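/- Let $\mathcal F$ be a singular holomorphic foliation of degree $d$ with isolated singularities on the complex projective plane $\mathbb P^2$, and let $\operatorname{Aut}(\mathcal F)$ be the group of biholomorphisms of $\mathbb P^2$ that carry $\mathcal F$ to itself. Suppose that $\operatorname{Aut}(\mathcal F)$ is finite and that there are homogeneous coordinates $[X:Y:Z]$ of $\mathbb P^2$ in which $$\operatorname{Aut}(\mathcal F)=\left\{[X:Y:Z]\mapsto[aX+bY:cX+eY:Z]\ :\ \begin{pmatrix}a&b\\c&e\end{pmatrix}\in G\right\}$$ for some (finite, necessarily non-abelian) subgroup $G$ of $\operatorname{GL}(2,\mathbb C)$ whose image in $\operatorname{PGL}(2,\mathbb C)$ is a tetrahedral, octahedral or icosahedral group, that is, isomorphic to $A_4$, $S_4$ or $A_5$. Then $$|\operatorname{Aut}(\mathcal F)|\ge 3(d^2+d+1)$$ if and only if $\mathcal F$ is projectively equivalent to one of the Bernoulli foliations $\mathcal P_5$ or $\mathcal P_{11}$. Here $\mathcal P_5$ (of degree $5$) and $\mathcal P_{11}$ (of degree $11$) are the foliations of $\mathbb P^2$ defined in the affine chart $(x,y)=[x:y:1]$ by the $1$-forms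 $$x\,dy-y\,dx+d\big(x^5y-xy^5\big)\quad\text{and}\quad x\,dy-y\,dx+d\big(x^{11}y+11x^6y^6-xy^{11}\big),$$ respectively. -/

import Mathlib

open scoped LinearAlgebra.Projectivization Topology

noncomputable section

namespace PlaneFoliation

/-- The complex projective plane. -/
abbrev Plane : Type := ℙ ℂ (Fin 3 → ℂ)

/-- The polynomial self-map of `ℂ³` whose components are the given polynomials. -/
def evalField (v : Fin 3 → MvPolynomial (Fin 3) ℂ) (z : Fin 3 → ℂ) : Fin 3 → ℂ :=
  fun i => MvPolynomial.eval z (v i)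

/-- A singular holomorphic foliation of degree `d` with isolated singularities on the complex
projective plane, presented by a homogeneous polynomial vector field of degree `d` on `ℂ³`.
The singular points are the points `[z]` at which the vector field is radial; the plane being
compact, they are isolated if and only if there are finitely many of them.  Different vector
fields may present the same foliation: what matters is only the field of planes
`Foliation.plane` below. -/
structure Foliation (d : ℕ) where
  /-- the components of the homogeneous vector field -/
  v : Fin 3 → MvPolynomial (Fin 3) ℂ
  homogeneous : ∀ i, (v i).IsHomogeneous d
  finite_singular : {p : Plane | ∃ c : ℂ, evalField v p.rep = c • p.rep}.Finite

/-- The plane in `ℂ³` spanned by `z` and by the vector field at `z`, that is the cone over the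
projective line tangent to the foliation at `[z]` (it is a line of `ℂ³` if `[z]` is singular). -/
def Foliation.plane {d : ℕ} (F : Foliation d) (z : Fin 3 → ℂ) : Submodule ℂ (Fin 3 → ℂ) :=
  Submodule.span ℂ {z, evalField F.v z}

/-- `Φ` is a holomorphic lift to `ℂ³ ∖ {0}`, near `z`, of the self-map `φ` of the plane. -/
def IsLiftAt (φ : Plane → Plane) (Φ : (Fin 3 → ℂ) → (Fin 3 → ℂ)) (z : Fin 3 → ℂ) : Prop :=
  AnalyticAt ℂ Φ z ∧
    ∀ᶠ w in 𝓝 z, ∃ (hw : w ≠ 0) (hΦ : Φ w ≠ 0),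
      φ (Projectivization.mk ℂ w hw) = Projectivization.mk ℂ (Φ w) hΦ

/-- `φ` is holomorphic and its differential maps the tangent line of `F` at each point onto the
tangent line of `F` at the image point (and singular points to singular points).  The condition
does not depend on the lift that is used to express it. -/
def Foliation.IsPreservedBy {d : ℕ} (F : Foliation d) (φ : Plane → Plane) : Prop :=
  ∀ z : Fin 3 → ℂ, z ≠ 0 → ∃ Φ : (Fin 3 → ℂ) → (Fin 3 → ℂ), IsLiftAt φ Φ z ∧
    Submodule.span ℂ {Φ z, fderiv ℂ Φ z (evalField F.v z)} = F.plane (Φ z)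

theorem Foliation.isPreservedBy_id {d : ℕ} (F : Foliation d) : F.IsPreservedBy id := by
  intro z hz
  refine ⟨id, ⟨analyticAt_id, ?_⟩, ?_⟩
  · filter_upwards [isOpen_ne.mem_nhds hz] with w hw
    exact ⟨hw, hw, rfl⟩
  · simp [Foliation.plane]

theorem IsLiftAt.fderiv_self_mem {φ : Plane → Plane} {Φ : (Fin 3 → ℂ) → (Fin 3 → ℂ)}
    {z : Fin 3 → ℂ} (h : IsLiftAt φ Φ z) :
    fderiv ℂ Φ z z ∈ Submodule.span ℂ {Φ z} := by
  obtain ⟨han, hev⟩ := h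
  obtain ⟨hz, hΦz, hφz⟩ := hev.self_of_nhds
  have hc : HasDerivAt (fun t : ℂ => t • z) z 1 := by
    simpa using (hasDerivAt_id (1 : ℂ)).smul_const z
  have hd : HasDerivAt (fun t : ℂ => Φ (t • z)) (fderiv ℂ Φ z z) 1 := by
    have h1 : HasFDerivAt Φ (fderiv ℂ Φ z) ((1 : ℂ) • z) := by
      simpa using han.differentiableAt.hasFDerivAt
    exact h1.comp_hasDerivAt (1 : ℂ) hc
  have hev' : ∀ᶠ t : ℂ in 𝓝 1, ∃ a : ℂ, Φ (t • z) = a • Φ z := by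
    have hcont : Filter.Tendsto (fun t : ℂ => t • z) (𝓝 1) (𝓝 z) := by
      simpa using hc.continuousAt.tendsto
    filter_upwards [hcont.eventually hev, isOpen_ne.mem_nhds (one_ne_zero (α := ℂ))]
      with t ht ht0
    obtain ⟨hw, hΦ, he⟩ := ht
    have : Projectivization.mk ℂ (t • z) hw = Projectivization.mk ℂ z hz :=
      (Projectivization.mk_eq_mk_iff' ℂ _ _ _ _).2 ⟨t, rfl⟩
    rw [this, hφz] at he
    obtain ⟨a, ha⟩ := (Projectivization.mk_eq_mk_iff' ℂ _ _ _ _).1 he.symm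
    exact ⟨a, ha.symm⟩
  obtain ⟨k, hk⟩ : ∃ k, Φ z k ≠ 0 := Function.ne_iff.1 hΦz
  have hcoord := hasDerivAt_pi.1 hd
  have hpar : ∀ i, Φ z k * fderiv ℂ Φ z z i - Φ z i * fderiv ℂ Φ z z k = 0 := by
    intro i
    have h1 := ((hcoord i).const_mul (Φ z k)).sub ((hcoord k).const_mul (Φ z i))
    refine h1.unique ((hasDerivAt_const (1 : ℂ) (0 : ℂ)).congr_of_eventuallyEq ?_)
    filter_upwards [hev'] with t ht
    obtain ⟨a, ha⟩ := ht
    simp only [Pi.sub_apply, ha, Pi.smul_apply, smul_eq_mul]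
    ring
  refine Submodule.mem_span_singleton.2 ⟨fderiv ℂ Φ z z k / Φ z k, ?_⟩
  ext i
  have := hpar i
  simp only [Pi.smul_apply, smul_eq_mul]
  field_simp
  linear_combination -this

theorem Foliation.IsPreservedBy.comp {d : ℕ} {F : Foliation d} {ψ φ : Plane → Plane}
    (hψ : F.IsPreservedBy ψ) (hφ : F.IsPreservedBy φ) : F.IsPreservedBy (ψ ∘ φ) := by
  intro z hz
  obtain ⟨Φ, ⟨hΦan, hΦev⟩, hΦ⟩ := hφ z hz
  obtain ⟨-, hΦz, -⟩ := hΦev.self_of_nhds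
  obtain ⟨Ψ, hΨl, hΨ⟩ := hψ (Φ z) hΦz
  have hmem := hΨl.fderiv_self_mem
  obtain ⟨hΨan, hΨev⟩ := hΨl
  refine ⟨Ψ ∘ Φ, ⟨hΨan.comp hΦan, ?_⟩, ?_⟩
  · filter_upwards [hΦev, hΦan.continuousAt.eventually hΨev] with w h1 h2
    obtain ⟨hw, hw', he⟩ := h1
    obtain ⟨hv, hv', he'⟩ := h2
    exact ⟨hw, hv', by simp only [Function.comp_apply, he, he']⟩
  · have hle : Submodule.span ℂ {fderiv ℂ Ψ (Φ z) (Φ z)} ≤ Submodule.span ℂ {Ψ (Φ z)} :=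
      (Submodule.span_singleton_le_iff_mem _ _).2 hmem
    have key : ∀ u : Fin 3 → ℂ,
        Submodule.span ℂ {Ψ (Φ z), fderiv ℂ Ψ (Φ z) u} = Submodule.span ℂ {Ψ (Φ z)} ⊔
          (Submodule.span ℂ {Φ z, u}).map (fderiv ℂ Ψ (Φ z)).toLinearMap := by
      intro u
      rw [Submodule.map_span, Set.image_pair, Submodule.span_insert, Submodule.span_insert,
        ← sup_assoc]
      congr 1
      exact (sup_eq_left.2 hle).symm
    rw [fderiv_comp z hΨan.differentiableAt hΦan.differentiableAt]
    simp only [Function.comp_apply, ContinuousLinearMap.comp_apply]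
    rw [key, hΦ, Foliation.plane, ← key, hΨ]

/-- The automorphism group of a foliation: the biholomorphisms of the plane that carry the
foliation to itself. -/
def Foliation.aut {d : ℕ} (F : Foliation d) : Subgroup (Equiv.Perm Plane) where
  carrier := {φ | F.IsPreservedBy φ ∧ F.IsPreservedBy φ.symm}
  one_mem' := ⟨F.isPreservedBy_id, F.isPreservedBy_id⟩
  mul_mem' := fun ha hb => ⟨ha.1.comp hb.1, hb.2.comp ha.2⟩
  inv_mem' := fun ha => ⟨ha.2, ha.1⟩

/-- Projective equivalence: some projective transformation carries `F` to `F'`. -/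
def Foliation.Equivalent {d d' : ℕ} (F : Foliation d) (F' : Foliation d') : Prop :=
  ∃ T : GL (Fin 3) ℂ, ∀ z : Fin 3 → ℂ, z ≠ 0 →
    (F.plane z).map (T : Matrix (Fin 3) (Fin 3) ℂ).mulVecLin =
      F'.plane ((T : Matrix (Fin 3) (Fin 3) ℂ).mulVec z)

/-- The projective transformation of the plane defined by an invertible matrix. -/
def projective : GL (Fin 3) ℂ →* Equiv.Perm Plane :=
  MulAction.toPermHom (GL (Fin 3) ℂ) Plane

/-- `GL(2, ℂ)` as the group of transformations `[X : Y : Z] ↦ [aX + bY : cX + dY : Z]`. -/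
def affineEmbedding : GL (Fin 2) ℂ →* GL (Fin 3) ℂ :=
  Units.map
    { toFun := fun A => !![A 0 0, A 0 1, 0; A 1 0, A 1 1, 0; 0, 0, 1]
      map_one' := by
        ext i j
        fin_cases i <;> fin_cases j <;> simp
      map_mul' := fun A B => by
        ext i j
        fin_cases i <;> fin_cases j <;> simp [Matrix.mul_apply, Fin.sum_univ_succ] }

/-- The projectivization in `PGL(2, ℂ)` of a subgroup of `GL(2, ℂ)`. -/
def projectivization (G : Subgroup (GL (Fin 2) ℂ)) :
    Subgroup (Matrix.ProjGenLinGroup (Fin 2) ℂ) :=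
  G.map (Matrix.ProjGenLinGroup.mk : GL (Fin 2) ℂ →* Matrix.ProjGenLinGroup (Fin 2) ℂ)

/-- Tetrahedral, octahedral or icosahedral subgroups of `PGL(2, ℂ)`: those isomorphic to
`A₄`, `S₄` or `A₅`. -/
def IsPolyhedral (K : Subgroup (Matrix.ProjGenLinGroup (Fin 2) ℂ)) : Prop :=
  Nonempty (K ≃* alternatingGroup (Fin 4)) ∨
  Nonempty (K ≃* Equiv.Perm (Fin 4)) ∨
  Nonempty (K ≃* alternatingGroup (Fin 5))

/-- For a homogeneous polynomial `P` in the first two variables, of degree `n + 2`, the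
homogeneous vector field of degree `n + 1` that defines the same foliation as the `1`-form
`x dy - y dx + dP` in the affine chart `(x, y) = [x : y : 1]`: the vector field
`-(x + ∂P/∂y) ∂x + (∂P/∂x - y) ∂y`, homogenized. -/
def bernoulliField (n : ℕ) (P : MvPolynomial (Fin 3) ℂ) : Fin 3 → MvPolynomial (Fin 3) ℂ :=
  ![-(MvPolynomial.X 0 * MvPolynomial.X 2 ^ n + MvPolynomial.pderiv 1 P),
    MvPolynomial.pderiv 0 P - MvPolynomial.X 1 * MvPolynomial.X 2 ^ n,
    0]

theorem bernoulliField_homogeneous {n : ℕ} {P : MvPolynomial (Fin 3) ℂ}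
    (hP : P.IsHomogeneous (n + 2)) (i : Fin 3) :
    (bernoulliField n P i).IsHomogeneous (n + 1) := by
  have h (k j : Fin 3) : (MvPolynomial.X k * MvPolynomial.X j ^ n :
      MvPolynomial (Fin 3) ℂ).IsHomogeneous (n + 1) := by
    have := (MvPolynomial.isHomogeneous_X ℂ k).mul ((MvPolynomial.isHomogeneous_X ℂ j).pow n)
    rwa [show 1 + 1 * n = n + 1 by ring] at this
  have h0 : (MvPolynomial.pderiv 0 P).IsHomogeneous (n + 1) := hP.pderiv
  have h1 : (MvPolynomial.pderiv 1 P).IsHomogeneous (n + 1) := hP.pderiv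
  fin_cases i
  · exact ((h 0 2).add h1).neg
  · exact h0.sub (h 1 2)
  · exact MvPolynomial.isHomogeneous_zero _ _ _

/-- In the affine chart, the vector field of `bernoulliField` is annihilated by the `1`-form
`x dy - y dx + dP = (∂P/∂x - y) dx + (∂P/∂y + x) dy`. -/
theorem bernoulliField_form (n : ℕ) (P : MvPolynomial (Fin 3) ℂ) (x y : ℂ) :
    let v := evalField (bernoulliField n P) ![x, y, 1]
    (MvPolynomial.eval ![x, y, 1] (MvPolynomial.pderiv 0 P) - y) * (v 0 - x * v 2) +
      (MvPolynomial.eval ![x, y, 1] (MvPolynomial.pderiv 1 P) + x) * (v 1 - y * v 2) = 0 := by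
  simp [evalField, bernoulliField]
  ring

theorem finite_pow_mul_eq {n : ℕ} (hn : n ≠ 0) (k b : ℂ) (hb : b ≠ 0) :
    {s : ℂ | s ^ n * k = b}.Finite := by
  have hne : (Polynomial.C k * Polynomial.X ^ n - Polynomial.C b : Polynomial ℂ) ≠ 0 := by
    intro h
    have := congrArg (Polynomial.eval 0) h
    simp [hn] at this
    exact hb this
  refine (Polynomial.finite_setOfPred_isRoot hne).subset ?_
  intro s hs
  simp only [Set.mem_ofPred_eq] at hs
  simp only [Set.mem_ofPred_eq, Polynomial.IsRoot.def, Polynomial.eval_sub, Polynomial.eval_mul,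
    Polynomial.eval_C, Polynomial.eval_pow, Polynomial.eval_X]
  linear_combination hs

theorem finite_singular_aux {n : ℕ} (hn : n ≠ 0) (f g : ℂ → ℂ → ℂ)
    (hf : ∀ s a b, f (s * a) (s * b) = s ^ (n + 1) * f a b)
    (hg : ∀ s a b, g (s * a) (s * b) = s ^ (n + 1) * g a b)
    (hR : {t : ℂ | t * f t 1 + g t 1 = 0}.Finite)
    (v : (Fin 3 → ℂ) → (Fin 3 → ℂ))
    (hv : ∀ z, v z = ![-(z 0 * z 2 ^ n + g (z 0) (z 1)), f (z 0) (z 1) - z 1 * z 2 ^ n, 0]) :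
    {p : Plane | ∃ c : ℂ, v p.rep = c • p.rep}.Finite := by
  set D : Set (ℂ × ℂ) :=
    insert (1, 0) ((fun t : ℂ => (t, (1 : ℂ))) '' {t : ℂ | t * f t 1 + g t 1 = 0}) with hD
  have hDfin : D.Finite := (hR.image _).insert _
  have hD0 : ∀ q ∈ D, q.1 ≠ 0 ∨ q.2 ≠ 0 := by
    rintro q (rfl | ⟨t, -, rfl⟩) <;> simp
  set S : ℂ × ℂ → Set ℂ := fun q => {s | s ^ n * f q.1 q.2 = q.2 ∧ s ^ n * g q.1 q.2 = -q.1}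
    with hS
  have hSfin : ∀ q ∈ D, (S q).Finite := by
    intro q hq
    rcases hD0 q hq with h | h
    · exact (finite_pow_mul_eq hn _ _ (neg_ne_zero.2 h)).subset fun s hs => hs.2
    · exact (finite_pow_mul_eq hn _ _ h).subset fun s hs => hs.1
  set W : Set (Fin 3 → ℂ) := insert ![0, 0, 1] (((fun q : ℂ × ℂ => ![q.1, q.2, 0]) '' D) ∪
    ⋃ q ∈ D, (fun s : ℂ => ![s * q.1, s * q.2, 1]) '' S q) with hW
  have hWfin : W.Finite :=
    ((hDfin.image _).union (hDfin.biUnion fun q hq => (hSfin q hq).image _)).insert _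
  have hdir : ∀ x y : ℂ, (x ≠ 0 ∨ y ≠ 0) → x * f x y + y * g x y = 0 →
      ∃ q ∈ D, ∃ s : ℂ, s ≠ 0 ∧ x = s * q.1 ∧ y = s * q.2 := by
    intro x y hxy h
    by_cases hy : y = 0
    · subst hy
      exact ⟨(1, 0), Set.mem_insert _ _, x, by simpa using hxy, by simp, by simp⟩
    · refine ⟨(x / y, 1), Set.mem_insert_of_mem _ ⟨x / y, ?_, rfl⟩, y, hy, ?_, by simp⟩
      · have e1 : f x y = y ^ (n + 1) * f (x / y) 1 := by
          rw [← hf]; congr 1 <;> field_simp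
        have e2 : g x y = y ^ (n + 1) * g (x / y) 1 := by
          rw [← hg]; congr 1 <;> field_simp
        rw [e1, e2] at h
        have h3 : y ^ (n + 2) * (x / y * f (x / y) 1 + g (x / y) 1) = 0 := by
          rw [← h]
          field_simp
          ring
        exact (mul_eq_zero.1 h3).resolve_left (pow_ne_zero _ hy)
      · field_simp
  have hcover : {p : Plane | ∃ c : ℂ, v p.rep = c • p.rep} ⊆
      ⋃ w ∈ W, {p : Plane | ∃ c : ℂ, p.rep = c • w} := by
    rintro p ⟨c, hc⟩
    rw [hv] at hc
    have hp := p.rep_nonzero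
    generalize hz : p.rep = z at hc hp
    have c0 := congrFun hc 0
    have c1 := congrFun hc 1
    have c2 := congrFun hc 2
    simp only [Matrix.cons_val, Pi.smul_apply, smul_eq_mul] at c0 c1 c2
    suffices ∃ w ∈ W, ∃ c : ℂ, z = c • w by
      obtain ⟨w, hw, hcw⟩ := this
      exact Set.mem_biUnion hw (by simpa only [Set.mem_ofPred_eq, hz] using hcw)
    by_cases h2 : z 2 = 0
    · have hxy : z 0 ≠ 0 ∨ z 1 ≠ 0 := by
        by_contra! hcon
        refine hp ?_
        ext i
        fin_cases i
        · exact hcon.1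
        · exact hcon.2
        · exact h2
      have hz0 : z 2 ^ n = 0 := by rw [h2, zero_pow hn]
      rw [hz0] at c0 c1
      obtain ⟨q, hq, s, -, e0, e1⟩ := hdir (z 0) (z 1) hxy (by
        linear_combination z 0 * c1 - z 1 * c0)
      refine ⟨_, Set.mem_insert_of_mem _ (Or.inl ⟨q, hq, rfl⟩), s, ?_⟩
      ext i
      fin_cases i
      · simpa using e0
      · simpa using e1
      · simpa using h2
    · have hc0 : c = 0 := (mul_eq_zero.1 c2.symm).resolve_right h2
      subst hc0
      rw [zero_mul] at c0 c1
      by_cases hxy : z 0 ≠ 0 ∨ z 1 ≠ 0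
      · obtain ⟨q, hq, s, hs, e0, e1⟩ := hdir (z 0) (z 1) hxy (by
          linear_combination z 0 * c1 - z 1 * c0)
        refine ⟨![s / z 2 * q.1, s / z 2 * q.2, 1], Set.mem_insert_of_mem _ (Or.inr
          (Set.mem_biUnion hq ⟨s / z 2, ⟨?_, ?_⟩, rfl⟩)), z 2, ?_⟩
        · rw [e0, e1, hf] at c1
          rw [div_pow]
          field_simp
          refine mul_left_cancel₀ hs ?_
          linear_combination c1
        · rw [e0, e1, hg] at c0
          rw [div_pow]
          field_simp
          refine mul_left_cancel₀ hs ?_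
          linear_combination -c0
        · ext i
          fin_cases i
          · simp only [Fin.zero_eta, Pi.smul_apply, Matrix.cons_val, smul_eq_mul, e0]
            field_simp
          · simp only [Fin.mk_one, Pi.smul_apply, Matrix.cons_val, smul_eq_mul, e1]
            field_simp
          · simp
      · push Not at hxy
        refine ⟨_, Set.mem_insert _ _, z 2, ?_⟩
        ext i
        fin_cases i
        · simpa using hxy.1
        · simpa using hxy.2
        · simp
  refine (hWfin.biUnion fun w _ => ?_).subset hcover
  refine Set.Subsingleton.finite ?_
  rintro p ⟨c, hc⟩ p' ⟨c', hc'⟩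
  have hc0 : c' ≠ 0 := by
    rintro rfl
    exact p'.rep_nonzero (by simpa using hc')
  rw [← p.mk_rep, ← p'.mk_rep]
  refine (Projectivization.mk_eq_mk_iff' ℂ _ _ _ _).2 ⟨c / c', ?_⟩
  rw [hc', hc, smul_smul, div_mul_cancel₀ _ hc0]

/-- `x⁵y - xy⁵` -/
def octahedralForm : MvPolynomial (Fin 3) ℂ :=
  MvPolynomial.X 0 ^ 5 * MvPolynomial.X 1 - MvPolynomial.X 0 * MvPolynomial.X 1 ^ 5

/-- `x¹¹y + 11x⁶y⁶ - xy¹¹` -/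
def icosahedralForm : MvPolynomial (Fin 3) ℂ :=
  MvPolynomial.X 0 ^ 11 * MvPolynomial.X 1
    + MvPolynomial.C 11 * (MvPolynomial.X 0 ^ 6 * MvPolynomial.X 1 ^ 6)
    - MvPolynomial.X 0 * MvPolynomial.X 1 ^ 11

theorem isHomogeneous_mono (a b : ℕ) :
    (MvPolynomial.X 0 ^ a * MvPolynomial.X 1 ^ b : MvPolynomial (Fin 3) ℂ).IsHomogeneous
      (a + b) := by
  have := ((MvPolynomial.isHomogeneous_X ℂ (0 : Fin 3)).pow a).mul
    ((MvPolynomial.isHomogeneous_X ℂ (1 : Fin 3)).pow b)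
  simpa using this

theorem octahedralForm_homogeneous : octahedralForm.IsHomogeneous 6 := by
  have h1 := isHomogeneous_mono 5 1
  have h2 := isHomogeneous_mono 1 5
  rw [pow_one] at h1 h2
  exact h1.sub h2

theorem icosahedralForm_homogeneous : icosahedralForm.IsHomogeneous 12 := by
  have h1 := isHomogeneous_mono 11 1
  have h2 := isHomogeneous_mono 6 6
  have h3 := isHomogeneous_mono 1 11
  rw [pow_one] at h1 h3
  exact (h1.add (h2.C_mul 11)).sub h3

/-- The Bernoulli foliation `P₅` of degree 5, defined by `x dy - y dx + d(x⁵y - xy⁵)`. -/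
def bernoulliFive : Foliation 5 where
  v := bernoulliField 4 octahedralForm
  homogeneous := bernoulliField_homogeneous octahedralForm_homogeneous
  finite_singular := by
    refine finite_singular_aux (n := 4) (by norm_num)
      (fun x y => 5 * x ^ 4 * y - y ^ 5) (fun x y => x ^ 5 - 5 * x * y ^ 4)
      (fun s a b => by ring) (fun s a b => by ring) ?_ _ ?_
    · have hne : (Polynomial.X ^ 5 - Polynomial.X : Polynomial ℂ) ≠ 0 := by
        intro h
        have := congrArg (Polynomial.eval 2) h
        norm_num at this
      refine (Polynomial.finite_setOfPred_isRoot hne).subset fun t ht => ?_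
      simp only [Set.mem_ofPred_eq] at ht
      simp only [Set.mem_ofPred_eq, Polynomial.IsRoot.def, Polynomial.eval_sub,
        Polynomial.eval_pow, Polynomial.eval_X]
      linear_combination ht / 6
    · intro z
      ext i
      fin_cases i
      · simp [evalField, bernoulliField, octahedralForm, MvPolynomial.pderiv_X]
        ring
      · simp [evalField, bernoulliField, octahedralForm, MvPolynomial.pderiv_X]
        ring
      · simp [evalField, bernoulliField]

/-- The Bernoulli foliation `P₁₁` of degree 11, defined by
`x dy - y dx + d(x¹¹y + 11x⁶y⁶ - xy¹¹)`. -/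
def bernoulliEleven : Foliation 11 where
  v := bernoulliField 10 icosahedralForm
  homogeneous := bernoulliField_homogeneous icosahedralForm_homogeneous
  finite_singular := by
    refine finite_singular_aux (n := 10) (by norm_num)
      (fun x y => 11 * x ^ 10 * y + 66 * x ^ 5 * y ^ 6 - y ^ 11)
      (fun x y => x ^ 11 + 66 * x ^ 6 * y ^ 5 - 11 * x * y ^ 10)
      (fun s a b => by ring) (fun s a b => by ring) ?_ _ ?_
    · have hne : (Polynomial.X ^ 11 + 11 * Polynomial.X ^ 6 - Polynomial.X :
          Polynomial ℂ) ≠ 0 := by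
        intro h
        have := congrArg (Polynomial.eval 2) h
        norm_num at this
      refine (Polynomial.finite_setOfPred_isRoot hne).subset fun t ht => ?_
      simp only [Set.mem_ofPred_eq] at ht
      simp only [Set.mem_ofPred_eq, Polynomial.IsRoot.def, Polynomial.eval_sub,
        Polynomial.eval_add, Polynomial.eval_mul, Polynomial.eval_pow, Polynomial.eval_X,
        Polynomial.eval_ofNat]
      linear_combination ht / 12
    · intro z
      ext i
      fin_cases i
      · simp [evalField, bernoulliField, icosahedralForm, MvPolynomial.pderiv_X]
        ring
      · simp [evalField, bernoulliField, icosahedralForm, MvPolynomial.pderiv_X]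
        ring
      · simp [evalField, bernoulliField]

end PlaneFoliation

end

/-! The tangent plane of a foliation over `[z]` is recorded by `z ∧ v(z)`, whose coordinates are
three forms of degree `d + 1`. Isolated singularities leave these forms without a common factor, so
two foliations with the same planes have the same degree and proportional `z ∧ v(z)`
(`Foliation.wedge_eq_of_plane_eq`). In the chart `t = 1` the first two coordinates form a planar
field, with homogeneous parts `(a_j, b_j)`; a linear automorphism `A` in `G` carries this field to a
multiple of itself, with one constant for all parts (`Parts.fieldScaled`).

By Euler's identity a part is determined by its divergence `h_j`, of degree `j - 1`, and by `Q_j = x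
b_j - y a_j`, of degree `j + 1`. Both are semi-invariants of the image `K` of `G` in `PGL₂`. A
semi-invariant binary form is a product of orbit forms on the projective line, and stabilizers of
points are cyclic, so orbits have at least 4 points for `A₄`, 6 or at least 8 for `S₄`, 12 or at
least 20 for `A₅`. Few degrees are therefore possible.

If a single degree `j` occurred, every homothety would be an automorphism, against finiteness. So
two degrees `i < j` occur; a scalar `c` in `G` satisfies `c ^ (j - i) = 1`, whence `|G| ≤ |K| (j -
i) ≤ |K| d`. Against `3(d² + d + 1) ≤ |G|` this gives `d ≤ 2`, `6`, `18` in the three cases. In that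
range the semi-invariants leave nothing for `A₄`, and for the other groups only a radial linear
field plus the Hamiltonian field of a semi-invariant `Q_d` of degree 6 or 12 (`Parts.normal_form`).

Such a `Q_d` is the form of an orbit whose points have stabilizers of order 4 or 5. Diagonalizing a
generator of a stabilizer kills all monomials but `x⁵y, xy⁵`, respectively `x¹¹y, x⁶y⁶, xy¹¹`.
Scaling the coordinates finishes the octahedral case. In the icosahedral case the fourth
transvectant has degree 16, where no semi-invariant lives, and its vanishing fixes the middle
coefficient.

Conversely, explicit matrices give 96 automorphisms of `P₅` and 500 of `P₁₁`, while the bounds are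
93 and 399. -/

noncomputable section

/-! ### Tangent planes as wedge products, and projective automorphisms in linear terms -/

namespace PlaneFoliation

/-- The coordinates of `p ∧ a`. -/
def wedge (p a : Fin 3 → ℂ) : Fin 3 → ℂ :=
  ![p 2 * a 0 - p 0 * a 2, p 2 * a 1 - p 1 * a 2, p 0 * a 1 - p 1 * a 0]

theorem wedge_add (p a b : Fin 3 → ℂ) : wedge p (a + b) = wedge p a + wedge p b := by
  ext i; fin_cases i <;> simp [wedge] <;> ring

theorem wedge_smul (p a : Fin 3 → ℂ) (c : ℂ) : wedge p (c • a) = c • wedge p a := by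
  ext i; fin_cases i <;> simp [wedge] <;> ring

theorem wedge_self (p : Fin 3 → ℂ) : wedge p p = 0 := by
  ext i; fin_cases i <;> simp [wedge] <;> ring

theorem smul_wedge (p a : Fin 3 → ℂ) (c : ℂ) : wedge (c • p) a = c • wedge p a := by
  ext i; fin_cases i <;> simp [wedge] <;> ring

theorem wedge_eq_zero_iff {p a : Fin 3 → ℂ} (hp : p ≠ 0) :
    wedge p a = 0 ↔ ∃ c : ℂ, a = c • p := by
  constructor
  · intro h
    have h0 := congrFun h 0
    have h1 := congrFun h 1
    have h2 := congrFun h 2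
    simp only [wedge, Matrix.cons_val, Pi.zero_apply] at h0 h1 h2
    obtain ⟨k, hk⟩ := Function.ne_iff.1 hp
    refine ⟨a k / p k, ?_⟩
    have hk' : p k ≠ 0 := hk
    ext i
    simp only [Pi.smul_apply, smul_eq_mul]
    rw [eq_comm, div_mul_eq_mul_div, div_eq_iff hk']
    fin_cases k <;> fin_cases i <;> simp only [Fin.zero_eta, Fin.mk_one, Fin.reduceFinMk] <;> first
    | ring1
    | linear_combination h0
    | linear_combination h1
    | linear_combination h2
    | linear_combination (-1 : ℂ) * h0
    | linear_combination (-1 : ℂ) * h1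
    | linear_combination (-1 : ℂ) * h2
  · rintro ⟨c, rfl⟩
    rw [wedge_smul, wedge_self, smul_zero]

theorem span_pair_eq_iff {p a b : Fin 3 → ℂ} (hp : p ≠ 0) :
    Submodule.span ℂ {p, a} = Submodule.span ℂ {p, b} ↔
      ∃ c : ℂ, c ≠ 0 ∧ wedge p a = c • wedge p b := by
  constructor
  · intro h
    have ha : a ∈ Submodule.span ℂ {p, b} := h ▸ Submodule.subset_span (by simp)
    have hb : b ∈ Submodule.span ℂ {p, a} := h ▸ Submodule.subset_span (by simp)
    obtain ⟨s, c, rfl⟩ := Submodule.mem_span_pair.1 ha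
    obtain ⟨s', c', hb⟩ := Submodule.mem_span_pair.1 hb
    have e := congrArg (wedge p) hb
    simp only [wedge_add, wedge_smul, wedge_self, smul_zero, zero_add] at e ⊢
    -- If `c = 0`, then `a`, and hence `b`, is a multiple of `p`; both wedges vanish and any nonzero
    -- factor will do.
    rcases eq_or_ne c 0 with rfl | hc
    · refine ⟨1, one_ne_zero, ?_⟩
      rw [← e]
      simp
    · exact ⟨c, hc, rfl⟩
  · rintro ⟨c, hc, h⟩
    have h0 : wedge p (a + (-c) • b) = 0 := by
      rw [wedge_add, wedge_smul, h, ← add_smul, add_neg_cancel, zero_smul]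
    obtain ⟨s, hs⟩ := (wedge_eq_zero_iff hp).1 h0
    have ha : a = s • p + c • b := by
      rw [← hs, add_assoc, ← add_smul, neg_add_cancel, zero_smul, add_zero]
    have hb : b = (-(s / c)) • p + c⁻¹ • a := by
      rw [ha, smul_add, smul_smul, smul_smul, inv_mul_cancel₀ hc, ← add_assoc, ← add_smul]
      rw [show -(s / c) + c⁻¹ * s = 0 by field_simp; ring]
      simp
    refine le_antisymm (Submodule.span_le.2 ?_) (Submodule.span_le.2 ?_)
    · rintro x (rfl | rfl)
      · exact Submodule.subset_span (by simp)
      · exact Submodule.mem_span_pair.2 ⟨s, c, ha.symm⟩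
    · rintro x (rfl | rfl)
      · exact Submodule.subset_span (by simp)
      · exact Submodule.mem_span_pair.2 ⟨_, _, hb.symm⟩

/-- The action of a linear map on `p ∧ a` when the linear map preserves the last coordinate. -/
theorem wedge_affine (A : GL (Fin 2) ℂ) (p a : Fin 3 → ℂ) :
    wedge ((affineEmbedding A : Matrix (Fin 3) (Fin 3) ℂ).mulVec p)
      ((affineEmbedding A : Matrix (Fin 3) (Fin 3) ℂ).mulVec a) =
    ![A 0 0 * wedge p a 0 + A 0 1 * wedge p a 1, A 1 0 * wedge p a 0 + A 1 1 * wedge p a 1,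
      (A 0 0 * A 1 1 - A 0 1 * A 1 0) * wedge p a 2] := by
  ext i
  fin_cases i <;> simp [wedge, affineEmbedding, Matrix.mulVec, dotProduct, Fin.sum_univ_succ]
    <;> ring

theorem mulVec_ne_zero {n : ℕ} (g : GL (Fin n) ℂ) {z : Fin n → ℂ} (hz : z ≠ 0) :
    (g : Matrix (Fin n) (Fin n) ℂ).mulVec z ≠ 0 :=
  (smul_ne_zero_iff_ne g).2 hz

theorem map_plane {d : ℕ} (F : Foliation d) (M : Matrix (Fin 3) (Fin 3) ℂ) (z : Fin 3 → ℂ) :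
    (F.plane z).map M.mulVecLin = Submodule.span ℂ {M.mulVec z, M.mulVec (evalField F.v z)} := by
  rw [Foliation.plane, Submodule.map_span, Set.image_pair]
  rfl

/-- A lift of a projective transformation is the linear map up to a scalar function. -/
theorem IsLiftAt.span_fderiv {g : GL (Fin 3) ℂ} {Φ : (Fin 3 → ℂ) → (Fin 3 → ℂ)}
    {z : Fin 3 → ℂ} (h : IsLiftAt (projective g) Φ z) (u : Fin 3 → ℂ) :
    (∃ c : ℂ, c ≠ 0 ∧ Φ z = c • (g : Matrix (Fin 3) (Fin 3) ℂ).mulVec z) ∧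
    Submodule.span ℂ {Φ z, fderiv ℂ Φ z u} =
      Submodule.span ℂ {(g : Matrix (Fin 3) (Fin 3) ℂ).mulVec z,
        (g : Matrix (Fin 3) (Fin 3) ℂ).mulVec u} := by
  obtain ⟨han, hev⟩ := h
  set M : Matrix (Fin 3) (Fin 3) ℂ := (g : Matrix (Fin 3) (Fin 3) ℂ) with hM
  have hev' : ∀ᶠ w in 𝓝 z, ∃ c : ℂ, c ≠ 0 ∧ Φ w = c • M.mulVec w := by
    filter_upwards [hev] with w hw
    obtain ⟨hw, hΦ, he⟩ := hw
    have he' : Projectivization.mk ℂ (M.mulVec w) (mulVec_ne_zero g hw) =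
      Projectivization.mk ℂ (Φ w) hΦ := he
    obtain ⟨a, ha⟩ := (Projectivization.mk_eq_mk_iff' ℂ _ _ _ _).1 he'.symm
    refine ⟨a, ?_, ha.symm⟩
    rintro rfl
    exact hΦ (by rw [← ha, zero_smul])
  obtain ⟨c, hc, hcz⟩ := hev'.self_of_nhds
  obtain ⟨hz, hΦz, -⟩ := hev.self_of_nhds
  have hMz : M.mulVec z ≠ 0 := mulVec_ne_zero g hz
  refine ⟨⟨c, hc, hcz⟩, ?_⟩
  obtain ⟨k, hk⟩ : ∃ k, M.mulVec z k ≠ 0 := Function.ne_iff.1 hMz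
  let L : (Fin 3 → ℂ) →L[ℂ] (Fin 3 → ℂ) := LinearMap.toContinuousLinearMap M.mulVecLin
  have hL : ∀ w, L w = M.mulVec w := fun w => rfl
  have hd : ∀ i, HasFDerivAt (fun w => Φ w i) ((ContinuousLinearMap.proj i).comp (fderiv ℂ Φ z)) z := 
    hasFDerivAt_pi'.1 han.differentiableAt.hasFDerivAt
  have hLd : ∀ i, HasFDerivAt (fun w => L w i) ((ContinuousLinearMap.proj i).comp L) z :=
    hasFDerivAt_pi'.1 (L.hasFDerivAt (x := z))
  -- Near `z`, `Φ w` is a multiple of `M w`, by a factor not known to be differentiable.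
  -- Differentiating the cross-multiplied identity `(M w)_k Φ_i = (M w)_i Φ_k` avoids
  -- differentiating the factor.
  have hpar : ∀ i, M.mulVec z k * fderiv ℂ Φ z u i + Φ z i * M.mulVec u k =
      M.mulVec z i * fderiv ℂ Φ z u k + Φ z k * M.mulVec u i := by
    intro i
    have h1 := ((hLd k).mul (hd i))
    have h2 := ((hLd i).mul (hd k))
    have h3 : (fun w => L w k) * (fun w => Φ w i) =ᶠ[𝓝 z] (fun w => L w i) * (fun w => Φ w k) := by
      filter_upwards [hev'] with w hw
      obtain ⟨c, -, hw⟩ := hw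
      simp only [Pi.mul_apply, hw, hL, Pi.smul_apply, smul_eq_mul]
      ring
    have h4 := congrArg (fun f : (Fin 3 → ℂ) →L[ℂ] ℂ => f u) (h1.unique (h2.congr_of_eventuallyEq h3))
    simpa [hL] using h4
  have hfd : ∃ s : ℂ, fderiv ℂ Φ z u = s • M.mulVec z + c • M.mulVec u := by
    refine ⟨(fderiv ℂ Φ z u k - c * M.mulVec u k) / M.mulVec z k, ?_⟩
    ext i
    have := hpar i
    rw [hcz] at this
    simp only [Pi.smul_apply, smul_eq_mul, Pi.add_apply] at this ⊢
    field_simp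
    linear_combination this
  obtain ⟨s, hs⟩ := hfd
  have e1 : Submodule.span ℂ {Φ z, fderiv ℂ Φ z u} =
      Submodule.span ℂ {M.mulVec z, fderiv ℂ Φ z u} := by
    rw [hcz, Submodule.span_insert, Submodule.span_insert, Submodule.span_singleton_smul_eq hc.isUnit]
  rw [e1, span_pair_eq_iff hMz]
  exact ⟨c, hc, by rw [hs, wedge_add, wedge_smul, wedge_smul, wedge_self, smul_zero, zero_add]⟩

theorem eval_smul_of_isHomogeneous {σ : Type*} [Fintype σ] {f : MvPolynomial σ ℂ} {d : ℕ}
    (hf : f.IsHomogeneous d) (a : ℂ) (z : σ → ℂ) :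
    MvPolynomial.eval (a • z) f = a ^ d * MvPolynomial.eval z f := by
  have h : a • z = fun i => a * z i := rfl
  rw [MvPolynomial.eval_eq, MvPolynomial.eval_eq, Finset.mul_sum]
  refine Finset.sum_congr rfl fun m hm => ?_
  have hdeg := hf.degree_eq_sum_deg_support hm
  simp only [h, mul_pow, Finset.prod_mul_distrib, Finset.prod_pow_eq_pow_sum]
  rw [hdeg]
  ring

theorem evalField_smul {d : ℕ} {v : Fin 3 → MvPolynomial (Fin 3) ℂ}
    (hv : ∀ i, (v i).IsHomogeneous d) (a : ℂ) (z : Fin 3 → ℂ) :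
    evalField v (a • z) = a ^ d • evalField v z := by
  ext i
  simp only [evalField, Pi.smul_apply, smul_eq_mul]
  exact eval_smul_of_isHomogeneous (hv i) a z

theorem Foliation.plane_smul {d : ℕ} (F : Foliation d) {c : ℂ} (hc : c ≠ 0) (z : Fin 3 → ℂ) :
    F.plane (c • z) = F.plane z := by
  rw [Foliation.plane, Foliation.plane, evalField_smul F.homogeneous, Submodule.span_insert,
    Submodule.span_insert, Submodule.span_singleton_smul_eq hc.isUnit,
    Submodule.span_singleton_smul_eq (pow_ne_zero d hc).isUnit]

/-- Bridge from the analytic definition of an automorphism to linear algebra: every lift spans the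
same planes as the matrix itself, and the matrix is one of the lifts. -/
theorem Foliation.isPreservedBy_projective_iff {d : ℕ} (F : Foliation d) (g : GL (Fin 3) ℂ) :
    F.IsPreservedBy (projective g) ↔ ∀ z : Fin 3 → ℂ, z ≠ 0 →
      (F.plane z).map (g : Matrix (Fin 3) (Fin 3) ℂ).mulVecLin =
        F.plane ((g : Matrix (Fin 3) (Fin 3) ℂ).mulVec z) := by
  constructor
  · intro h z hz
    obtain ⟨Φ, hΦ, he⟩ := h z hz
    obtain ⟨⟨c, hc, hcz⟩, h2⟩ := hΦ.span_fderiv (evalField F.v z)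
    rw [map_plane, ← h2, he, hcz, F.plane_smul hc]
  · intro h z hz
    let L : (Fin 3 → ℂ) →L[ℂ] (Fin 3 → ℂ) :=
      LinearMap.toContinuousLinearMap (g : Matrix (Fin 3) (Fin 3) ℂ).mulVecLin
    refine ⟨L, ⟨L.analyticAt z, ?_⟩, ?_⟩
    · filter_upwards [isOpen_ne.mem_nhds hz] with w hw
      exact ⟨hw, mulVec_ne_zero g hw, rfl⟩
    · rw [L.fderiv]
      exact (map_plane F _ z).symm.trans (h z hz)

/-- A homogeneous vector field is radial at a point if and only if it is radial at any
representative of it. -/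
theorem singular_iff {d : ℕ} {v : Fin 3 → MvPolynomial (Fin 3) ℂ}
    (hv : ∀ i, (v i).IsHomogeneous d) {z : Fin 3 → ℂ} (hz : z ≠ 0) :
    (∃ c : ℂ, evalField v (Projectivization.mk ℂ z hz).rep =
      c • (Projectivization.mk ℂ z hz).rep) ↔ wedge z (evalField v z) = 0 := by
  obtain ⟨a, ha⟩ := Projectivization.exists_smul_eq_mk_rep ℂ z hz
  have ha' : (Projectivization.mk ℂ z hz).rep = (a : ℂ) • z := ha.symm
  rw [← wedge_eq_zero_iff (Projectivization.rep_nonzero _), ha', evalField_smul hv, wedge_smul,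
    smul_wedge, smul_smul]
  exact smul_eq_zero_iff_right (mul_ne_zero (pow_ne_zero _ a.ne_zero) a.ne_zero)

theorem Foliation.finite_wedge {d : ℕ} (F : Foliation d) :
    {p : Plane | ∃ (z : Fin 3 → ℂ) (hz : z ≠ 0), p = Projectivization.mk ℂ z hz ∧
      wedge z (evalField F.v z) = 0}.Finite := by
  refine F.finite_singular.subset ?_
  rintro p ⟨z, hz, rfl, h⟩
  exact (singular_iff F.homogeneous hz).2 h

/-- The components of the pull-back of a polynomial vector field by a linear map. -/
def pullback (T : GL (Fin 3) ℂ) (v : Fin 3 → MvPolynomial (Fin 3) ℂ) (i : Fin 3) :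
    MvPolynomial (Fin 3) ℂ :=
  ∑ j, MvPolynomial.C ((T⁻¹ : GL (Fin 3) ℂ) i j) *
    MvPolynomial.aeval (fun k => ∑ l, MvPolynomial.C (T k l) * MvPolynomial.X l) (v j)

theorem evalField_pullback (T : GL (Fin 3) ℂ) (v : Fin 3 → MvPolynomial (Fin 3) ℂ)
    (z : Fin 3 → ℂ) : evalField (pullback T v) z =
      ((T⁻¹ : GL (Fin 3) ℂ) : Matrix (Fin 3) (Fin 3) ℂ).mulVec
        (evalField v ((T : Matrix (Fin 3) (Fin 3) ℂ).mulVec z)) := by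
  ext i
  simp only [evalField, pullback, map_sum, map_mul, MvPolynomial.eval_C, Matrix.mulVec, dotProduct]
  refine Finset.sum_congr rfl fun j _ => ?_
  congr 1
  induction v j using MvPolynomial.induction_on with
  | C a => simp
  | add p q hp hq => simp only [map_add, hp, hq]
  | mul_X p k hp =>
    rw [map_mul, map_mul, map_mul, hp]
    simp [Matrix.mulVec, dotProduct]

theorem pullback_homogeneous {d : ℕ} (T : GL (Fin 3) ℂ) {v : Fin 3 → MvPolynomial (Fin 3) ℂ}
    (hv : ∀ i, (v i).IsHomogeneous d) (i : Fin 3) : (pullback T v i).IsHomogeneous d :=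
  MvPolynomial.IsHomogeneous.sum _ _ _ fun j _ => MvPolynomial.IsHomogeneous.C_mul (by
    have := (hv j).aeval (fun k => ∑ l, MvPolynomial.C (T k l) * MvPolynomial.X l) (n := 1)
      fun k => MvPolynomial.IsHomogeneous.sum _ _ _ fun l _ =>
        MvPolynomial.isHomogeneous_C_mul_X _ _
    rwa [one_mul] at this) _

theorem mulVec_inv_mulVec {n : ℕ} (T : GL (Fin n) ℂ) (z : Fin n → ℂ) :
    (T : Matrix (Fin n) (Fin n) ℂ).mulVec
      (((T⁻¹ : GL (Fin n) ℂ) : Matrix (Fin n) (Fin n) ℂ).mulVec z) = z :=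
  smul_inv_smul T z

/-- The foliation whose image under the projective transformation `T` is `F`. -/
def Foliation.transport {d : ℕ} (F : Foliation d) (T : GL (Fin 3) ℂ) : Foliation d where
  v := pullback T F.v
  homogeneous := pullback_homogeneous T F.homogeneous
  finite_singular := by
    refine (F.finite_singular.preimage (projective T).injective.injOn).subset ?_
    intro p hp
    obtain ⟨z, hz, rfl⟩ : ∃ z hz, p = Projectivization.mk ℂ z hz :=
      ⟨p.rep, p.rep_nonzero, p.mk_rep.symm⟩
    rw [Set.mem_ofPred_eq, singular_iff (pullback_homogeneous T F.homogeneous),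
      evalField_pullback, wedge_eq_zero_iff hz] at hp
    obtain ⟨c, hc⟩ := hp
    refine (singular_iff F.homogeneous (mulVec_ne_zero T hz)).2
      ((wedge_eq_zero_iff (mulVec_ne_zero T hz)).2 ⟨c, ?_⟩)
    rw [← mulVec_inv_mulVec T (evalField F.v _), hc, Matrix.mulVec_smul]

theorem Foliation.map_plane_transport {d : ℕ} (F : Foliation d) (T : GL (Fin 3) ℂ)
    (z : Fin 3 → ℂ) :
    ((F.transport T).plane z).map (T : Matrix (Fin 3) (Fin 3) ℂ).mulVecLin =
      F.plane ((T : Matrix (Fin 3) (Fin 3) ℂ).mulVec z) := by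
  rw [map_plane]
  change Submodule.span ℂ {_, _} = Submodule.span ℂ {_, _}
  rw [Foliation.transport, evalField_pullback, mulVec_inv_mulVec]

/-- `g` carries `F` to itself. -/
def Foliation.Invariant {d : ℕ} (F : Foliation d) (g : GL (Fin 3) ℂ) : Prop :=
  ∀ z : Fin 3 → ℂ, z ≠ 0 → (F.plane z).map (g : Matrix (Fin 3) (Fin 3) ℂ).mulVecLin =
    F.plane ((g : Matrix (Fin 3) (Fin 3) ℂ).mulVec z)

theorem map_mulVecLin_injective (T : GL (Fin 3) ℂ) :
    Function.Injective (Submodule.map (T : Matrix (Fin 3) (Fin 3) ℂ).mulVecLin) :=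
  Submodule.map_injective_of_injective (MulAction.injective T)

theorem map_mulVecLin_mul (g h : GL (Fin 3) ℂ) (S : Submodule ℂ (Fin 3 → ℂ)) :
    S.map ((g * h : GL (Fin 3) ℂ) : Matrix (Fin 3) (Fin 3) ℂ).mulVecLin =
      (S.map (h : Matrix (Fin 3) (Fin 3) ℂ).mulVecLin).map
        (g : Matrix (Fin 3) (Fin 3) ℂ).mulVecLin := by
  rw [← Submodule.map_comp, ← Matrix.mulVecLin_mul]
  rfl

theorem mul_mulVec (g h : GL (Fin 3) ℂ) (z : Fin 3 → ℂ) :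
    ((g * h : GL (Fin 3) ℂ) : Matrix (Fin 3) (Fin 3) ℂ).mulVec z =
      (g : Matrix (Fin 3) (Fin 3) ℂ).mulVec ((h : Matrix (Fin 3) (Fin 3) ℂ).mulVec z) :=
  mul_smul g h z

theorem Foliation.invariant_transport_iff {d : ℕ} (F : Foliation d) (T g : GL (Fin 3) ℂ) :
    (F.transport T).Invariant g ↔ F.Invariant (T * g * T⁻¹) := by
  constructor
  · intro h z hz
    have h1 := h (((T⁻¹ : GL (Fin 3) ℂ) : Matrix (Fin 3) (Fin 3) ℂ).mulVec z)
      (mulVec_ne_zero _ hz)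
    have h2 := congrArg (Submodule.map (T : Matrix (Fin 3) (Fin 3) ℂ).mulVecLin) h1
    rw [F.map_plane_transport, ← map_mulVecLin_mul, ← mul_mulVec, ← mul_mulVec] at h2
    rw [← h2]
    conv_lhs => rw [← mulVec_inv_mulVec T z, ← F.map_plane_transport, ← map_mulVecLin_mul]
    rw [inv_mul_cancel_right]
  · intro h z hz
    apply map_mulVecLin_injective T
    have h1 := h ((T : Matrix (Fin 3) (Fin 3) ℂ).mulVec z) (mulVec_ne_zero _ hz)
    rw [← F.map_plane_transport, ← map_mulVecLin_mul, ← mul_mulVec, inv_mul_cancel_right,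
      mul_mulVec] at h1
    rw [F.map_plane_transport, ← map_mulVecLin_mul, h1]

theorem Foliation.Invariant.inv {d : ℕ} {F : Foliation d} {g : GL (Fin 3) ℂ}
    (h : F.Invariant g) : F.Invariant g⁻¹ := by
  intro z hz
  apply map_mulVecLin_injective g
  rw [h _ (mulVec_ne_zero _ hz), ← map_mulVecLin_mul, mulVec_inv_mulVec, mul_inv_cancel]
  simp

/-- Membership in `aut` also asks for the inverse, but this is automatic for an invertible linear
map. -/
theorem Foliation.projective_mem_aut_iff {d : ℕ} (F : Foliation d) (g : GL (Fin 3) ℂ) :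
    projective g ∈ F.aut ↔ F.Invariant g := by
  have e : ((projective g).symm : Plane → Plane) = projective g⁻¹ := by
    rw [map_inv]; rfl
  have h0 : projective g ∈ F.aut ↔
      F.IsPreservedBy (projective g) ∧ F.IsPreservedBy (projective g).symm := Iff.rfl
  rw [h0, e, F.isPreservedBy_projective_iff, F.isPreservedBy_projective_iff]
  exact ⟨fun h => h.1, fun h => ⟨h, Foliation.Invariant.inv h⟩⟩

/-- The last coordinate, which these maps fix, normalizes the scalar that a projective
transformation leaves undetermined; testing on `[x : y : 1]` then recovers the matrix. -/
theorem projective_affineEmbedding_injective :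
    Function.Injective (projective.comp affineEmbedding) := by
  rw [injective_iff_map_eq_one]
  intro A hA
  have key : ∀ z : Fin 3 → ℂ, z ≠ 0 → ∃ c : ℂ,
      c • z = (affineEmbedding A : Matrix (Fin 3) (Fin 3) ℂ).mulVec z := by
    intro z hz
    have h1 := congrArg (fun σ : Equiv.Perm Plane => σ (Projectivization.mk ℂ z hz)) hA
    have h2 : Projectivization.mk ℂ ((affineEmbedding A : Matrix (Fin 3) (Fin 3) ℂ).mulVec z)
      (mulVec_ne_zero _ hz) = Projectivization.mk ℂ z hz := h1
    exact (Projectivization.mk_eq_mk_iff' ℂ _ _ _ _).1 h2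
  have key2 : ∀ x y : ℂ, A 0 0 * x + A 0 1 * y = x ∧ A 1 0 * x + A 1 1 * y = y := by
    intro x y
    obtain ⟨c, hc⟩ := key ![x, y, 1] (fun h => one_ne_zero (congrFun h 2))
    have h0 := congrFun hc 0
    have h1 := congrFun hc 1
    have h2 := congrFun hc 2
    simp [affineEmbedding, Matrix.mulVec, dotProduct, Fin.sum_univ_succ] at h0 h1 h2
    subst h2
    exact ⟨by linear_combination -h0, by linear_combination -h1⟩
  ext i j
  have h10 := key2 1 0
  have h01 := key2 0 1
  simp only [mul_one, mul_zero, add_zero, zero_add] at h10 h01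
  fin_cases i <;> fin_cases j <;> simp [h10, h01]

end PlaneFoliation

end

/-! ### Isolated singularities and uniqueness of the defining field -/

noncomputable section

namespace PlaneFoliation

/-- The restriction of a polynomial to an affine line. -/
theorem exists_polynomial_eval_line {σ : Type*} (g : MvPolynomial σ ℂ) (A B : σ → ℂ) :
    ∃ q : Polynomial ℂ, ∀ t, q.eval t = MvPolynomial.eval (A + t • B) g := by
  refine ⟨MvPolynomial.aeval (fun i => Polynomial.C (A i) + Polynomial.X * Polynomial.C (B i)) g,
    fun t => ?_⟩
  induction g using MvPolynomial.induction_on with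
  | C a => simp
  | add p q hp hq => simp only [map_add, Polynomial.eval_add, hp, hq]
  | mul_X p k hp =>
    rw [map_mul, map_mul, Polynomial.eval_mul, hp]
    simp only [MvPolynomial.aeval_X, Polynomial.eval_add, Polynomial.eval_mul, Polynomial.eval_C,
      Polynomial.eval_X, MvPolynomial.eval_X, Pi.add_apply, Pi.smul_apply, smul_eq_mul]

/-- A homogeneous polynomial of positive degree has a zero on every projective line. -/
theorem exists_zero_on_line {σ : Type*} [Fintype σ] {g : MvPolynomial σ ℂ} {e : ℕ}
    (hg : g.IsHomogeneous e) (he : 1 ≤ e) {A B : σ → ℂ} (hAB : LinearIndependent ℂ ![A, B]) :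
    ∃ z : σ → ℂ, z ≠ 0 ∧ z ∈ Submodule.span ℂ {A, B} ∧ MvPolynomial.eval z g = 0 := by
  rw [LinearIndependent.pair_iff] at hAB
  obtain ⟨q, hq⟩ := exists_polynomial_eval_line g A B
  -- Degree `0` means a nonzero constant; the zero polynomial has degree `⊥` and falls in the other
  -- case. If the form is constant on `A + t B`, then on `B + s A` it is a constant times `s ^ e`,
  -- which vanishes at `B`.
  by_cases hdeg : q.degree = 0
  · obtain ⟨c, hc⟩ : ∃ c, q = Polynomial.C c := ⟨_, Polynomial.eq_C_of_degree_eq_zero hdeg⟩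
    obtain ⟨q', hq'⟩ := exists_polynomial_eval_line g B A
    have h : q' = Polynomial.X ^ e * Polynomial.C c := by
      refine Polynomial.eq_of_infinite_eval_eq _ _ ((Set.finite_singleton (0 : ℂ)).infinite_compl.mono ?_)
      intro s (hs : s ≠ 0)
      rw [Set.mem_ofPred_eq, hq']
      have e1 : B + s • A = s • (A + s⁻¹ • B) := by
        rw [smul_add, smul_smul, mul_inv_cancel₀ hs, one_smul, add_comm]
      rw [e1, eval_smul_of_isHomogeneous hg, ← hq, hc, Polynomial.eval_mul,
        Polynomial.eval_C, Polynomial.eval_pow, Polynomial.eval_X, Polynomial.eval_C]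
    refine ⟨B, ?_, Submodule.subset_span (by simp), ?_⟩
    · rintro rfl
      exact one_ne_zero (hAB 0 1 (by simp)).2
    · have := hq' 0
      rw [h] at this
      simpa [show e ≠ 0 by omega] using this.symm
  · obtain ⟨t, ht⟩ := IsAlgClosed.exists_root q hdeg
    refine ⟨A + t • B, ?_, Submodule.mem_span_pair.2 ⟨1, t, by simp⟩, by rw [← hq]; exact ht⟩
    intro h
    exact one_ne_zero (hAB 1 t (by simpa using h)).1

/-- A plane curve is not contained in a finite set. -/
theorem exists_zero_notMem_finite {g : MvPolynomial (Fin 3) ℂ} {e : ℕ}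
    (hg : g.IsHomogeneous e) (he : 1 ≤ e) {S : Set Plane} (hS : S.Finite) :
    ∃ (z : Fin 3 → ℂ) (hz : z ≠ 0), MvPolynomial.eval z g = 0 ∧
      Projectivization.mk ℂ z hz ∉ S := by
  have : Finite S := hS
  -- A linear form that vanishes at no point of `S` gives a line disjoint from `S`, and the curve
  -- meets that line.
  obtain ⟨φ, hφ⟩ := Module.exists_dual_forall_apply_ne_zero (K := ℂ)
    (fun p : S => p.1.rep) fun p => p.1.rep_nonzero
  have hker : 2 ≤ Module.finrank ℂ (LinearMap.ker φ) := by
    have h1 := LinearMap.finrank_range_add_finrank_ker φ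
    have h2 := (LinearMap.range φ).finrank_le
    simp at h1 h2
    omega
  obtain ⟨f, hf⟩ := exists_linearIndependent_of_le_finrank hker
  obtain ⟨z, hz, hzs, hzg⟩ := exists_zero_on_line hg he (A := f 0) (B := f 1) (by
    have h1 := hf.map' (LinearMap.ker φ).subtype (Submodule.ker_subtype _)
    have h2 : (LinearMap.ker φ).subtype ∘ f = ![(f 0 : Fin 3 → ℂ), (f 1 : Fin 3 → ℂ)] := by
      ext i; fin_cases i <;> rfl
    rwa [h2] at h1)
  refine ⟨z, hz, hzg, fun hmem => hφ ⟨_, hmem⟩ ?_⟩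
  have hzk : φ z = 0 := by
    have : Submodule.span ℂ {(f 0 : Fin 3 → ℂ), (f 1 : Fin 3 → ℂ)} ≤ LinearMap.ker φ := by
      refine Submodule.span_le.2 ?_
      rintro x (rfl | rfl)
      · exact (f 0).2
      · exact (f 1).2
    exact this hzs
  obtain ⟨a, ha⟩ := Projectivization.exists_smul_eq_mk_rep ℂ z hz
  change φ (Projectivization.mk ℂ z hz).rep = 0
  rw [← ha]
  change φ ((a : ℂ) • z) = 0
  rw [map_smul, hzk, smul_zero]

/-- The form in which isolatedness of the singularities is used: the singular set contains no curve.
-/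
theorem Foliation.exists_zero_wedge_ne_zero {d : ℕ} (F : Foliation d)
    {g : MvPolynomial (Fin 3) ℂ} {e : ℕ} (hg : g.IsHomogeneous e) (he : 1 ≤ e) :
    ∃ z : Fin 3 → ℂ, z ≠ 0 ∧ MvPolynomial.eval z g = 0 ∧ wedge z (evalField F.v z) ≠ 0 := by
  obtain ⟨z, hz, hzg, hS⟩ := exists_zero_notMem_finite hg he F.finite_wedge
  exact ⟨z, hz, hzg, fun h => hS ⟨z, hz, rfl, h⟩⟩

/-- All products of components other than the top pair have degree below `m + n`. -/
theorem homogeneousComponent_add_mul {σ : Type*} {p q : MvPolynomial σ ℂ} {m n : ℕ}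
    (hp : p.totalDegree ≤ m) (hq : q.totalDegree ≤ n) :
    MvPolynomial.homogeneousComponent (m + n) (p * q) =
      MvPolynomial.homogeneousComponent m p * MvPolynomial.homogeneousComponent n q := by
  have key : ∀ (p : MvPolynomial σ ℂ) (m : ℕ), p.totalDegree ≤ m →
      p = ∑ i ∈ Finset.range (m + 1), MvPolynomial.homogeneousComponent i p := by
    intro p m hp
    conv_lhs => rw [← MvPolynomial.sum_homogeneousComponent p]
    refine Finset.sum_subset (by intro i; simp; omega) fun i _ hi => ?_
    exact MvPolynomial.homogeneousComponent_eq_zero _ _ (by simpa using hi)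
  conv_lhs => rw [key p m hp, key q n hq, Finset.sum_mul_sum, map_sum]
  rw [Finset.sum_eq_single_of_mem m (by simp), map_sum, Finset.sum_eq_single_of_mem n (by simp)]
  · exact MvPolynomial.homogeneousComponent_eq_self
      ((MvPolynomial.homogeneousComponent_isHomogeneous _ _).mul
        (MvPolynomial.homogeneousComponent_isHomogeneous _ _))
  · intro j hj hjn
    rw [MvPolynomial.homogeneousComponent_of_mem
      (((MvPolynomial.homogeneousComponent_isHomogeneous m p).mul
        (MvPolynomial.homogeneousComponent_isHomogeneous j q))), if_neg]
    omega
  · intro i hi him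
    rw [map_sum]
    refine Finset.sum_eq_zero fun j hj => ?_
    rw [MvPolynomial.homogeneousComponent_of_mem
      (((MvPolynomial.homogeneousComponent_isHomogeneous i p).mul
        (MvPolynomial.homogeneousComponent_isHomogeneous j q))), if_neg]
    simp only [Finset.mem_range] at hi hj
    omega

/-- The top homogeneous component of a divisor of a homogeneous polynomial is a divisor. -/
theorem homogeneousComponent_totalDegree_dvd {σ : Type*} {p r : MvPolynomial σ ℂ} {n : ℕ}
    (hr : r.IsHomogeneous n) (h : p ∣ r) :
    MvPolynomial.homogeneousComponent p.totalDegree p ∣ r := by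
  obtain ⟨q, rfl⟩ := h
  by_cases h0 : p * q = 0
  · simp [h0]
  · have hpq := mul_ne_zero_iff.1 h0
    have hn := hr.totalDegree h0
    rw [MvPolynomial.totalDegree_mul_of_isDomain hpq.1 hpq.2] at hn
    refine ⟨MvPolynomial.homogeneousComponent q.totalDegree q, ?_⟩
    rw [← homogeneousComponent_add_mul le_rfl le_rfl, hn]
    exact (MvPolynomial.homogeneousComponent_eq_self hr).symm

/-- The polynomials whose values are the coordinates of `z ∧ v(z)`. -/
def wedgePoly (v : Fin 3 → MvPolynomial (Fin 3) ℂ) : Fin 3 → MvPolynomial (Fin 3) ℂ :=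
  ![MvPolynomial.X 2 * v 0 - MvPolynomial.X 0 * v 2,
    MvPolynomial.X 2 * v 1 - MvPolynomial.X 1 * v 2,
    MvPolynomial.X 0 * v 1 - MvPolynomial.X 1 * v 0]

theorem eval_wedgePoly (v : Fin 3 → MvPolynomial (Fin 3) ℂ) (z : Fin 3 → ℂ) (i : Fin 3) :
    MvPolynomial.eval z (wedgePoly v i) = wedge z (evalField v z) i := by
  fin_cases i <;> simp [wedgePoly, wedge, evalField]

theorem wedgePoly_homogeneous {d : ℕ} {v : Fin 3 → MvPolynomial (Fin 3) ℂ}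
    (hv : ∀ i, (v i).IsHomogeneous d) (i : Fin 3) : (wedgePoly v i).IsHomogeneous (d + 1) := by
  have h : ∀ j k, (MvPolynomial.X j * v k).IsHomogeneous (d + 1) := fun j k => by
    have := (MvPolynomial.isHomogeneous_X ℂ j).mul (hv k)
    rwa [add_comm] at this
  fin_cases i
  · exact (h 2 0).sub (h 0 2)
  · exact (h 2 1).sub (h 1 2)
  · exact (h 0 1).sub (h 1 0)

theorem Foliation.wedgePoly_ne_zero {d : ℕ} (F : Foliation d) : ∃ i, wedgePoly F.v i ≠ 0 := by
  by_contra! h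
  obtain ⟨z, hz, -, hw⟩ := F.exists_zero_wedge_ne_zero (MvPolynomial.isHomogeneous_X ℂ 0) le_rfl
  refine hw ?_
  ext i
  rw [← eval_wedgePoly, h i]
  simp

/-- A nonconstant common factor would vanish along a curve of singular points. Its top component is
used in its place, to have a homogeneous equation. -/
theorem Foliation.isUnit_of_dvd_wedgePoly {d : ℕ} (F : Foliation d)
    {p : MvPolynomial (Fin 3) ℂ} (hp : ∀ i, p ∣ wedgePoly F.v i) : IsUnit p := by
  obtain ⟨k, hk⟩ := F.wedgePoly_ne_zero
  have hp0 : p ≠ 0 := fun h => hk (zero_dvd_iff.1 (h ▸ hp k))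
  by_cases he : 1 ≤ p.totalDegree
  · exfalso
    obtain ⟨z, hz, hzg, hw⟩ := F.exists_zero_wedge_ne_zero
      (MvPolynomial.homogeneousComponent_isHomogeneous p.totalDegree p) he
    refine hw ?_
    ext i
    obtain ⟨q, hq⟩ := homogeneousComponent_totalDegree_dvd (wedgePoly_homogeneous F.homogeneous i)
      (hp i)
    rw [← eval_wedgePoly, hq, map_mul, hzg, zero_mul]
    rfl
  · obtain ⟨c, rfl⟩ : ∃ c, p = MvPolynomial.C c :=
      ⟨_, MvPolynomial.totalDegree_eq_zero_iff_eq_C.1 (by omega)⟩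
    exact (isUnit_iff_ne_zero.2 fun h => hp0 (by rw [h, map_zero])).map MvPolynomial.C

/-- `a` divides the gcd of the three products, which is `b` times a unit because the three
polynomials have no common factor. -/
theorem Foliation.dvd_of_dvd_wedgePoly_mul {d : ℕ} (F : Foliation d)
    {a b : MvPolynomial (Fin 3) ℂ} (h : ∀ i, a ∣ wedgePoly F.v i * b) : a ∣ b := by
  classical
  let _ := UniqueFactorizationMonoid.toGCDMonoid (MvPolynomial (Fin 3) ℂ)
  set P := wedgePoly F.v
  have hu : IsUnit (gcd (P 0) (gcd (P 1) (P 2))) := by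
    refine F.isUnit_of_dvd_wedgePoly fun i => ?_
    fin_cases i
    · exact gcd_dvd_left _ _
    · exact (gcd_dvd_right _ _).trans (gcd_dvd_left _ _)
    · exact (gcd_dvd_right _ _).trans (gcd_dvd_right _ _)
  have h12 : a ∣ gcd (P 1) (P 2) * b := (dvd_gcd (h 1) (h 2)).trans (gcd_mul_right' _ _ _).dvd
  have h012 := (dvd_gcd (h 0) h12).trans (gcd_mul_right' _ _ _).dvd
  exact (hu.dvd_mul_left).1 h012

/-- Coprimality turns proportionality over the function field into divisibility: `P_k` divides every
`P_i P'_k`, hence `P'_k`, and the quotient is the same for all coordinates. -/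
theorem Foliation.wedgePoly_dvd {d d' : ℕ} (F : Foliation d) (F' : Foliation d')
    (h : ∀ i j, wedgePoly F.v i * wedgePoly F'.v j = wedgePoly F.v j * wedgePoly F'.v i) :
    ∃ c, ∀ i, wedgePoly F'.v i = c * wedgePoly F.v i := by
  obtain ⟨k, hk⟩ := F.wedgePoly_ne_zero
  obtain ⟨c, hc⟩ := F.dvd_of_dvd_wedgePoly_mul (a := wedgePoly F.v k) (b := wedgePoly F'.v k)
    fun i => ⟨wedgePoly F'.v i, h i k⟩
  refine ⟨c, fun i => mul_left_cancel₀ hk ?_⟩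
  rw [← h i k, hc]
  ring

/-- Two foliations with the same tangent planes have the same degree, and their vector fields
are proportional up to radial vector fields. -/
theorem Foliation.wedge_eq_of_plane_eq {d d' : ℕ} (F : Foliation d) (F' : Foliation d')
    (h : ∀ z : Fin 3 → ℂ, z ≠ 0 → F.plane z = F'.plane z) :
    d = d' ∧ ∃ c : ℂ, c ≠ 0 ∧ ∀ z, wedge z (evalField F'.v z) = c • wedge z (evalField F.v z) := by
  have hpar : ∀ i j, wedgePoly F.v i * wedgePoly F'.v j = wedgePoly F.v j * wedgePoly F'.v i := by
    intro i j
    refine MvPolynomial.funext fun z => ?_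
    rw [map_mul, map_mul]
    simp only [eval_wedgePoly]
    rcases eq_or_ne z 0 with rfl | hz
    · rw [← zero_smul ℂ (0 : Fin 3 → ℂ), smul_wedge]
      simp
    · obtain ⟨c, hc, e⟩ := (span_pair_eq_iff hz).1 (h z hz)
      rw [e]
      simp only [Pi.smul_apply, smul_eq_mul]
      ring
  obtain ⟨c, hc⟩ := F.wedgePoly_dvd F' hpar
  obtain ⟨c', hc'⟩ := F'.wedgePoly_dvd F fun i j => by
    rw [mul_comm, hpar j i, mul_comm]
  obtain ⟨k, hk⟩ := F.wedgePoly_ne_zero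
  -- By symmetry each triple divides the other, so the ratio is a unit of the polynomial ring, that
  -- is a nonzero constant.
  have hcc : c * c' = 1 := by
    refine mul_right_cancel₀ hk ?_
    rw [one_mul]
    conv_rhs => rw [hc' k, hc k]
    ring
  obtain ⟨a, ha, rfl⟩ := MvPolynomial.isUnit_iff_eq_C_of_isReduced.1 (IsUnit.of_mul_eq_one _ hcc)
  refine ⟨?_, a, ha.ne_zero, fun z => ?_⟩
  · have h1 := (wedgePoly_homogeneous F.homogeneous k).C_mul a
    rw [← hc k] at h1
    have h2 := wedgePoly_homogeneous F'.homogeneous k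
    have := h1.inj_right h2 (by
      rw [hc k]
      exact mul_ne_zero (by simpa using ha.ne_zero) hk)
    omega
  · ext i
    rw [Pi.smul_apply, ← eval_wedgePoly, ← eval_wedgePoly, hc i]
    simp

end PlaneFoliation

end

/-! ### Binary forms and their zeros on the projective line -/

noncomputable section

namespace PlaneFoliation

/-- Polynomials in two variables. -/
abbrev BinaryPoly : Type := MvPolynomial (Fin 2) ℂ

/-- The complex projective line. -/
abbrev PLine : Type := ℙ ℂ (Fin 2 → ℂ)

/-- Linear substitution. -/
def subst (A : Matrix (Fin 2) (Fin 2) ℂ) : BinaryPoly →ₐ[ℂ] BinaryPoly :=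
  MvPolynomial.aeval fun i => ∑ j, MvPolynomial.C (A i j) * MvPolynomial.X j

theorem eval_subst (A : Matrix (Fin 2) (Fin 2) ℂ) (f : BinaryPoly) (z : Fin 2 → ℂ) :
    MvPolynomial.eval z (subst A f) = MvPolynomial.eval (A.mulVec z) f := by
  induction f using MvPolynomial.induction_on with
  | C a => simp [subst]
  | add p q hp hq => simp only [map_add, hp, hq]
  | mul_X p k hp =>
    rw [map_mul, map_mul, map_mul, hp]
    simp only [subst, MvPolynomial.aeval_X, map_sum, map_mul, MvPolynomial.eval_C,
      MvPolynomial.eval_X]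
    rfl

theorem subst_homogeneous (A : Matrix (Fin 2) (Fin 2) ℂ) {f : BinaryPoly} {m : ℕ}
    (hf : f.IsHomogeneous m) : (subst A f).IsHomogeneous m := by
  have := hf.aeval (fun k => ∑ l, MvPolynomial.C (A k l) * MvPolynomial.X l) (n := 1)
    fun k => MvPolynomial.IsHomogeneous.sum _ _ _ fun l _ => MvPolynomial.isHomogeneous_C_mul_X _ _
  rwa [one_mul] at this

theorem pderiv_subst (A : Matrix (Fin 2) (Fin 2) ℂ) (f : BinaryPoly) (j : Fin 2) :
    MvPolynomial.pderiv j (subst A f) =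
      MvPolynomial.C (A 0 j) * subst A (MvPolynomial.pderiv 0 f) +
        MvPolynomial.C (A 1 j) * subst A (MvPolynomial.pderiv 1 f) := by
  induction f using MvPolynomial.induction_on with
  | C a => simp [subst]
  | add p q hp hq => simp only [map_add, hp, hq]; ring
  | mul_X p k hp =>
    simp only [map_mul, MvPolynomial.pderiv_mul, hp, map_add]
    have hX : ∀ k, subst A (MvPolynomial.X k) =
        MvPolynomial.C (A k 0) * MvPolynomial.X 0 + MvPolynomial.C (A k 1) * MvPolynomial.X 1 :=
      fun k => by simp [subst, Fin.sum_univ_succ]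
    fin_cases k <;> fin_cases j <;> simp [hX, MvPolynomial.pderiv_X] <;> ring

/-- The linear form that vanishes at `w`. -/
def lin (w : Fin 2 → ℂ) : BinaryPoly :=
  MvPolynomial.C (w 1) * MvPolynomial.X 0 - MvPolynomial.C (w 0) * MvPolynomial.X 1

theorem eval_lin (w z : Fin 2 → ℂ) : MvPolynomial.eval z (lin w) = w 1 * z 0 - w 0 * z 1 := by
  simp [lin]

theorem lin_homogeneous (w : Fin 2 → ℂ) : (lin w).IsHomogeneous 1 :=
  (MvPolynomial.isHomogeneous_C_mul_X _ _).sub (MvPolynomial.isHomogeneous_C_mul_X _ _)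

theorem eval_lin_eq_zero {w z : Fin 2 → ℂ} (hw : w ≠ 0) :
    MvPolynomial.eval z (lin w) = 0 ↔ ∃ c : ℂ, c • w = z := by
  rw [eval_lin]
  constructor
  · intro h
    obtain ⟨k, hk⟩ := Function.ne_iff.1 hw
    have hk' : w k ≠ 0 := hk
    refine ⟨z k / w k, ?_⟩
    ext i
    simp only [Pi.smul_apply, smul_eq_mul]
    rw [div_mul_eq_mul_div, div_eq_iff hk']
    fin_cases k <;> fin_cases i <;> simp only [Fin.zero_eta, Fin.mk_one] <;> first
    | ring1
    | linear_combination h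
    | linear_combination (-1 : ℂ) * h
  · rintro ⟨c, rfl⟩
    simp
    ring

theorem lin_ne_zero {w : Fin 2 → ℂ} (hw : w ≠ 0) : lin w ≠ 0 := by
  intro h
  have h0 := eval_lin w ![1, 0]
  have h1 := eval_lin w ![0, 1]
  rw [h] at h0 h1
  simp at h0 h1
  exact hw (by ext i; fin_cases i <;> simp [h0, h1])

theorem eval_lin_rep_eq_zero {p : PLine} {z : Fin 2 → ℂ} (hz : z ≠ 0) :
    MvPolynomial.eval z (lin p.rep) = 0 ↔ Projectivization.mk ℂ z hz = p := by
  rw [eval_lin_eq_zero p.rep_nonzero, ← Projectivization.mk_eq_mk_iff' ℂ z p.rep hz p.rep_nonzero,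
    p.mk_rep]

theorem eval_rep_mk_eq_zero {f : BinaryPoly} {m : ℕ} (hf : f.IsHomogeneous m) {z : Fin 2 → ℂ}
    (hz : z ≠ 0) : MvPolynomial.eval (Projectivization.mk ℂ z hz).rep f = 0 ↔
      MvPolynomial.eval z f = 0 := by
  obtain ⟨a, ha⟩ := Projectivization.exists_smul_eq_mk_rep ℂ z hz
  have ha' : (Projectivization.mk ℂ z hz).rep = (a : ℂ) • z := ha.symm
  rw [ha', eval_smul_of_isHomogeneous hf]
  exact mul_eq_zero_iff_left (pow_ne_zero _ a.ne_zero)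

theorem lin_dvd {f : BinaryPoly} {m : ℕ} (hf : f.IsHomogeneous m) {w : Fin 2 → ℂ} (hw : w ≠ 0)
    (h : MvPolynomial.eval w f = 0) : lin w ∣ f := by
  -- Modulo `lin w` the point `(X 0, X 1)` is `L • w` with `L = X k / w k`, so `f` is congruent to
  -- `f(L w) = L ^ m f(w) = 0`.
  obtain ⟨L, hL⟩ : ∃ L : BinaryPoly, ∀ i, lin w ∣ MvPolynomial.X i - MvPolynomial.C (w i) * L := by
    obtain ⟨k, hk⟩ := Function.ne_iff.1 hw
    have hk' : w k ≠ 0 := hk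
    refine ⟨MvPolynomial.C (w k)⁻¹ * MvPolynomial.X k, fun i => ?_⟩
    have e : (MvPolynomial.C (w k) : BinaryPoly) * MvPolynomial.C (w k)⁻¹ = 1 := by
      rw [← map_mul, mul_inv_cancel₀ hk', map_one]
    rw [lin]
    fin_cases k <;> fin_cases i <;> simp only [Fin.zero_eta, Fin.mk_one] at e ⊢
    · exact ⟨0, by linear_combination -MvPolynomial.X 0 * e⟩
    · exact ⟨-MvPolynomial.C (w 0)⁻¹, by linear_combination -MvPolynomial.X 1 * e⟩
    · exact ⟨MvPolynomial.C (w 1)⁻¹, by linear_combination -MvPolynomial.X 0 * e⟩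
    · exact ⟨0, by linear_combination -MvPolynomial.X 1 * e⟩
  have h1 : ∀ f : BinaryPoly, lin w ∣ f - MvPolynomial.aeval (fun i => MvPolynomial.C (w i) * L) f := by
    intro f
    induction f using MvPolynomial.induction_on with
    | C a => simp
    | add p q hp hq =>
      rw [map_add, add_sub_add_comm]
      exact dvd_add hp hq
    | mul_X p k hp =>
      rw [map_mul, MvPolynomial.aeval_X]
      have e : ∀ a b c d : BinaryPoly, a * b - c * d = (a - c) * b + c * (b - d) := fun a b c d => by
        ring
      rw [e]
      exact dvd_add (hp.mul_right _) ((hL k).mul_left _)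
  have h2 : MvPolynomial.aeval (fun i => MvPolynomial.C (w i) * L) f = 0 := by
    refine MvPolynomial.funext fun z => ?_
    have e : ∀ f : BinaryPoly, MvPolynomial.eval z
        (MvPolynomial.aeval (fun i => MvPolynomial.C (w i) * L) f) =
        MvPolynomial.eval (MvPolynomial.eval z L • w) f := by
      intro f
      induction f using MvPolynomial.induction_on with
      | C a => simp
      | add p q hp hq => simp only [map_add, hp, hq]
      | mul_X p k hp =>
        rw [map_mul, map_mul, map_mul, hp]
        simp [mul_comm]
    rw [e, eval_smul_of_isHomogeneous hf, h, mul_zero, map_zero]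
  have := h1 f
  rwa [h2, sub_zero] at this

/-- The top component of `q` already gives the whole product with `p`; cancelling `p` shows that it
is `q`. -/
theorem isHomogeneous_of_mul {σ : Type*} {p q : MvPolynomial σ ℂ} {k n : ℕ}
    (hpq : (p * q).IsHomogeneous n) (hp : p.IsHomogeneous k) (h0 : p * q ≠ 0) :
    ∃ m, n = k + m ∧ q.IsHomogeneous m := by
  have h := mul_ne_zero_iff.1 h0
  have hn := hpq.totalDegree h0
  rw [MvPolynomial.totalDegree_mul_of_isDomain h.1 h.2, hp.totalDegree h.1] at hn
  refine ⟨MvPolynomial.totalDegree q, hn.symm, ?_⟩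
  have e := homogeneousComponent_add_mul (q := q) hp.totalDegree_le le_rfl
  rw [hn, MvPolynomial.homogeneousComponent_eq_self hpq,
    MvPolynomial.homogeneousComponent_eq_self hp] at e
  have hq := MvPolynomial.homogeneousComponent_isHomogeneous (MvPolynomial.totalDegree q) q
  rwa [← mul_left_cancel₀ h.1 e] at hq

theorem prod_lin_homogeneous (S : Finset PLine) :
    (∏ p ∈ S, lin p.rep).IsHomogeneous S.card := by
  have := MvPolynomial.IsHomogeneous.prod S (fun p => lin p.rep) (fun _ => 1)
    fun p _ => lin_homogeneous p.rep
  simpa using this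

theorem prod_lin_ne_zero (S : Finset PLine) : ∏ p ∈ S, lin p.rep ≠ 0 :=
  Finset.prod_ne_zero_iff.2 fun p _ => lin_ne_zero p.rep_nonzero

theorem exists_eq_prod_lin_mul {f : BinaryPoly} {m : ℕ} (hf : f.IsHomogeneous m) (hf0 : f ≠ 0)
    (S : Finset PLine) (hS : ∀ p ∈ S, MvPolynomial.eval p.rep f = 0) :
    ∃ (k : ℕ) (q : BinaryPoly), m = S.card + k ∧ q.IsHomogeneous k ∧
      f = (∏ p ∈ S, lin p.rep) * q := by
  classical
  suffices h : ∏ p ∈ S, lin p.rep ∣ f by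
    obtain ⟨q, rfl⟩ := h
    obtain ⟨k, hk, hq⟩ := isHomogeneous_of_mul hf (prod_lin_homogeneous S) hf0
    exact ⟨k, q, hk, hq, rfl⟩
  induction S using Finset.induction_on with
  | empty => simp
  | insert p S hp ih =>
    obtain ⟨q, rfl⟩ := ih fun s hs => hS s (Finset.mem_insert_of_mem hs)
    obtain ⟨k, -, hq⟩ := isHomogeneous_of_mul hf (prod_lin_homogeneous S) hf0
    have h0 := hS p (Finset.mem_insert_self _ _)
    rw [map_mul, mul_eq_zero, map_prod, Finset.prod_eq_zero_iff] at h0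
    have h1 : MvPolynomial.eval p.rep q = 0 := by
      refine h0.resolve_left ?_
      rintro ⟨s, hs, e⟩
      rw [eval_lin_rep_eq_zero p.rep_nonzero, p.mk_rep] at e
      exact hp (e ▸ hs)
    rw [Finset.prod_insert hp, mul_comm (lin p.rep)]
    exact mul_dvd_mul_left _ (lin_dvd hq p.rep_nonzero h1)

theorem card_zeros_le {f : BinaryPoly} {m : ℕ} (hf : f.IsHomogeneous m) (hf0 : f ≠ 0)
    (S : Finset PLine) (hS : ∀ p ∈ S, MvPolynomial.eval p.rep f = 0) : S.card ≤ m := by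
  obtain ⟨k, q, hk, -⟩ := exists_eq_prod_lin_mul hf hf0 S hS
  omega

/-- A form with a double root has fewer roots than its degree. -/
theorem card_zeros_lt_of_sq_dvd {f : BinaryPoly} {m : ℕ} (hf : f.IsHomogeneous m) (hf0 : f ≠ 0)
    (S : Finset PLine) (hS : ∀ p ∈ S, MvPolynomial.eval p.rep f = 0) {w : Fin 2 → ℂ}
    (hw : lin w ^ 2 ∣ f) : S.card < m := by
  obtain ⟨q, rfl⟩ := hw
  have h1 : (lin w * q) ≠ 0 := fun h => hf0 (by rw [pow_two, mul_assoc, h, mul_zero])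
  have e : lin w ^ 2 * q = lin w * (lin w * q) := by ring
  rw [e] at hf hf0
  obtain ⟨k, hk, hq⟩ := isHomogeneous_of_mul hf (lin_homogeneous w) hf0
  have := card_zeros_le hq h1 S fun p hp => by
    have := hS p hp
    rw [map_mul, map_pow, mul_eq_zero, pow_eq_zero_iff two_ne_zero] at this
    rw [map_mul, mul_eq_zero]
    exact this
  omega

theorem exists_zero {f : BinaryPoly} {m : ℕ} (hf : f.IsHomogeneous m) (hm : 1 ≤ m) :
    ∃ p : PLine, MvPolynomial.eval p.rep f = 0 := by
  obtain ⟨z, hz, -, h⟩ := exists_zero_on_line hf hm (A := ![1, 0]) (B := ![0, 1])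
    (LinearIndependent.pair_iff.2 fun s t h => by
      have h0 := congrFun h 0
      have h1 := congrFun h 1
      simpa using And.intro h0 h1)
  exact ⟨Projectivization.mk ℂ z hz, (eval_rep_mk_eq_zero hf hz).2 h⟩

/-! ### Semi-invariant forms and orbits -/

/-- `f` is invariant up to factors under the linear transformations whose class is in `K`. -/
def IsSemiInvariant (K : Subgroup (Matrix.ProjGenLinGroup (Fin 2) ℂ)) (f : BinaryPoly) : Prop :=
  ∀ A : GL (Fin 2) ℂ, Matrix.ProjGenLinGroup.mk A ∈ K → ∃ χ : ℂ, χ ≠ 0 ∧ ∀ z : Fin 2 → ℂ,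
    MvPolynomial.eval ((A : Matrix (Fin 2) (Fin 2) ℂ).mulVec z) f = χ * MvPolynomial.eval z f

theorem smul_mk_pline (A : GL (Fin 2) ℂ) {z : Fin 2 → ℂ} (hz : z ≠ 0) :
    (Matrix.ProjGenLinGroup.mk A) • Projectivization.mk ℂ z hz =
      Projectivization.mk ℂ ((A : Matrix (Fin 2) (Fin 2) ℂ).mulVec z) (mulVec_ne_zero A hz) := rfl

variable {K : Subgroup (Matrix.ProjGenLinGroup (Fin 2) ℂ)}

theorem IsSemiInvariant.eval_smul {f : BinaryPoly} {m : ℕ} (hf : f.IsHomogeneous m)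
    (h : IsSemiInvariant K f) (g : K) {p : PLine} (hp : MvPolynomial.eval p.rep f = 0) :
    MvPolynomial.eval (g • p).rep f = 0 := by
  obtain ⟨A, hA⟩ := Matrix.ProjGenLinGroup.mk_surjective g.1
  obtain ⟨χ, -, h⟩ := h A (hA ▸ g.2)
  have e : g • p = Projectivization.mk ℂ ((A : Matrix (Fin 2) (Fin 2) ℂ).mulVec p.rep)
      (mulVec_ne_zero A p.rep_nonzero) := by
    rw [← smul_mk_pline A p.rep_nonzero, p.mk_rep, hA]
    rfl
  rw [e, eval_rep_mk_eq_zero hf, h, hp, mul_zero]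

theorem eval_mulVec_lin (A : GL (Fin 2) ℂ) (s : PLine) : ∃ c : ℂ, c ≠ 0 ∧ ∀ z,
    MvPolynomial.eval ((A : Matrix (Fin 2) (Fin 2) ℂ).mulVec z)
      (lin (Matrix.ProjGenLinGroup.mk A • s).rep) = c * MvPolynomial.eval z (lin s.rep) := by
  have e : Matrix.ProjGenLinGroup.mk A • s = Projectivization.mk ℂ
      ((A : Matrix (Fin 2) (Fin 2) ℂ).mulVec s.rep) (mulVec_ne_zero A s.rep_nonzero) := by
    rw [← smul_mk_pline A s.rep_nonzero, s.mk_rep]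
  obtain ⟨a, ha⟩ := Projectivization.exists_smul_eq_mk_rep ℂ _ (mulVec_ne_zero A s.rep_nonzero)
  have hdet : (A : Matrix (Fin 2) (Fin 2) ℂ).det ≠ 0 := Matrix.GeneralLinearGroup.det_ne_zero A
  refine ⟨a * (A : Matrix (Fin 2) (Fin 2) ℂ).det, mul_ne_zero a.ne_zero hdet, fun z => ?_⟩
  rw [e, ← ha, eval_lin, eval_lin, Matrix.det_fin_two]
  simp [Matrix.mulVec, dotProduct, Fin.sum_univ_succ, Units.smul_def]
  ring

/-- A matrix over `K` permutes the points of the orbit and carries each linear factor to a multiple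
of another one. -/
theorem isSemiInvariant_prod_orbit {p : PLine} (S : Finset PLine)
    (hS : ∀ s, s ∈ S ↔ s ∈ MulAction.orbit K p) : IsSemiInvariant K (∏ s ∈ S, lin s.rep) := by
  intro A hA
  choose c hc h using eval_mulVec_lin A
  refine ⟨∏ s ∈ S, c s, Finset.prod_ne_zero_iff.2 fun s _ => hc s, fun z => ?_⟩
  rw [map_prod, map_prod, ← Finset.prod_mul_distrib]
  have hmem : ∀ s, s ∈ S → Matrix.ProjGenLinGroup.mk A • s ∈ S := fun s hs => by
    rw [hS] at hs ⊢
    exact MulAction.mem_orbit_of_mem_orbit (⟨_, hA⟩ : K) hs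
  have hmem' : ∀ s, s ∈ S → (Matrix.ProjGenLinGroup.mk A)⁻¹ • s ∈ S := fun s hs => by
    rw [hS] at hs ⊢
    exact MulAction.mem_orbit_of_mem_orbit (⟨_, hA⟩ : K)⁻¹ hs
  symm
  exact Finset.prod_bij' (fun s _ => Matrix.ProjGenLinGroup.mk A • s)
    (fun s _ => (Matrix.ProjGenLinGroup.mk A)⁻¹ • s) hmem hmem' (fun s _ => inv_smul_smul _ _)
    (fun s _ => smul_inv_smul _ _) fun s _ => (h s z).symm

theorem IsSemiInvariant.of_mul {f q : BinaryPoly} (h : IsSemiInvariant K (f * q))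
    (hf : IsSemiInvariant K f) (hf0 : f ≠ 0) : IsSemiInvariant K q := by
  intro A hA
  obtain ⟨χ, hχ, h⟩ := h A hA
  obtain ⟨χ', hχ', h'⟩ := hf A hA
  refine ⟨χ / χ', div_ne_zero hχ hχ', fun z => ?_⟩
  have key : f * subst A q = f * (MvPolynomial.C (χ / χ') * q) := by
    refine MvPolynomial.funext fun z => ?_
    have := h z
    rw [map_mul, h', map_mul] at this
    rw [map_mul, map_mul, eval_subst, map_mul, MvPolynomial.eval_C]
    field_simp
    linear_combination this
  rw [← eval_subst, mul_left_cancel₀ hf0 key, map_mul, MvPolynomial.eval_C]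

/-- A semi-invariant form is divisible by the form of an orbit. -/
theorem IsSemiInvariant.exists_orbit {f : BinaryPoly} {m : ℕ} (h : IsSemiInvariant K f)
    (hf : f.IsHomogeneous m) (hf0 : f ≠ 0) (hm : 1 ≤ m) :
    ∃ (p : PLine) (S : Finset PLine) (k : ℕ) (q : BinaryPoly),
      (∀ s, s ∈ S ↔ s ∈ MulAction.orbit K p) ∧ m = S.card + k ∧ q.IsHomogeneous k ∧ q ≠ 0 ∧
      IsSemiInvariant K q ∧ f = (∏ s ∈ S, lin s.rep) * q := by
  obtain ⟨p, hp⟩ := exists_zero hf hm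
  have hzero : ∀ s ∈ MulAction.orbit K p, MvPolynomial.eval s.rep f = 0 := by
    rintro s ⟨g, rfl⟩
    exact h.eval_smul hf g hp
  -- The orbit consists of zeros of `f`, and a nonzero form of degree `m` has at most `m` of them.
  have hfin : (MulAction.orbit K p).Finite := by
    by_contra hinf
    obtain ⟨S, hS, hcard⟩ := Set.Infinite.exists_subset_card_eq hinf (m + 1)
    have := card_zeros_le hf hf0 S fun s hs => hzero s (hS hs)
    omega
  obtain ⟨k, q, hk, hq, e⟩ := exists_eq_prod_lin_mul hf hf0 hfin.toFinset
    fun s hs => hzero s (hfin.mem_toFinset.1 hs)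
  have hS : ∀ s, s ∈ hfin.toFinset ↔ s ∈ MulAction.orbit K p := fun s => hfin.mem_toFinset
  refine ⟨p, hfin.toFinset, k, q, hS, hk, hq, ?_, ?_, e⟩
  · rintro rfl
    exact hf0 (by rw [e, mul_zero])
  · exact IsSemiInvariant.of_mul (e ▸ h) (isSemiInvariant_prod_orbit _ hS) (prod_lin_ne_zero _)

/-- A semi-invariant form of small degree is the form of an orbit. -/
theorem IsSemiInvariant.eq_orbit {f : BinaryPoly} {m N : ℕ} (h : IsSemiInvariant K f)
    (hf : f.IsHomogeneous m) (hf0 : f ≠ 0) (hm : 1 ≤ m)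
    (hN : ∀ p : PLine, N ≤ Nat.card (MulAction.orbit K p)) (hmN : m < 2 * N) :
    ∃ (p : PLine) (S : Finset PLine), (∀ s, s ∈ S ↔ s ∈ MulAction.orbit K p) ∧ S.card = m ∧
      Nat.card (MulAction.orbit K p) = m ∧ ∀ s ∈ S, MvPolynomial.eval s.rep f = 0 := by
  have hcard : ∀ (p : PLine) (S : Finset PLine), (∀ s, s ∈ S ↔ s ∈ MulAction.orbit K p) →
      Nat.card (MulAction.orbit K p) = S.card := by
    intro p S hS
    rw [show MulAction.orbit K p = (S : Set PLine) by ext s; exact (hS s).symm]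
    simp
  obtain ⟨p, S, k, q, hS, hk, hq, hq0, hqK, e⟩ := h.exists_orbit hf hf0 hm
  have h1 := hcard p S hS
  have h2 := hN p
  -- A cofactor of positive degree would contain a further orbit form, and the total degree would be
  -- at least `2 * N`.
  have hk0 : k = 0 := by
    by_contra hk0
    obtain ⟨p', S', k', q', hS', hk', -⟩ := hqK.exists_orbit hq hq0 (by omega)
    have h3 := hcard p' S' hS'
    have h4 := hN p'
    omega
  refine ⟨p, S, hS, by omega, by omega, fun s hs => ?_⟩
  rw [e, map_mul, map_prod, Finset.prod_eq_zero hs, zero_mul]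
  rw [eval_lin]
  ring

end PlaneFoliation

end

/-! ### Cyclic stabilizers and orbit sizes of the polyhedral groups -/

noncomputable section

namespace PlaneFoliation

variable {K : Subgroup (Matrix.ProjGenLinGroup (Fin 2) ℂ)}

theorem mk_eq_one_iff {A : GL (Fin 2) ℂ} :
    Matrix.ProjGenLinGroup.mk A = 1 ↔ ∃ c : ℂ, (A : Matrix (Fin 2) (Fin 2) ℂ) = c • 1 := by
  rw [Matrix.ProjGenLinGroup.mk_eq_one,
    Matrix.GeneralLinearGroup.mem_center_iff_val_mem_range_scalar]
  constructor
  · rintro ⟨c, hc⟩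
    exact ⟨c, by rw [← hc, Matrix.smul_one_eq_diagonal]; rfl⟩
  · rintro ⟨c, hc⟩
    exact ⟨c, by rw [hc, Matrix.smul_one_eq_diagonal]; rfl⟩

theorem trace_eq_of_eigenvector {A : Matrix (Fin 2) (Fin 2) ℂ} {w : Fin 2 → ℂ} (hw : w ≠ 0)
    {e : ℂ} (h : A.mulVec w = e • w) : e ^ 2 - (A 0 0 + A 1 1) * e + A.det = 0 := by
  have h0 := congrFun h 0
  have h1 := congrFun h 1
  simp only [Matrix.mulVec, dotProduct, Fin.sum_univ_two, Pi.smul_apply, smul_eq_mul] at h0 h1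
  rw [Matrix.det_fin_two]
  have e0 : (e ^ 2 - (A 0 0 + A 1 1) * e + (A 0 0 * A 1 1 - A 0 1 * A 1 0)) * w 0 = 0 := by
    linear_combination (A 1 1 - e) * h0 - A 0 1 * h1
  have e1 : (e ^ 2 - (A 0 0 + A 1 1) * e + (A 0 0 * A 1 1 - A 0 1 * A 1 0)) * w 1 = 0 := by
    linear_combination (A 0 0 - e) * h1 - A 1 0 * h0
  by_contra hne
  exact hw (by
    ext i
    fin_cases i
    · exact (mul_eq_zero.1 e0).resolve_left hne
    · exact (mul_eq_zero.1 e1).resolve_left hne)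

/-- A matrix of finite order in `PGL₂` with a double eigenvalue is a scalar. -/
theorem mk_eq_one_of_det_eq_sq {A : GL (Fin 2) ℂ} {w : Fin 2 → ℂ} (hw : w ≠ 0) {e : ℂ}
    (h : (A : Matrix (Fin 2) (Fin 2) ℂ).mulVec w = e • w)
    (hdet : (A : Matrix (Fin 2) (Fin 2) ℂ).det = e ^ 2) {r : ℕ} (hr : r ≠ 0)
    (hA : Matrix.ProjGenLinGroup.mk A ^ r = 1) : Matrix.ProjGenLinGroup.mk A = 1 := by
  rw [← map_pow, mk_eq_one_iff] at hA
  obtain ⟨c, hc⟩ := hA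
  rw [mk_eq_one_iff]
  refine ⟨e, ?_⟩
  have he : e ≠ 0 := by
    rintro rfl
    refine Matrix.GeneralLinearGroup.det_ne_zero A ?_
    rw [hdet]
    simp
  set M : Matrix (Fin 2) (Fin 2) ℂ := (A : Matrix (Fin 2) (Fin 2) ℂ) with hM
  have htr := trace_eq_of_eigenvector hw h
  rw [hdet] at htr
  have htr' : M 0 0 + M 1 1 = 2 * e := by
    refine mul_right_cancel₀ he ?_
    linear_combination -htr
  rw [Matrix.det_fin_two] at hdet
  -- Cayley–Hamilton with the double eigenvalue `e`. Then `M ^ (n + 1)` is a scalar plus `(n + 1) e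
  -- ^ n (M - e)`, so it can be scalar only if `M` is.
  have hsq : (M - e • 1) * (M - e • 1) = 0 := by
    have h11 : M 1 1 = 2 * e - M 0 0 := by linear_combination htr'
    rw [h11] at hdet
    ext i j
    fin_cases i <;> fin_cases j <;> simp [Matrix.mul_apply, Fin.sum_univ_two, h11] <;> first
    | linear_combination (-1 : ℂ) * hdet
    | ring1
  have hpow : ∀ n : ℕ, M ^ (n + 1) = e ^ (n + 1) • 1 + ((n + 1 : ℕ) * e ^ n) • (M - e • 1) := by
    intro n
    induction n with
    | zero => simp
    | succ n ih =>
      rw [pow_succ, ih]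
      have e2 : M = e • 1 + (M - e • 1) := by abel
      set X := M - e • 1
      rw [e2, add_mul, mul_add, mul_add, smul_mul_assoc _ X X, hsq]
      simp only [smul_mul_assoc, mul_smul_comm, one_mul, mul_one, smul_zero, add_zero, smul_smul]
      rw [add_assoc, ← add_smul]
      congr 2
      · ring
      · push_cast
        ring
  obtain ⟨n, rfl⟩ : ∃ n, r = n + 1 := ⟨r - 1, by omega⟩
  have hc' : M ^ (n + 1) = c • 1 := by rw [← hc]; simp [hM]
  rw [hpow] at hc'
  have hXw : (M - e • 1).mulVec w = 0 := by
    rw [Matrix.sub_mulVec, h, Matrix.smul_mulVec, Matrix.one_mulVec, sub_self]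
  have hce : c = e ^ (n + 1) := by
    have := congrArg (fun X : Matrix (Fin 2) (Fin 2) ℂ => X.mulVec w) hc'
    simp only [Matrix.add_mulVec, Matrix.smul_mulVec, hXw, smul_zero, add_zero,
      Matrix.one_mulVec] at this
    exact (smul_left_injective ℂ hw this).symm
  rw [hce, add_eq_left, smul_eq_zero] at hc'
  have := hc'.resolve_left (mul_ne_zero (by exact_mod_cast n.succ_ne_zero) (pow_ne_zero _ he))
  exact sub_eq_zero.1 this

theorem smul_eq_iff_eigenvector {A : GL (Fin 2) ℂ} {p : PLine} :
    Matrix.ProjGenLinGroup.mk A • p = p ↔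
      ∃ e : ℂ, (A : Matrix (Fin 2) (Fin 2) ℂ).mulVec p.rep = e • p.rep := by
  conv_lhs => rw [← p.mk_rep, smul_mk_pline]
  rw [Projectivization.mk_eq_mk_iff']
  exact ⟨fun ⟨a, h⟩ => ⟨a, h.symm⟩, fun ⟨a, h⟩ => ⟨a, h.symm⟩⟩

/-- The ratio of the eigenvalues of an element of `PGL₂` that fixes a point. -/
theorem exists_eigenvalue_ratio {p : PLine} {g : Matrix.ProjGenLinGroup (Fin 2) ℂ}
    (hg : g • p = p) : ∃ r : ℂ, ∀ A : GL (Fin 2) ℂ, Matrix.ProjGenLinGroup.mk A = g →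
      ∃ e : ℂ, (A : Matrix (Fin 2) (Fin 2) ℂ).mulVec p.rep = e • p.rep ∧
        r * (A : Matrix (Fin 2) (Fin 2) ℂ).det = e ^ 2 := by
  obtain ⟨A, rfl⟩ := Matrix.ProjGenLinGroup.mk_surjective g
  obtain ⟨e, he⟩ := smul_eq_iff_eigenvector.1 hg
  have hdet : (A : Matrix (Fin 2) (Fin 2) ℂ).det ≠ 0 := Matrix.GeneralLinearGroup.det_ne_zero A
  -- The determinant is the product of the two eigenvalues, so `e² / det` is their ratio; it does
  -- not change when the matrix is multiplied by a scalar.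
  refine ⟨e ^ 2 / (A : Matrix (Fin 2) (Fin 2) ℂ).det, fun B hB => ?_⟩
  obtain ⟨u, rfl⟩ := Matrix.ProjGenLinGroup.mk_eq_mk_iff.1 hB.symm
  have hB : ((A * Matrix.GeneralLinearGroup.scalar (Fin 2) u : GL (Fin 2) ℂ) :
      Matrix (Fin 2) (Fin 2) ℂ) = (u : ℂ) • (A : Matrix (Fin 2) (Fin 2) ℂ) := by
    rw [Units.val_mul, Matrix.GeneralLinearGroup.coe_scalar]
    simp [← Matrix.smul_one_eq_diagonal]
  refine ⟨u * e, ?_, ?_⟩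
  · rw [hB, Matrix.smul_mulVec, he, smul_smul]
  · rw [hB, Matrix.det_smul]
    simp only [Fintype.card_fin]
    field_simp

/-- The stabilizer of a point of the line in a finite group is cyclic. -/
theorem exists_generator_stabilizer [Finite K] (p : PLine) :
    ∃ g : K, orderOf g = Nat.card (MulAction.stabilizer K p) ∧ ∃ ζ : ℂ,
      IsPrimitiveRoot ζ (orderOf g) ∧ ∀ A : GL (Fin 2) ℂ, Matrix.ProjGenLinGroup.mk A = g →
      ∃ e : ℂ, (A : Matrix (Fin 2) (Fin 2) ℂ).mulVec p.rep = e • p.rep ∧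
        ζ * (A : Matrix (Fin 2) (Fin 2) ℂ).det = e ^ 2 := by
  have hex : ∀ g : MulAction.stabilizer K p, ∃ r : ℂ, ∀ A : GL (Fin 2) ℂ,
      Matrix.ProjGenLinGroup.mk A = (g : K) →
      ∃ e : ℂ, (A : Matrix (Fin 2) (Fin 2) ℂ).mulVec p.rep = e • p.rep ∧
        r * (A : Matrix (Fin 2) (Fin 2) ℂ).det = e ^ 2 := fun g => exists_eigenvalue_ratio g.2
  choose r hr using hex
  have hinj : ∀ a b : ℂ, a • p.rep = b • p.rep → a = b := fun a b h =>
    smul_left_injective ℂ p.rep_nonzero h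
  have hone : r 1 = 1 := by
    obtain ⟨e, he, h⟩ := hr 1 1 rfl
    have : e = 1 := by
      refine (hinj 1 e ?_).symm
      rw [← he]
      simp
    rw [this] at h
    simpa using h
  have hmul : ∀ g h, r (g * h) = r g * r h := by
    intro g h
    obtain ⟨A, hA⟩ := Matrix.ProjGenLinGroup.mk_surjective ((g : K) : Matrix.ProjGenLinGroup (Fin 2) ℂ)
    obtain ⟨B, hB⟩ := Matrix.ProjGenLinGroup.mk_surjective ((h : K) : Matrix.ProjGenLinGroup (Fin 2) ℂ)
    obtain ⟨a, ha, ha'⟩ := hr g A hA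
    obtain ⟨b, hb, hb'⟩ := hr h B hB
    obtain ⟨c, hc, hc'⟩ := hr (g * h) (A * B) (by rw [map_mul, hA, hB]; rfl)
    have : c = a * b := by
      refine hinj _ _ ?_
      rw [← hc, Units.val_mul, ← Matrix.mulVec_mulVec, hb, Matrix.mulVec_smul, ha, smul_smul,
        mul_comm]
    rw [this, Units.val_mul, Matrix.det_mul] at hc'
    have hdA : (A : Matrix (Fin 2) (Fin 2) ℂ).det ≠ 0 := Matrix.GeneralLinearGroup.det_ne_zero A
    have hdB : (B : Matrix (Fin 2) (Fin 2) ℂ).det ≠ 0 := Matrix.GeneralLinearGroup.det_ne_zero B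
    refine mul_right_cancel₀ (mul_ne_zero hdA hdB) ?_
    rw [hc']
    linear_combination -(b ^ 2) * ha' - r g * (A : Matrix (Fin 2) (Fin 2) ℂ).det * hb'
  -- The eigenvalue ratio is a character of the stabilizer. Its kernel is trivial, since ratio 1
  -- means a double eigenvalue, and a finite group that embeds in the multiplicative monoid of a
  -- field is cyclic.
  let τ : MulAction.stabilizer K p →* ℂ := ⟨⟨r, hone⟩, hmul⟩
  have hτ : Function.Injective τ := by
    have h1 : ∀ g, r g = 1 → g = 1 := by
      intro g hg
      obtain ⟨A, hA⟩ := Matrix.ProjGenLinGroup.mk_surjective ((g : K) : Matrix.ProjGenLinGroup (Fin 2) ℂ)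
      obtain ⟨a, ha, ha'⟩ := hr g A hA
      rw [hg, one_mul] at ha'
      have := mk_eq_one_of_det_eq_sq p.rep_nonzero ha ha' (orderOf_pos g).ne' (by
        rw [hA]
        exact_mod_cast congrArg (fun x : MulAction.stabilizer K p =>
          ((x : K) : Matrix.ProjGenLinGroup (Fin 2) ℂ)) (pow_orderOf_eq_one g))
      rw [hA] at this
      exact Subtype.ext (Subtype.ext this)
    intro g h e
    have e' : r g = r h := e
    have : r (g * h⁻¹) = 1 := by rw [hmul, e', ← hmul, mul_inv_cancel, hone]
    exact mul_inv_eq_one.1 (h1 _ this)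
  have hcyc := isCyclic_of_injective_ringHom τ hτ
  obtain ⟨g, hg⟩ := IsCyclic.exists_ofOrder_eq_natCard (α := MulAction.stabilizer K p)
  refine ⟨g, by rw [Subgroup.orderOf_coe, hg], r g, ?_, hr g⟩
  rw [Subgroup.orderOf_coe, ← orderOf_injective τ hτ g]
  exact IsPrimitiveRoot.orderOf (τ g)

theorem card_orbit_mul_card_stabilizer [Finite K] (p : PLine) :
    Nat.card (MulAction.orbit K p) * Nat.card (MulAction.stabilizer K p) = Nat.card K := by
  classical
  have := Fintype.ofFinite K
  have : Finite (MulAction.orbit K p) := Set.finite_range _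
  have := Fintype.ofFinite (MulAction.orbit K p)
  have := Fintype.ofFinite (MulAction.stabilizer K p)
  simp only [Nat.card_eq_fintype_card]
  exact MulAction.card_orbit_mul_card_stabilizer_eq_card_group K p

set_option maxRecDepth 10000 in
theorem alternatingGroup_four_pow (g : alternatingGroup (Fin 4)) : g ^ 2 = 1 ∨ g ^ 3 = 1 := by
  revert g
  decide

set_option maxRecDepth 10000 in
theorem perm_four_pow (g : Equiv.Perm (Fin 4)) : g ^ 4 = 1 ∨ g ^ 3 = 1 := by
  revert g
  decide

set_option maxRecDepth 10000 in
theorem perm_five_pow (g : Equiv.Perm (Fin 5)) (hg : Equiv.Perm.sign g = 1) :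
    g ^ 2 = 1 ∨ g ^ 3 = 1 ∨ g ^ 5 = 1 := by
  revert g
  decide

/-- The stabilizer of a point is cyclic, so its order is the order of an element of `A₄`, at most 3.
-/
theorem card_orbit_of_tetrahedral (e : K ≃* alternatingGroup (Fin 4)) :
    Nat.card K = 12 ∧ ∀ p : PLine, 4 ≤ Nat.card (MulAction.orbit K p) := by
  have : Finite K := Finite.of_equiv _ e.symm.toEquiv
  have hcard : Nat.card K = 12 := by
    rw [Nat.card_congr e.toEquiv, Nat.card_eq_fintype_card, card_alternatingGroup]
    rfl
  refine ⟨hcard, fun p => ?_⟩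
  obtain ⟨g, hg, -⟩ := exists_generator_stabilizer (K := K) p
  have h1 := card_orbit_mul_card_stabilizer (K := K) p
  rw [hcard, ← hg, ← MulEquiv.orderOf_eq e g] at h1
  have h2 : orderOf (e g) ≤ 3 := by
    rcases alternatingGroup_four_pow (e g) with h | h
    · exact (orderOf_le_of_pow_eq_one (by norm_num) h).trans (by norm_num)
    · exact orderOf_le_of_pow_eq_one (by norm_num) h
  nlinarith

/-- Cyclic stabilizers have order at most 4, so an orbit has `24 / n` points with `n ≤ 4`: after 6
the next size is 8. -/
theorem card_orbit_of_octahedral (e : K ≃* Equiv.Perm (Fin 4)) :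
    Nat.card K = 24 ∧ ∀ p : PLine, 6 ≤ Nat.card (MulAction.orbit K p) ∧
      (Nat.card (MulAction.orbit K p) < 8 → Nat.card (MulAction.orbit K p) = 6) := by
  have : Finite K := Finite.of_equiv _ e.symm.toEquiv
  have hcard : Nat.card K = 24 := by
    rw [Nat.card_congr e.toEquiv, Nat.card_eq_fintype_card, Fintype.card_perm]
    rfl
  refine ⟨hcard, fun p => ?_⟩
  obtain ⟨g, hg, -⟩ := exists_generator_stabilizer (K := K) p
  have h1 := card_orbit_mul_card_stabilizer (K := K) p
  rw [hcard, ← hg, ← MulEquiv.orderOf_eq e g] at h1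
  have h2 : orderOf (e g) ≤ 4 := by
    rcases perm_four_pow (e g) with h | h
    · exact orderOf_le_of_pow_eq_one (by norm_num) h
    · exact (orderOf_le_of_pow_eq_one (by norm_num) h).trans (by norm_num)
  generalize orderOf (e g) = n at h1 h2
  interval_cases n <;> omega

/-- Cyclic stabilizers have order 1, 2, 3 or 5, which gives orbits of 60, 30, 20 or 12 points. -/
theorem card_orbit_of_icosahedral (e : K ≃* alternatingGroup (Fin 5)) :
    Nat.card K = 60 ∧ ∀ p : PLine, 12 ≤ Nat.card (MulAction.orbit K p) ∧
      (Nat.card (MulAction.orbit K p) < 20 → Nat.card (MulAction.orbit K p) = 12) := by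
  have : Finite K := Finite.of_equiv _ e.symm.toEquiv
  have hcard : Nat.card K = 60 := by
    rw [Nat.card_congr e.toEquiv, Nat.card_eq_fintype_card, card_alternatingGroup]
    rfl
  refine ⟨hcard, fun p => ?_⟩
  obtain ⟨g, hg, -⟩ := exists_generator_stabilizer (K := K) p
  have h1 := card_orbit_mul_card_stabilizer (K := K) p
  rw [hcard, ← hg, ← MulEquiv.orderOf_eq e g] at h1
  have h2 : orderOf (e g) ∣ 2 ∨ orderOf (e g) ∣ 3 ∨ orderOf (e g) ∣ 5 := by
    simp only [orderOf_dvd_iff_pow_eq_one]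
    have h := perm_five_pow (e g) (e g).2
    exact_mod_cast h
  have h3 : orderOf (e g) = 1 ∨ orderOf (e g) = 2 ∨ orderOf (e g) = 3 ∨ orderOf (e g) = 5 := by
    rcases h2 with h | h | h
    · rcases (Nat.dvd_prime Nat.prime_two).1 h with h | h <;> simp [h]
    · rcases (Nat.dvd_prime Nat.prime_three).1 h with h | h <;> simp [h]
    · rcases (Nat.dvd_prime Nat.prime_five).1 h with h | h <;> simp [h]
  rcases h3 with h | h | h | h <;> rw [h] at h1 <;> omega

end PlaneFoliation

end

/-! ### Homogeneous parts of the affine field, divergence and radial component -/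

noncomputable section

namespace PlaneFoliation

/-- The expansion of a form in three variables in powers of the last one. -/
theorem exists_expansion {f : MvPolynomial (Fin 3) ℂ} {n : ℕ} (hf : f.IsHomogeneous n) :
    ∃ c : ℕ → BinaryPoly, (∀ j, (c j).IsHomogeneous j) ∧ (∀ j, n < j → c j = 0) ∧
      ∀ (x : Fin 2 → ℂ) (t : ℂ), MvPolynomial.eval ![x 0, x 1, t] f =
        ∑ j ∈ Finset.range (n + 1), t ^ (n - j) * MvPolynomial.eval x (c j) := by
  classical
  have hdeg : ∀ m ∈ f.support, m 0 + m 1 + m 2 = n := fun m hm => by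
    have := hf.degree_eq_sum_deg_support hm
    rw [this, ← Finsupp.degree_apply, Finsupp.degree_eq_sum, Fin.sum_univ_three]
  refine ⟨fun j => ∑ m ∈ f.support with m 0 + m 1 = j,
    MvPolynomial.C (f.coeff m) * (MvPolynomial.X 0 ^ m 0 * MvPolynomial.X 1 ^ m 1), ?_, ?_, ?_⟩
  · intro j
    refine MvPolynomial.IsHomogeneous.sum _ _ _ fun m hm => ?_
    rw [Finset.mem_filter] at hm
    rw [← hm.2]
    exact ((MvPolynomial.isHomogeneous_X_pow _ _).mul
      (MvPolynomial.isHomogeneous_X_pow _ _)).C_mul _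
  · intro j hj
    refine Finset.sum_eq_zero fun m hm => ?_
    rw [Finset.mem_filter] at hm
    have := hdeg m hm.1
    omega
  · intro x t
    rw [MvPolynomial.eval_eq', ← Finset.sum_fiberwise_of_maps_to (t := Finset.range (n + 1))
      (g := fun m => m 0 + m 1)]
    · refine Finset.sum_congr rfl fun j hj => ?_
      rw [map_sum, Finset.mul_sum]
      refine Finset.sum_congr rfl fun m hm => ?_
      rw [Finset.mem_filter] at hm
      have h2 : m 2 = n - j := by
        have := hdeg m hm.1
        omega
      rw [Fin.prod_univ_three, ← h2]
      simp
      ring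
    · intro m hm
      have := hdeg m hm
      simp only [Finset.mem_range]
      omega

theorem sum_pow_mul_injective {n : ℕ} {α β : ℕ → ℂ}
    (h : ∀ t : ℂ, t ≠ 0 → ∑ j ∈ Finset.range (n + 1), t ^ (n - j) * α j =
      ∑ j ∈ Finset.range (n + 1), t ^ (n - j) * β j) {j : ℕ} (hj : j ≤ n) : α j = β j := by
  have key : (∑ j ∈ Finset.range (n + 1), Polynomial.monomial (n - j) (α j)) =
      ∑ j ∈ Finset.range (n + 1), Polynomial.monomial (n - j) (β j) := by
    refine Polynomial.eq_of_infinite_eval_eq _ _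
      ((Set.finite_singleton (0 : ℂ)).infinite_compl.mono ?_)
    intro t (ht : t ≠ 0)
    have := h t ht
    simpa [Polynomial.eval_finsetSum, Polynomial.eval_monomial, mul_comm] using this
  have hc := congrArg (fun q => Polynomial.coeff q (n - j)) key
  have e : ∀ γ : ℕ → ℂ, (∑ i ∈ Finset.range (n + 1), Polynomial.monomial (n - i) (γ i)).coeff (n - j) =
      γ j := by
    intro γ
    rw [Polynomial.finsetSum_coeff, Finset.sum_eq_single_of_mem j (by simp; omega)]
    · simp
    · intro i hi hij
      rw [Polynomial.coeff_monomial, if_neg]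
      simp only [Finset.mem_range] at hi
      omega
  simpa [e] using hc

/-- The homogeneous parts, in the affine chart, of the field `z ∧ v(z)`. -/
structure Parts {d : ℕ} (F : Foliation d) where
  a : ℕ → BinaryPoly
  b : ℕ → BinaryPoly
  homogeneous_a : ∀ j, (a j).IsHomogeneous j
  homogeneous_b : ∀ j, (b j).IsHomogeneous j
  a_eq_zero : ∀ j, d + 1 < j → a j = 0
  b_eq_zero : ∀ j, d + 1 < j → b j = 0
  -- The highest part is radial: `x` times the second coordinate of `z ∧ v` minus `y` times the
  -- first is `t` times the third, which is zero on `t = 0`. For the same reason the sum in the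
  -- third coordinate stops at `d`.
  top : MvPolynomial.X 0 * b (d + 1) - MvPolynomial.X 1 * a (d + 1) = 0
  wedge_eq : ∀ (x : Fin 2 → ℂ) (t : ℂ),
    wedge ![x 0, x 1, t] (evalField F.v ![x 0, x 1, t]) =
      ![∑ j ∈ Finset.range (d + 2), t ^ (d + 1 - j) * MvPolynomial.eval x (a j),
        ∑ j ∈ Finset.range (d + 2), t ^ (d + 1 - j) * MvPolynomial.eval x (b j),
        ∑ j ∈ Finset.range (d + 1), t ^ (d - j) *
          (x 0 * MvPolynomial.eval x (b j) - x 1 * MvPolynomial.eval x (a j))]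

theorem Foliation.nonempty_parts {d : ℕ} (F : Foliation d) : Nonempty (Parts F) := by
  obtain ⟨a, ha, ha0, hae⟩ := exists_expansion (wedgePoly_homogeneous F.homogeneous 0)
  obtain ⟨b, hb, hb0, hbe⟩ := exists_expansion (wedgePoly_homogeneous F.homogeneous 1)
  have h2 : ∀ (x : Fin 2 → ℂ) (t : ℂ), t * MvPolynomial.eval ![x 0, x 1, t] (wedgePoly F.v 2) =
      ∑ j ∈ Finset.range (d + 2), t ^ (d + 1 - j) *
        (x 0 * MvPolynomial.eval x (b j) - x 1 * MvPolynomial.eval x (a j)) := by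
    intro x t
    have e : t * MvPolynomial.eval ![x 0, x 1, t] (wedgePoly F.v 2) =
        x 0 * MvPolynomial.eval ![x 0, x 1, t] (wedgePoly F.v 1) -
          x 1 * MvPolynomial.eval ![x 0, x 1, t] (wedgePoly F.v 0) := by
      simp [wedgePoly]
      ring
    rw [e, hae, hbe, Finset.mul_sum, Finset.mul_sum, ← Finset.sum_sub_distrib]
    exact Finset.sum_congr rfl fun j _ => by ring
  have htop : ∀ x : Fin 2 → ℂ, x 0 * MvPolynomial.eval x (b (d + 1)) -
      x 1 * MvPolynomial.eval x (a (d + 1)) = 0 := by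
    intro x
    have := h2 x 0
    rw [zero_mul, Finset.sum_range_succ, Finset.sum_eq_zero] at this
    · simpa using this.symm
    · intro j hj
      rw [Finset.mem_range] at hj
      rw [zero_pow (by omega), zero_mul]
  have h2' : ∀ (x : Fin 2 → ℂ) (t : ℂ), MvPolynomial.eval ![x 0, x 1, t] (wedgePoly F.v 2) =
      ∑ j ∈ Finset.range (d + 1), t ^ (d - j) *
        (x 0 * MvPolynomial.eval x (b j) - x 1 * MvPolynomial.eval x (a j)) := by
    -- Division of `h2` by `t`: the two sides are polynomials in `t` that agree for `t ≠ 0`.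
    intro x
    obtain ⟨q, hq⟩ := exists_polynomial_eval_line (wedgePoly F.v 2) ![x 0, x 1, 0] ![0, 0, 1]
    have hv : ∀ t : ℂ, ![x 0, x 1, 0] + t • ![0, 0, 1] = ![x 0, x 1, t] := fun t => by simp
    have key : q = ∑ j ∈ Finset.range (d + 1), Polynomial.monomial (d - j)
        (x 0 * MvPolynomial.eval x (b j) - x 1 * MvPolynomial.eval x (a j)) := by
      refine Polynomial.eq_of_infinite_eval_eq _ _
        ((Set.finite_singleton (0 : ℂ)).infinite_compl.mono ?_)
      intro t (ht : t ≠ 0)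
      have e := h2 x t
      rw [Finset.sum_range_succ, htop, mul_zero, add_zero] at e
      rw [Set.mem_ofPred_eq, hq, hv, Polynomial.eval_finsetSum]
      refine mul_left_cancel₀ ht ?_
      rw [e, Finset.mul_sum]
      refine Finset.sum_congr rfl fun j hj => ?_
      rw [Finset.mem_range] at hj
      rw [Polynomial.eval_monomial, show d + 1 - j = d - j + 1 by omega]
      ring
    intro t
    rw [← hv, ← hq, key, Polynomial.eval_finsetSum]
    exact Finset.sum_congr rfl fun j hj => by rw [Polynomial.eval_monomial, mul_comm]
  refine ⟨⟨a, b, ha, hb, ha0, hb0, MvPolynomial.funext fun x => ?_, fun x t => ?_⟩⟩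
  · simpa using htop x
  · ext i
    rw [← eval_wedgePoly]
    fin_cases i
    · exact hae x t
    · exact hbe x t
    · exact h2' x t

/-- That the factor `c` does not depend on `z` comes from `Foliation.wedge_eq_of_plane_eq`, applied
to `F` and its transport by `A`. -/
theorem Foliation.invariant_affine_iff {d : ℕ} (F : Foliation d) (A : GL (Fin 2) ℂ) :
    F.Invariant (affineEmbedding A) ↔ ∃ c : ℂ, c ≠ 0 ∧ ∀ z : Fin 3 → ℂ,
      wedge ((affineEmbedding A : Matrix (Fin 3) (Fin 3) ℂ).mulVec z)
        (evalField F.v ((affineEmbedding A : Matrix (Fin 3) (Fin 3) ℂ).mulVec z)) =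
      c • ![A 0 0 * wedge z (evalField F.v z) 0 + A 0 1 * wedge z (evalField F.v z) 1,
        A 1 0 * wedge z (evalField F.v z) 0 + A 1 1 * wedge z (evalField F.v z) 1,
        (A 0 0 * A 1 1 - A 0 1 * A 1 0) * wedge z (evalField F.v z) 2] := by
  constructor
  · intro h
    have hpl : ∀ z : Fin 3 → ℂ, z ≠ 0 →
        F.plane z = (F.transport (affineEmbedding A)).plane z := fun z hz => by
      apply map_mulVecLin_injective (affineEmbedding A)
      rw [h z hz, F.map_plane_transport]
    obtain ⟨-, c, hc, e⟩ := F.wedge_eq_of_plane_eq _ hpl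
    refine ⟨c, hc, fun z => ?_⟩
    have e1 : evalField F.v ((affineEmbedding A : Matrix (Fin 3) (Fin 3) ℂ).mulVec z) =
        (affineEmbedding A : Matrix (Fin 3) (Fin 3) ℂ).mulVec
          (evalField (F.transport (affineEmbedding A)).v z) := by
      rw [Foliation.transport, evalField_pullback, mulVec_inv_mulVec]
    rw [e1, wedge_affine, e]
    ext i
    fin_cases i <;> simp <;> ring
  · rintro ⟨c, hc, h⟩ z hz
    rw [map_plane, Foliation.plane, span_pair_eq_iff (mulVec_ne_zero _ hz)]
    refine ⟨c⁻¹, inv_ne_zero hc, ?_⟩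
    rw [h, wedge_affine, smul_smul, inv_mul_cancel₀ hc, one_smul]

theorem affineEmbedding_mulVec (A : GL (Fin 2) ℂ) (x : Fin 2 → ℂ) (t : ℂ) :
    (affineEmbedding A : Matrix (Fin 3) (Fin 3) ℂ).mulVec ![x 0, x 1, t] =
      ![(A : Matrix (Fin 2) (Fin 2) ℂ).mulVec x 0, (A : Matrix (Fin 2) (Fin 2) ℂ).mulVec x 1, t] := by
  ext i
  fin_cases i <;> simp [affineEmbedding, Matrix.mulVec, dotProduct, Fin.sum_univ_succ]

theorem eq_vec_three (z : Fin 3 → ℂ) : z = ![(![z 0, z 1] : Fin 2 → ℂ) 0, (![z 0, z 1] : Fin 2 → ℂ) 1, z 2] := by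
  ext i
  fin_cases i <;> rfl

/-- The planar vector field `(a, b)` is multiplied by `χ` by the linear map `A`. -/
def FieldScaled (A : GL (Fin 2) ℂ) (χ : ℂ) (a b : BinaryPoly) : Prop :=
  ∀ x : Fin 2 → ℂ,
    MvPolynomial.eval ((A : Matrix (Fin 2) (Fin 2) ℂ).mulVec x) a =
      χ * (A 0 0 * MvPolynomial.eval x a + A 0 1 * MvPolynomial.eval x b) ∧
    MvPolynomial.eval ((A : Matrix (Fin 2) (Fin 2) ℂ).mulVec x) b =
      χ * (A 1 0 * MvPolynomial.eval x a + A 1 1 * MvPolynomial.eval x b)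

/-- `A` leaves `t` alone, so coefficients of powers of `t` can be compared; that one `χ` serves all
`j` is what bounds the scalars in the group. -/
theorem Parts.fieldScaled {d : ℕ} {F : Foliation d} (P : Parts F) {A : GL (Fin 2) ℂ}
    (h : F.Invariant (affineEmbedding A)) :
    ∃ χ : ℂ, χ ≠ 0 ∧ ∀ j, FieldScaled A χ (P.a j) (P.b j) := by
  obtain ⟨c, hc, h⟩ := (F.invariant_affine_iff A).1 h
  refine ⟨c, hc, fun j => ?_⟩
  by_cases hj : d + 1 < j
  · intro x
    simp [P.a_eq_zero j hj, P.b_eq_zero j hj]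
  · intro x
    have key : ∀ t, _ := fun t => h ![x 0, x 1, t]
    simp only [affineEmbedding_mulVec, P.wedge_eq] at key
    constructor
    · refine sum_pow_mul_injective (n := d + 1) (α := fun j => MvPolynomial.eval
        ((A : Matrix (Fin 2) (Fin 2) ℂ).mulVec x) (P.a j)) (β := fun j => c * (A 0 0 *
          MvPolynomial.eval x (P.a j) + A 0 1 * MvPolynomial.eval x (P.b j)))
        (fun t _ => ?_) (by omega : j ≤ d + 1)
      have := congrFun (key t) 0
      simp only [Matrix.cons_val, Pi.smul_apply, smul_eq_mul] at this
      rw [this, Finset.mul_sum, Finset.mul_sum, ← Finset.sum_add_distrib, Finset.mul_sum]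
      exact Finset.sum_congr rfl fun j _ => by ring
    · refine sum_pow_mul_injective (n := d + 1) (α := fun j => MvPolynomial.eval
        ((A : Matrix (Fin 2) (Fin 2) ℂ).mulVec x) (P.b j)) (β := fun j => c * (A 1 0 *
          MvPolynomial.eval x (P.a j) + A 1 1 * MvPolynomial.eval x (P.b j)))
        (fun t _ => ?_) (by omega : j ≤ d + 1)
      have := congrFun (key t) 1
      simp only [Matrix.cons_val, Pi.smul_apply, smul_eq_mul] at this
      rw [this, Finset.mul_sum, Finset.mul_sum, ← Finset.sum_add_distrib, Finset.mul_sum]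
      exact Finset.sum_congr rfl fun j _ => by ring

/-- The divergence of a planar vector field. -/
def divergence (a b : BinaryPoly) : BinaryPoly := MvPolynomial.pderiv 0 a + MvPolynomial.pderiv 1 b

/-- The radial component `x b - y a` of a planar vector field. -/
def radialDet (a b : BinaryPoly) : BinaryPoly := MvPolynomial.X 0 * b - MvPolynomial.X 1 * a

theorem det_ne_zero_fin_two (A : GL (Fin 2) ℂ) : A 0 0 * A 1 1 - A 0 1 * A 1 0 ≠ 0 := by
  have : (A : Matrix (Fin 2) (Fin 2) ℂ).det ≠ 0 := Matrix.GeneralLinearGroup.det_ne_zero A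
  rwa [Matrix.det_fin_two] at this

/-- `x b - y a` is the determinant of the position vector and the field, hence the factor `det A`.
-/
theorem FieldScaled.eval_radialDet {A : GL (Fin 2) ℂ} {χ : ℂ} {a b : BinaryPoly}
    (h : FieldScaled A χ a b) (x : Fin 2 → ℂ) :
    MvPolynomial.eval ((A : Matrix (Fin 2) (Fin 2) ℂ).mulVec x) (radialDet a b) =
      χ * (A 0 0 * A 1 1 - A 0 1 * A 1 0) * MvPolynomial.eval x (radialDet a b) := by
  simp only [radialDet, map_sub, map_mul, MvPolynomial.eval_X, (h x).1, (h x).2]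
  simp only [Matrix.mulVec, dotProduct, Fin.sum_univ_two]
  ring

/-- The chain rule gives `J(Ax) A = χ A J(x)` for the Jacobian matrix `J`; conjugate matrices have
the same trace, and the divergence is the trace of `J`. -/
theorem FieldScaled.eval_divergence {A : GL (Fin 2) ℂ} {χ : ℂ} {a b : BinaryPoly}
    (h : FieldScaled A χ a b) (x : Fin 2 → ℂ) :
    MvPolynomial.eval ((A : Matrix (Fin 2) (Fin 2) ℂ).mulVec x) (divergence a b) =
      χ * MvPolynomial.eval x (divergence a b) := by
  have ha : subst A a = MvPolynomial.C χ * (MvPolynomial.C (A 0 0) * a + MvPolynomial.C (A 0 1) * b) :=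
    MvPolynomial.funext fun x => by rw [eval_subst, (h x).1]; simp
  have hb : subst A b = MvPolynomial.C χ * (MvPolynomial.C (A 1 0) * a + MvPolynomial.C (A 1 1) * b) :=
    MvPolynomial.funext fun x => by rw [eval_subst, (h x).2]; simp
  have e : ∀ j, _ := fun j => (pderiv_subst A a j).symm.trans (congrArg (MvPolynomial.pderiv j) ha)
  have e' : ∀ j, _ := fun j => (pderiv_subst A b j).symm.trans (congrArg (MvPolynomial.pderiv j) hb)
  have e0 := congrArg (MvPolynomial.eval x) (e 0)
  have e1 := congrArg (MvPolynomial.eval x) (e 1)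
  have e0' := congrArg (MvPolynomial.eval x) (e' 0)
  have e1' := congrArg (MvPolynomial.eval x) (e' 1)
  simp only [map_add, map_mul, MvPolynomial.pderiv_C_mul, MvPolynomial.eval_C, eval_subst] at e0 e1 e0' e1'
  refine mul_left_cancel₀ (det_ne_zero_fin_two A) ?_
  simp only [divergence, map_add]
  linear_combination A 1 1 * e0 - A 1 0 * e1 + A 0 0 * e1' - A 0 1 * e0'

theorem homogeneous_radialDet {a b : BinaryPoly} {j : ℕ} (ha : a.IsHomogeneous j)
    (hb : b.IsHomogeneous j) : (radialDet a b).IsHomogeneous (j + 1) := by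
  have h : ∀ (i : Fin 2) {f : BinaryPoly}, f.IsHomogeneous j →
      (MvPolynomial.X i * f).IsHomogeneous (j + 1) := fun i f hf => by
    have := (MvPolynomial.isHomogeneous_X ℂ i).mul hf
    rwa [add_comm] at this
  exact (h 0 hb).sub (h 1 ha)

theorem homogeneous_divergence {a b : BinaryPoly} {j : ℕ} (ha : a.IsHomogeneous j)
    (hb : b.IsHomogeneous j) : (divergence a b).IsHomogeneous (j - 1) :=
  ha.pderiv.add hb.pderiv

/-- A homogeneous planar vector field is determined by its divergence and its radial component. -/
theorem field_decomposition {a b : BinaryPoly} {j : ℕ} (ha : a.IsHomogeneous j)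
    (hb : b.IsHomogeneous j) :
    ((j : BinaryPoly) + 1) * a = MvPolynomial.X 0 * divergence a b -
      MvPolynomial.pderiv 1 (radialDet a b) ∧
    ((j : BinaryPoly) + 1) * b = MvPolynomial.X 1 * divergence a b +
      MvPolynomial.pderiv 0 (radialDet a b) := by
  -- Euler's identity for both components is all that is needed.
  have h1 := ha.sum_X_mul_pderiv
  have h2 := hb.sum_X_mul_pderiv
  rw [Fin.sum_univ_two, nsmul_eq_mul] at h1 h2
  simp only [divergence, radialDet, map_sub, MvPolynomial.pderiv_mul, MvPolynomial.pderiv_X_self,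
    MvPolynomial.pderiv_X_of_ne (show (0 : Fin 2) ≠ 1 by decide),
    MvPolynomial.pderiv_X_of_ne (show (1 : Fin 2) ≠ 0 by decide)]
  constructor
  · linear_combination -h1
  · linear_combination -h2

theorem natCast_add_one_ne_zero (j : ℕ) : ((j : BinaryPoly) + 1) ≠ 0 := by
  exact_mod_cast j.succ_ne_zero

theorem field_eq_zero {a b : BinaryPoly} {j : ℕ} (ha : a.IsHomogeneous j)
    (hb : b.IsHomogeneous j) (h : divergence a b = 0) (h' : radialDet a b = 0) :
    a = 0 ∧ b = 0 := by
  have := field_decomposition ha hb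
  rw [h, h'] at this
  simpa [natCast_add_one_ne_zero] using this

/-- If there is only one nonzero part, the foliation is preserved by the homotheties. -/
theorem Parts.invariant_scalar {d : ℕ} {F : Foliation d} (P : Parts F) {k : ℕ}
    (hk : ∀ j, j ≠ k → P.a j = 0 ∧ P.b j = 0) (u : ℂˣ) :
    F.Invariant (affineEmbedding (Matrix.GeneralLinearGroup.scalar (Fin 2) u)) := by
  have hu : (u : ℂ) ≠ 0 := u.ne_zero
  rw [F.invariant_affine_iff]
  refine ⟨(u : ℂ) ^ k / u, div_ne_zero (pow_ne_zero _ hu) hu, fun z => ?_⟩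
  rw [eq_vec_three z]
  generalize (![z 0, z 1] : Fin 2 → ℂ) = x
  generalize z 2 = t
  have hmul : ((Matrix.GeneralLinearGroup.scalar (Fin 2) u : GL (Fin 2) ℂ) :
      Matrix (Fin 2) (Fin 2) ℂ).mulVec x = (u : ℂ) • x := by
    rw [Matrix.GeneralLinearGroup.coe_scalar]
    ext i
    fin_cases i <;> simp [Matrix.mulVec, dotProduct]
  have hsub : ∀ j ≠ k, P.a j = 0 ∧ P.b j = 0 := hk
  have ea : ∀ j, MvPolynomial.eval ((u : ℂ) • x) (P.a j) = (u : ℂ) ^ k * MvPolynomial.eval x (P.a j) := by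
    intro j
    by_cases hj : j = k
    · subst hj
      exact eval_smul_of_isHomogeneous (P.homogeneous_a j) _ _
    · simp [(hk j hj).1]
  have eb : ∀ j, MvPolynomial.eval ((u : ℂ) • x) (P.b j) = (u : ℂ) ^ k * MvPolynomial.eval x (P.b j) := by
    intro j
    by_cases hj : j = k
    · subst hj
      exact eval_smul_of_isHomogeneous (P.homogeneous_b j) _ _
    · simp [(hk j hj).2]
  rw [affineEmbedding_mulVec, P.wedge_eq, P.wedge_eq, hmul]
  simp only [ea, eb]
  ext i
  fin_cases i
  · simp only [Fin.zero_eta, Matrix.cons_val, Pi.smul_apply, smul_eq_mul]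
    simp only [Matrix.GeneralLinearGroup.coe_scalar, Matrix.scalar_apply, Matrix.diagonal_apply]
    simp
    rw [Finset.mul_sum, Finset.mul_sum]
    refine Finset.sum_congr rfl fun j _ => ?_
    field_simp
  · simp only [Fin.mk_one, Matrix.cons_val, Pi.smul_apply, smul_eq_mul]
    simp only [Matrix.GeneralLinearGroup.coe_scalar, Matrix.scalar_apply, Matrix.diagonal_apply]
    simp
    rw [Finset.mul_sum, Finset.mul_sum]
    refine Finset.sum_congr rfl fun j _ => ?_
    field_simp
  · simp only [Fin.reduceFinMk, Matrix.cons_val, Pi.smul_apply, smul_eq_mul]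
    simp only [Matrix.GeneralLinearGroup.coe_scalar, Matrix.scalar_apply, Matrix.diagonal_apply]
    simp
    rw [Finset.mul_sum, Finset.mul_sum]
    refine Finset.sum_congr rfl fun j _ => ?_
    field_simp

/-- The line at infinity is not contained in the singular set. -/
theorem Parts.top_ne_zero {d : ℕ} {F : Foliation d} (P : Parts F) :
    (P.a (d + 1) ≠ 0 ∨ P.b (d + 1) ≠ 0) ∨ radialDet (P.a d) (P.b d) ≠ 0 := by
  by_contra! h
  obtain ⟨⟨h1, h2⟩, h3⟩ := h
  -- On `t = 0` the field `z ∧ v` reduces to `(a (d + 1), b (d + 1), Q_d)`, which cannot vanish on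
  -- the whole line.
  obtain ⟨z, hz, hz2, hw⟩ := F.exists_zero_wedge_ne_zero (MvPolynomial.isHomogeneous_X ℂ 2) le_rfl
  rw [MvPolynomial.eval_X] at hz2
  refine hw ?_
  have e := eq_vec_three z
  rw [hz2] at e
  rw [e, P.wedge_eq]
  generalize (![z 0, z 1] : Fin 2 → ℂ) = x
  have h3' := congrArg (MvPolynomial.eval x) h3
  simp only [radialDet, map_sub, map_mul, MvPolynomial.eval_X, map_zero] at h3'
  ext i
  fin_cases i
  · simp only [Fin.zero_eta, Matrix.cons_val, Pi.zero_apply]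
    rw [Finset.sum_range_succ, h1, map_zero, mul_zero, add_zero]
    refine Finset.sum_eq_zero fun j hj => ?_
    rw [Finset.mem_range] at hj
    rw [zero_pow (by omega), zero_mul]
  · simp only [Fin.mk_one, Matrix.cons_val, Pi.zero_apply]
    rw [Finset.sum_range_succ, h2, map_zero, mul_zero, add_zero]
    refine Finset.sum_eq_zero fun j hj => ?_
    rw [Finset.mem_range] at hj
    rw [zero_pow (by omega), zero_mul]
  · simp only [Fin.reduceFinMk, Matrix.cons_val, Pi.zero_apply]
    rw [Finset.sum_range_succ, h3', mul_zero, add_zero]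
    refine Finset.sum_eq_zero fun j hj => ?_
    rw [Finset.mem_range] at hj
    rw [zero_pow (by omega), zero_mul]

end PlaneFoliation

end

/-! ### The bound for the group and the normal form of the foliation -/

noncomputable section

namespace PlaneFoliation

/-- `IsSemiInvariant` concerns every matrix with class in `K`; each is a scalar multiple of an
element of `G`, and homogeneity absorbs the scalar. -/
theorem isSemiInvariant_projectivization {G : Subgroup (GL (Fin 2) ℂ)} {f : BinaryPoly} {m : ℕ}
    (hf : f.IsHomogeneous m) (h : ∀ A ∈ G, ∃ χ : ℂ, χ ≠ 0 ∧ ∀ x : Fin 2 → ℂ,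
      MvPolynomial.eval ((A : Matrix (Fin 2) (Fin 2) ℂ).mulVec x) f =
        χ * MvPolynomial.eval x f) : IsSemiInvariant (projectivization G) f := by
  intro B hB
  obtain ⟨A, hA, hAB⟩ := hB
  obtain ⟨u, rfl⟩ := Matrix.ProjGenLinGroup.mk_eq_mk_iff.1 hAB
  obtain ⟨χ, hχ, h⟩ := h A hA
  refine ⟨(u : ℂ) ^ m * χ, mul_ne_zero (pow_ne_zero _ u.ne_zero) hχ, fun x => ?_⟩
  have e : ((A * Matrix.GeneralLinearGroup.scalar (Fin 2) u : GL (Fin 2) ℂ) :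
      Matrix (Fin 2) (Fin 2) ℂ).mulVec x = (u : ℂ) • (A : Matrix (Fin 2) (Fin 2) ℂ).mulVec x := by
    rw [Units.val_mul, Matrix.GeneralLinearGroup.coe_scalar]
    simp [← Matrix.smul_one_eq_diagonal, Matrix.smul_mulVec]
  rw [e, eval_smul_of_isHomogeneous hf, h]
  ring

variable {d : ℕ} {F : Foliation d} {G : Subgroup (GL (Fin 2) ℂ)}

theorem Parts.isSemiInvariant_radialDet (P : Parts F)
    (hinv : ∀ A ∈ G, F.Invariant (affineEmbedding A)) (j : ℕ) :
    IsSemiInvariant (projectivization G) (radialDet (P.a j) (P.b j)) := by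
  refine isSemiInvariant_projectivization
    (homogeneous_radialDet (P.homogeneous_a j) (P.homogeneous_b j)) fun A hA => ?_
  obtain ⟨χ, hχ, h⟩ := P.fieldScaled (hinv A hA)
  exact ⟨_, mul_ne_zero hχ (det_ne_zero_fin_two A), (h j).eval_radialDet⟩

theorem Parts.isSemiInvariant_divergence (P : Parts F)
    (hinv : ∀ A ∈ G, F.Invariant (affineEmbedding A)) (j : ℕ) :
    IsSemiInvariant (projectivization G) (divergence (P.a j) (P.b j)) := by
  refine isSemiInvariant_projectivization
    (homogeneous_divergence (P.homogeneous_a j) (P.homogeneous_b j)) fun A hA => ?_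
  obtain ⟨χ, hχ, h⟩ := P.fieldScaled (hinv A hA)
  exact ⟨χ, hχ, (h j).eval_divergence⟩

/-- `j` is the degree of a nonzero part. -/
def Parts.IsWeight (P : Parts F) (j : ℕ) : Prop := P.a j ≠ 0 ∨ P.b j ≠ 0

theorem Parts.IsWeight.le {P : Parts F} {j : ℕ} (h : P.IsWeight j) : j ≤ d + 1 := by
  by_contra hj
  exact h.elim (fun h => h (P.a_eq_zero j (by omega))) fun h => h (P.b_eq_zero j (by omega))

/-- A scalar matrix multiplies a part of degree `j` by `c ^ j`, while `FieldScaled` says `χ * c`. -/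
theorem Parts.IsWeight.scalar {P : Parts F} {j : ℕ} (h : P.IsWeight j) {A : GL (Fin 2) ℂ} {χ c : ℂ}
    (hχ : FieldScaled A χ (P.a j) (P.b j)) (hA : (A : Matrix (Fin 2) (Fin 2) ℂ) = c • 1) :
    c ^ j = χ * c := by
  have hmul : ∀ x, (A : Matrix (Fin 2) (Fin 2) ℂ).mulVec x = c • x := fun x => by
    rw [hA, Matrix.smul_mulVec, Matrix.one_mulVec]
  have key : ∀ x, c ^ j * MvPolynomial.eval x (P.a j) = χ * c * MvPolynomial.eval x (P.a j) ∧
      c ^ j * MvPolynomial.eval x (P.b j) = χ * c * MvPolynomial.eval x (P.b j) := by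
    intro x
    have := hχ x
    rw [hmul, eval_smul_of_isHomogeneous (P.homogeneous_a j),
      eval_smul_of_isHomogeneous (P.homogeneous_b j)] at this
    simp only [hA] at this
    simpa [mul_assoc] using this
  by_contra hne
  refine h.elim (fun h => h (MvPolynomial.funext fun x => ?_))
    fun h => h (MvPolynomial.funext fun x => ?_)
  · rw [map_zero]
    by_contra h0
    exact hne (mul_right_cancel₀ h0 (key x).1)
  · rw [map_zero]
    by_contra h0
    exact hne (mul_right_cancel₀ h0 (key x).2)

/-- The kernel of `G → PGL₂` consists of scalars `c` with `c ^ i = χ c = c ^ j`, hence of at most `j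
- i` roots of unity. -/
theorem Parts.card_le (P : Parts F) (hinv : ∀ A ∈ G, F.Invariant (affineEmbedding A)) 
    {i j : ℕ} (hi : P.IsWeight i) (hj : P.IsWeight j) (hij : i < j) :
    Nat.card G ≤ Nat.card (projectivization G) * (j - i) := by
  let f : G →* Matrix.ProjGenLinGroup (Fin 2) ℂ := Matrix.ProjGenLinGroup.mk.comp G.subtype
  have hrange : f.range = projectivization G := by
    rw [projectivization, MonoidHom.range_comp, Subgroup.range_subtype]
  have hcard : Nat.card G = Nat.card f.ker * Nat.card f.range := by
    rw [← Subgroup.index_ker, Subgroup.card_mul_index]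
  rw [hcard, hrange, mul_comm]
  refine Nat.mul_le_mul_left _ ?_
  have hn : NeZero (j - i) := ⟨by omega⟩
  have hex : ∀ g : f.ker, ∃ c : ℂ, c ^ (j - i) = 1 ∧
      (((g : G) : GL (Fin 2) ℂ) : Matrix (Fin 2) (Fin 2) ℂ) = c • 1 := by
    intro g
    obtain ⟨c, hc⟩ := mk_eq_one_iff.1 g.2
    obtain ⟨χ, hχ, h⟩ := P.fieldScaled (hinv _ (g : G).2)
    have h1 := hi.scalar (h i) hc
    have h2 := hj.scalar (h j) hc
    have hc0 : c ≠ 0 := by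
      rintro rfl
      refine Matrix.GeneralLinearGroup.det_ne_zero ((g : G) : GL (Fin 2) ℂ) ?_
      change (((g : G) : GL (Fin 2) ℂ) : Matrix (Fin 2) (Fin 2) ℂ).det = 0
      have hc' : (((g : G) : GL (Fin 2) ℂ) : Matrix (Fin 2) (Fin 2) ℂ) = (0 : ℂ) • 1 := hc
      rw [hc']
      simp
    refine ⟨c, ?_, hc⟩
    refine mul_left_cancel₀ (pow_ne_zero i hc0) ?_
    rw [← pow_add, show i + (j - i) = j by omega, h2, h1, mul_one]
  choose c hc hc' using hex
  let φ : f.ker → rootsOfUnity (j - i) ℂ := fun g => rootsOfUnity.mkOfPowEq (c g) (hc g)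
  have hφ : Function.Injective φ := by
    intro g h e
    have e1 : c g = c h := congrArg (fun x : rootsOfUnity (j - i) ℂ => ((x : ℂˣ) : ℂ)) e
    refine Subtype.ext (Subtype.ext (Units.ext ?_))
    rw [hc', hc', e1]
  exact (Nat.card_le_card_of_injective φ hφ).trans_eq (Complex.card_rootsOfUnity _)

/-- Separates the case `j = 0`, where the truncated degree `j - 1` of the divergence is 0 and not
negative. -/
theorem divergence_eq_zero_of_constant {a b : BinaryPoly} (ha : a.IsHomogeneous 0)
    (hb : b.IsHomogeneous 0) : divergence a b = 0 := by
  have h1 := MvPolynomial.totalDegree_eq_zero_iff_eq_C.1 (Nat.le_zero.1 ha.totalDegree_le)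
  have h2 := MvPolynomial.totalDegree_eq_zero_iff_eq_C.1 (Nat.le_zero.1 hb.totalDegree_le)
  rw [divergence, h1, h2]
  simp

/-- A foliation is not tangent to the radial foliation. -/
theorem Parts.exists_radialDet_ne_zero (P : Parts F) (hd : 1 ≤ d) :
    ∃ j ≤ d, radialDet (P.a j) (P.b j) ≠ 0 := by
  by_contra! h
  have hQ : ∀ j, radialDet (P.a j) (P.b j) = 0 := by
    intro j
    rcases le_or_gt j d with hj | hj
    · exact h j hj
    · rcases eq_or_ne j (d + 1) with rfl | hj'
      · exact P.top
      · rw [radialDet, P.a_eq_zero j (by omega), P.b_eq_zero j (by omega)]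
        simp
  -- If all `Q_j` vanish, each part is `h_j / (j + 1)` times `(x, y)`, so `z ∧ v = g · (x, y, 0)`,
  -- and the zeros of `g` form a curve of singularities. This needs `deg g = d ≥ 1`.
  set g : MvPolynomial (Fin 3) ℂ := ∑ j ∈ Finset.range (d + 2),
    MvPolynomial.C ((j : ℂ) + 1)⁻¹ * (MvPolynomial.X 2 ^ (d + 1 - j) *
      MvPolynomial.rename Fin.castSucc (divergence (P.a j) (P.b j))) with hg
  have hghom : g.IsHomogeneous d := by
    refine MvPolynomial.IsHomogeneous.sum _ _ _ fun j hj => MvPolynomial.IsHomogeneous.C_mul ?_ _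
    rw [Finset.mem_range] at hj
    rcases Nat.eq_zero_or_pos j with rfl | hj0
    · rw [divergence_eq_zero_of_constant (P.homogeneous_a 0) (P.homogeneous_b 0), map_zero, mul_zero]
      exact MvPolynomial.isHomogeneous_zero _ _ _
    · have := (MvPolynomial.isHomogeneous_X_pow (R := ℂ) (2 : Fin 3) (d + 1 - j)).mul
        ((homogeneous_divergence (P.homogeneous_a j) (P.homogeneous_b j)).rename_isHomogeneous
          (f := Fin.castSucc))
      rwa [show d + 1 - j + (j - 1) = d by omega] at this
  obtain ⟨z, hz, hzg, hw⟩ := F.exists_zero_wedge_ne_zero hghom hd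
  refine hw ?_
  rw [eq_vec_three z, P.wedge_eq]
  have hr : ∀ f : BinaryPoly, MvPolynomial.eval z (MvPolynomial.rename Fin.castSucc f) =
      MvPolynomial.eval ![z 0, z 1] f := by
    intro f
    rw [MvPolynomial.eval_rename]
    congr 2
    ext i
    fin_cases i <;> rfl
  simp only [hg, map_sum, map_mul, MvPolynomial.eval_C, map_pow, MvPolynomial.eval_X, hr] at hzg
  have ha : ∀ j x, MvPolynomial.eval x (P.a j) =
      x 0 * (((j : ℂ) + 1)⁻¹ * MvPolynomial.eval x (divergence (P.a j) (P.b j))) := by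
    intro j x
    have := congrArg (MvPolynomial.eval x)
      (field_decomposition (P.homogeneous_a j) (P.homogeneous_b j)).1
    rw [hQ j] at this
    have hj : (j : ℂ) + 1 ≠ 0 := by exact_mod_cast j.succ_ne_zero
    simp at this
    field_simp
    linear_combination this
  have hb : ∀ j x, MvPolynomial.eval x (P.b j) =
      x 1 * (((j : ℂ) + 1)⁻¹ * MvPolynomial.eval x (divergence (P.a j) (P.b j))) := by
    intro j x
    have := congrArg (MvPolynomial.eval x)
      (field_decomposition (P.homogeneous_a j) (P.homogeneous_b j)).2
    rw [hQ j] at this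
    have hj : (j : ℂ) + 1 ≠ 0 := by exact_mod_cast j.succ_ne_zero
    simp at this
    field_simp
    linear_combination this
  have hs : ∀ s : ℂ, ∑ j ∈ Finset.range (d + 2), z 2 ^ (d + 1 - j) * (s * (((j : ℂ) + 1)⁻¹ *
      MvPolynomial.eval ![z 0, z 1] (divergence (P.a j) (P.b j)))) = 0 := by
    intro s
    rw [← mul_zero s, ← hzg, Finset.mul_sum]
    exact Finset.sum_congr rfl fun j _ => by ring
  ext i
  fin_cases i
  · simp only [ha, Fin.zero_eta, Matrix.cons_val, Pi.zero_apply]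
    exact hs _
  · simp only [hb, Fin.mk_one, Matrix.cons_val, Pi.zero_apply]
    exact hs _
  · simp only [ha, hb, Fin.reduceFinMk, Matrix.cons_val, Pi.zero_apply]
    exact Finset.sum_eq_zero fun j _ => by ring

theorem Parts.exists_isWeight_ne (P : Parts F)
    (hscal : ∃ u : ℂˣ, ¬ F.Invariant (affineEmbedding (Matrix.GeneralLinearGroup.scalar (Fin 2) u)))
    (k : ℕ) : ∃ j, j ≠ k ∧ P.IsWeight j := by
  by_contra! h
  obtain ⟨u, hu⟩ := hscal
  refine hu (P.invariant_scalar (k := k) (fun j hj => ?_) u)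
  have := h j hj
  rw [Parts.IsWeight] at this
  push Not at this
  exact this

theorem Parts.IsWeight.divergence_or (P : Parts F) {j : ℕ} (h : P.IsWeight j) :
    divergence (P.a j) (P.b j) ≠ 0 ∨ radialDet (P.a j) (P.b j) ≠ 0 := by
  by_contra! h'
  have := field_eq_zero (P.homogeneous_a j) (P.homogeneous_b j) h'.1 h'.2
  exact h.elim (fun h => h this.1) fun h => h this.2

theorem Parts.isWeight_of_radialDet (P : Parts F) {j : ℕ}
    (h : radialDet (P.a j) (P.b j) ≠ 0) : P.IsWeight j := by
  by_contra h'
  rw [Parts.IsWeight] at h'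
  push Not at h'
  exact h (by rw [radialDet, h'.1, h'.2]; simp)

/-- A bound for the order of the group in terms of the degree. -/
theorem Parts.card_le_mul_degree (P : Parts F) (hinv : ∀ A ∈ G, F.Invariant (affineEmbedding A))
    (hscal : ∃ u : ℂˣ, ¬ F.Invariant (affineEmbedding (Matrix.GeneralLinearGroup.scalar (Fin 2) u)))
    (h1 : ∀ f : BinaryPoly, f.IsHomogeneous 1 → IsSemiInvariant (projectivization G) f → f = 0) :
    Nat.card G ≤ Nat.card (projectivization G) * d := by
  -- A constant field has no divergence, and its `Q_0` would be a semi-invariant linear form. Two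
  -- distinct weights then lie in `[1, d + 1]` and differ by at most `d`.
  have hpos : ∀ j, P.IsWeight j → 1 ≤ j := by
    intro j hj
    by_contra h0
    obtain rfl : j = 0 := by omega
    rcases hj.divergence_or with h | h
    · exact h (divergence_eq_zero_of_constant (P.homogeneous_a 0) (P.homogeneous_b 0))
    · exact h (h1 _ (homogeneous_radialDet (P.homogeneous_a 0) (P.homogeneous_b 0))
        (P.isSemiInvariant_radialDet hinv 0))
  obtain ⟨i, -, hi⟩ := P.exists_isWeight_ne hscal 0
  obtain ⟨j, hij, hj⟩ := P.exists_isWeight_ne hscal i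
  have hi1 := hpos i hi
  have hj1 := hpos j hj
  have hi2 := hi.le
  have hj2 := hj.le
  rcases lt_or_gt_of_ne hij with h | h
  · exact (P.card_le hinv hj hi h).trans (Nat.mul_le_mul_left _ (by omega))
  · exact (P.card_le hinv hi hj h).trans (Nat.mul_le_mul_left _ (by omega))

/-- The normal form of a foliation whose group has semi-invariants in few degrees. -/
theorem Parts.normal_form (P : Parts F) (hinv : ∀ A ∈ G, F.Invariant (affineEmbedding A))
    (hscal : ∃ u : ℂˣ, ¬ F.Invariant (affineEmbedding (Matrix.GeneralLinearGroup.scalar (Fin 2) u)))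
    {N : ℕ} (hN : 3 ≤ N)
    (hsemi : ∀ (m : ℕ) (f : BinaryPoly), m ≤ d + 1 → f.IsHomogeneous m →
      IsSemiInvariant (projectivization G) f → f ≠ 0 → m = 0 ∨ m = N)
    (hk : d = N → Nat.card (projectivization G) * 2 < Nat.card G) :
    d + 1 = N ∧ radialDet (P.a d) (P.b d) ≠ 0 ∧ divergence (P.a d) (P.b d) = 0 ∧
      (∀ j, j ≠ 1 → j ≠ d → P.a j = 0 ∧ P.b j = 0) ∧
      ∃ c : ℂ, c ≠ 0 ∧ P.a 1 = MvPolynomial.C c * MvPolynomial.X 0 ∧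
        P.b 1 = MvPolynomial.C c * MvPolynomial.X 1 := by
  -- `Q_j` has degree `j + 1 ≥ 1`, so only degree `N` is possible; `j = d + 1`, where the degree
  -- would exceed the range of `hsemi`, is excluded by `P.top`.
  have hQ : ∀ j, radialDet (P.a j) (P.b j) ≠ 0 → j + 1 = N := by
    intro j h
    have hj := (P.isWeight_of_radialDet h).le
    have hjd : j ≠ d + 1 := by
      rintro rfl
      exact h P.top
    have := hsemi (j + 1) _ (by omega)
      (homogeneous_radialDet (P.homogeneous_a j) (P.homogeneous_b j))
      (P.isSemiInvariant_radialDet hinv j) h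
    omega
  have hh : ∀ j, divergence (P.a j) (P.b j) ≠ 0 → j ≤ d + 1 ∧ (j = 1 ∨ j = N + 1) := by
    intro j h
    have hj : j ≤ d + 1 := by
      by_contra hj
      refine h ?_
      rw [divergence, P.a_eq_zero j (by omega), P.b_eq_zero j (by omega)]
      simp
    have h0 : j ≠ 0 := by
      rintro rfl
      exact h (divergence_eq_zero_of_constant (P.homogeneous_a 0) (P.homogeneous_b 0))
    have := hsemi (j - 1) _ (by omega)
      (homogeneous_divergence (P.homogeneous_a j) (P.homogeneous_b j))
      (P.isSemiInvariant_divergence hinv j) h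
    omega
  have hw : ∀ j, P.IsWeight j → j ≤ d + 1 ∧ (j = 1 ∨ j + 1 = N ∨ j = N + 1) := by
    intro j hj
    refine ⟨hj.le, ?_⟩
    rcases hj.divergence_or with h | h
    · have := hh j h
      omega
    · have := hQ j h
      omega
  -- If `Q_d` is nonzero then `d + 1 = N`, and the only other weight is 1, where the field is radial
  -- with constant divergence.
  by_cases htop : radialDet (P.a d) (P.b d) ≠ 0
  · have hdN := hQ d htop
    refine ⟨hdN, htop, ?_, ?_, ?_⟩
    · by_contra h
      have := hh d h
      omega
    · intro j hj1 hjd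
      by_contra h
      have : P.IsWeight j := by
        rw [Parts.IsWeight]
        by_contra! h'
        exact h h'
      have := hw j this
      omega
    · obtain ⟨j, hjd, hj⟩ := P.exists_isWeight_ne hscal d
      have hj1 : j = 1 := by
        have := hw j hj
        omega
      subst hj1
      have hQ1 : radialDet (P.a 1) (P.b 1) = 0 := by
        by_contra h
        have := hQ 1 h
        omega
      have hdiv := MvPolynomial.totalDegree_eq_zero_iff_eq_C.1 (Nat.le_zero.1
        (homogeneous_divergence (P.homogeneous_a 1) (P.homogeneous_b 1)).totalDegree_le)
      set c := MvPolynomial.coeff 0 (divergence (P.a 1) (P.b 1))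
      have h1 := field_decomposition (P.homogeneous_a 1) (P.homogeneous_b 1)
      rw [hQ1, hdiv] at h1
      have h2 : (MvPolynomial.C (c / 2) : BinaryPoly) * 2 = MvPolynomial.C c := by
        rw [← map_ofNat MvPolynomial.C, ← map_mul]
        congr 1
        ring
      have ha : P.a 1 = MvPolynomial.C (c / 2) * MvPolynomial.X 0 := by
        refine mul_left_cancel₀ (natCast_add_one_ne_zero 1) ?_
        rw [h1.1, map_zero]
        push_cast
        linear_combination -MvPolynomial.X 0 * h2
      have hb : P.b 1 = MvPolynomial.C (c / 2) * MvPolynomial.X 1 := by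
        refine mul_left_cancel₀ (natCast_add_one_ne_zero 1) ?_
        rw [h1.2, map_zero]
        push_cast
        linear_combination -MvPolynomial.X 1 * h2
      refine ⟨c / 2, ?_, ha, hb⟩
      intro h0
      rw [Parts.IsWeight, ha, hb, h0] at hj
      simp at hj
  · exfalso
    -- Otherwise the part of degree `d + 1` is nonzero and radial, so it has a divergence, of degree
    -- 0 or `N`. Degree 0 leaves no second weight. Degree `N` means `d = N`; some `Q_j` is nonzero,
    -- with `j = N - 1`, and the gap 2 between the weights makes `G` too small for `hk`.
    have hwt : P.IsWeight (d + 1) := P.top_ne_zero.resolve_right htop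
    have hdiv := hwt.divergence_or.resolve_right fun h => h P.top
    rcases (hh _ hdiv).2 with h | h
    · obtain ⟨j, hj1, hj⟩ := P.exists_isWeight_ne hscal 1
      have := hw j hj
      omega
    · have hdN : d = N := by omega
      obtain ⟨j, hj, hjQ⟩ := P.exists_radialDet_ne_zero (by omega)
      have hjN := hQ j hjQ
      have := P.card_le hinv (P.isWeight_of_radialDet hjQ) hwt (by omega)
      have hk := hk hdN
      rw [show d + 1 - j = 2 by omega] at this
      omega

end PlaneFoliation

end

/-! ### Semi-invariants in coordinates adapted to a stabilizer -/

noncomputable section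

namespace PlaneFoliation

/-- The expansion of a binary form. -/
theorem exists_coefficients {f : BinaryPoly} {n : ℕ} (hf : f.IsHomogeneous n) :
    ∃ c : ℕ → ℂ, ∀ x : Fin 2 → ℂ, MvPolynomial.eval x f =
      ∑ j ∈ Finset.range (n + 1), x 0 ^ (n - j) * (x 1 ^ j * c j) := by
  classical
  have hdeg : ∀ m ∈ f.support, m 0 + m 1 = n := fun m hm => by
    have := hf.degree_eq_sum_deg_support hm
    rw [this, ← Finsupp.degree_apply, Finsupp.degree_eq_sum, Fin.sum_univ_two]
  refine ⟨fun j => ∑ m ∈ f.support with m 1 = j, f.coeff m, fun x => ?_⟩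
  rw [MvPolynomial.eval_eq', ← Finset.sum_fiberwise_of_maps_to (t := Finset.range (n + 1))
    (g := fun m => m 1)]
  · refine Finset.sum_congr rfl fun j hj => ?_
    rw [Finset.mul_sum, Finset.mul_sum]
    refine Finset.sum_congr rfl fun m hm => ?_
    rw [Finset.mem_filter] at hm
    have h0 : m 0 = n - j := by
      have := hdeg m hm.1
      omega
    rw [Fin.prod_univ_two, ← h0, hm.2]
    ring
  · intro m hm
    have := hdeg m hm
    simp only [Finset.mem_range]
    omega

/-- A matrix with distinct eigenvalues is diagonalizable. -/
theorem exists_diagonalization {A : GL (Fin 2) ℂ} {w : Fin 2 → ℂ} (hw : w ≠ 0) {e ζ : ℂ}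
    (h : (A : Matrix (Fin 2) (Fin 2) ℂ).mulVec w = e • w)
    (hζ : ζ * (A : Matrix (Fin 2) (Fin 2) ℂ).det = e ^ 2) (hζ1 : ζ ≠ 1) :
    ∃ (B : GL (Fin 2) ℂ) (e' : ℂ), e' ≠ 0 ∧
      (B : Matrix (Fin 2) (Fin 2) ℂ).mulVec ![1, 0] = w ∧ ∀ x : Fin 2 → ℂ,
      (A : Matrix (Fin 2) (Fin 2) ℂ).mulVec ((B : Matrix (Fin 2) (Fin 2) ℂ).mulVec x) =
        (B : Matrix (Fin 2) (Fin 2) ℂ).mulVec ![ζ * e' * x 0, e' * x 1] := by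
  have hdet : (A : Matrix (Fin 2) (Fin 2) ℂ).det ≠ 0 := Matrix.GeneralLinearGroup.det_ne_zero A
  set M : Matrix (Fin 2) (Fin 2) ℂ := (A : Matrix (Fin 2) (Fin 2) ℂ) with hM
  have he : e ≠ 0 := by
    rintro rfl
    have hMw : M.mulVec w = 0 := by rw [h, zero_smul]
    exact mulVec_ne_zero A hw hMw
  set e' := M.det / e with he'
  have he'0 : e' ≠ 0 := div_ne_zero hdet he
  have hee : e = ζ * e' := by
    rw [he']
    field_simp
    linear_combination -hζ
  have htr := trace_eq_of_eigenvector hw h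
  have hdet' : M.det = e * e' := by rw [he']; field_simp
  have htr' : M 0 0 + M 1 1 = e + e' := by
    refine mul_right_cancel₀ he ?_
    rw [hdet'] at htr
    linear_combination -htr
  rw [Matrix.det_fin_two] at hdet'
  obtain ⟨u, hu⟩ : ∃ u : Fin 2 → ℂ, M.mulVec u ≠ e • u := by
    by_contra! hcon
    have h10 := hcon ![1, 0]
    have h01 := hcon ![0, 1]
    have e00 := congrFun h10 0
    have e10 := congrFun h10 1
    have e01 := congrFun h01 0
    have e11 := congrFun h01 1
    simp [Matrix.mulVec, dotProduct] at e00 e10 e01 e11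
    rw [e00, e10, e11] at hdet'
    have : e = e' := by
      refine mul_left_cancel₀ he ?_
      linear_combination hdet'
    rw [this] at hee
    refine hζ1 (mul_right_cancel₀ he'0 ?_)
    rw [← hee, one_mul]
  -- By Cayley–Hamilton, `M - e` maps every vector into the eigenspace of `e'`. A suitable `u`
  -- exists, since otherwise `M` would be the scalar `e` and `ζ` would be 1.
  set w' := M.mulVec u - e • u with hw'
  have hw'0 : w' ≠ 0 := sub_ne_zero.2 hu
  have hwi : ∀ i, w' i = M i 0 * u 0 + M i 1 * u 1 - e * u i := fun i => by
    simp only [hw', Pi.sub_apply, Pi.smul_apply, smul_eq_mul, Matrix.mulVec, dotProduct,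
      Fin.sum_univ_two]
  have hw'e : M.mulVec w' = e' • w' := by
    ext i
    simp only [Matrix.mulVec, dotProduct, Fin.sum_univ_two, Pi.smul_apply, smul_eq_mul, hwi]
    fin_cases i <;> simp only [Fin.zero_eta, Fin.mk_one]
    · linear_combination (u 0 * M 0 0 + u 1 * M 0 1) * htr' - u 0 * hdet'
    · linear_combination (u 0 * M 1 0 + u 1 * M 1 1) * htr' - u 1 * hdet'
  have hind : w 0 * w' 1 - w' 0 * w 1 ≠ 0 := by
    intro h0
    obtain ⟨c, hc⟩ := (eval_lin_eq_zero hw (z := w')).1 (by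
      rw [eval_lin]
      linear_combination -h0)
    have h1 : e' • w' = e • w' := by
      rw [← hw'e, ← hc, Matrix.mulVec_smul, h, smul_comm]
    have h2 : e' = e := smul_left_injective ℂ hw'0 h1
    rw [← h2] at hee
    refine hζ1 (mul_right_cancel₀ he'0 ?_)
    rw [← hee, one_mul]
  set N : Matrix (Fin 2) (Fin 2) ℂ := !![w 0, w' 0; w 1, w' 1] with hN
  have hNdet : N.det ≠ 0 := by
    rw [Matrix.det_fin_two]
    simpa [hN] using hind
  refine ⟨Matrix.GeneralLinearGroup.mkOfDetNeZero N hNdet, e', he'0, ?_, fun x => ?_⟩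
  · change N.mulVec ![1, 0] = w
    ext i
    fin_cases i <;> simp [hN]
  · change M.mulVec (N.mulVec x) = N.mulVec ![ζ * e' * x 0, e' * x 1]
    have h0 : ∀ y : Fin 2 → ℂ, N.mulVec y = y 0 • w + y 1 • w' := by
      intro y
      ext i
      fin_cases i <;> simp [hN, Matrix.mulVec, dotProduct, Fin.sum_univ_two] <;> ring
    rw [h0, h0, Matrix.mulVec_add, Matrix.mulVec_smul, Matrix.mulVec_smul, h, hw'e, ← hee]
    ext i
    simp
    ring

theorem lin_sq_dvd_of_coefficients {f : BinaryPoly} {n : ℕ} {c : ℕ → ℂ}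
    (hf : ∀ x : Fin 2 → ℂ, MvPolynomial.eval x f =
      ∑ j ∈ Finset.range (n + 1), x 0 ^ (n - j) * (x 1 ^ j * c j)) :
    (c 0 = 0 → c 1 = 0 → lin ![1, 0] ^ 2 ∣ f) ∧
    (c n = 0 → c (n - 1) = 0 → lin ![0, 1] ^ 2 ∣ f) := by
  have e : f = ∑ j ∈ Finset.range (n + 1), MvPolynomial.X 0 ^ (n - j) *
      (MvPolynomial.X 1 ^ j * MvPolynomial.C (c j)) := MvPolynomial.funext fun x => by
    rw [hf]
    simp
  have hl : lin ![1, 0] ^ 2 = MvPolynomial.X 1 ^ 2 := by simp [lin]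
  have hl' : lin ![0, 1] ^ 2 = MvPolynomial.X 0 ^ 2 := by simp [lin]
  rw [hl, hl', e]
  constructor
  · intro h0 h1
    refine Finset.dvd_sum fun j _ => ?_
    rcases Nat.lt_or_ge j 2 with hj | hj
    · have : c j = 0 := by interval_cases j <;> assumption
      simp [this]
    · exact ((pow_dvd_pow _ hj).mul_right _).mul_left _
  · intro h0 h1
    refine Finset.dvd_sum fun j hj => ?_
    rw [Finset.mem_range] at hj
    rcases Nat.lt_or_ge (n - j) 2 with hj' | hj'
    · have : c j = 0 := by
        rcases (by omega : j = n ∨ j = n - 1) with rfl | rfl <;> assumption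
      simp [this]
    · exact (pow_dvd_pow _ hj').mul_right _

/-- In eigencoordinates of a generator of the stabilizer of `p`, the monomial with exponent `j` of
the second variable is scaled by a constant times `ζ ^ (N - j)`. Semi-invariance leaves a single
class of `j` modulo `n`. The class is that of 1, because `p = [1 : 0]` is a simple zero. -/
theorem exists_coefficients_of_stabilizer {K : Subgroup (Matrix.ProjGenLinGroup (Fin 2) ℂ)}
    [Finite K] {f : BinaryPoly} {N n : ℕ} (hf : f.IsHomogeneous N) (hf0 : f ≠ 0)
    (hK : IsSemiInvariant K f) (p : PLine) (S : Finset PLine)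
    (hS : ∀ s, s ∈ S ↔ s ∈ MulAction.orbit K p) (hcard : S.card = N)
    (hfS : ∀ s ∈ S, MvPolynomial.eval s.rep f = 0)
    (hn : Nat.card (MulAction.stabilizer K p) = n) (hn2 : 2 ≤ n) (hN2 : 2 ≤ N) (hnN : n ∣ N - 2) :
    ∃ (B : GL (Fin 2) ℂ) (c : ℕ → ℂ),
      (∀ x, MvPolynomial.eval ((B : Matrix (Fin 2) (Fin 2) ℂ).mulVec x) f =
        ∑ j ∈ Finset.range (N + 1), x 0 ^ (N - j) * (x 1 ^ j * c j)) ∧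
      c 1 ≠ 0 ∧ c (N - 1) ≠ 0 ∧ ∀ j ≤ N, (¬ (n : ℤ) ∣ (j : ℤ) - 1) → c j = 0 := by
  classical
  obtain ⟨g, hg, ζ, hζ, hA⟩ := exists_generator_stabilizer (K := K) p
  rw [hg, hn] at hζ
  obtain ⟨A, hAg⟩ := Matrix.ProjGenLinGroup.mk_surjective (g : Matrix.ProjGenLinGroup (Fin 2) ℂ)
  obtain ⟨e, he, hdet⟩ := hA A hAg
  obtain ⟨B, e', he', hB, hAB⟩ := exists_diagonalization p.rep_nonzero he hdet
    (hζ.ne_one (by omega))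
  have hζ0 : ζ ≠ 0 := hζ.ne_zero (by omega)
  set f' := subst B f with hf'
  have hf'h : f'.IsHomogeneous N := subst_homogeneous _ hf
  have hf'0 : f' ≠ 0 := by
    intro h0
    refine hf0 (MvPolynomial.funext fun x => ?_)
    rw [← mulVec_inv_mulVec B x, ← eval_subst, ← hf', h0]
    simp
  obtain ⟨c, hc⟩ := exists_coefficients hf'h
  have hinj : Function.Injective fun s : PLine => Matrix.ProjGenLinGroup.mk B⁻¹ • s :=
    MulAction.injective _
  -- `f'` has degree `N` and vanishes at the `N` points of the transformed orbit, so all its zeros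
  -- are simple.
  have hlt : ∀ w, ¬ lin w ^ 2 ∣ f' := by
    intro w hw
    have := card_zeros_lt_of_sq_dvd hf'h hf'0 (S.image fun s => Matrix.ProjGenLinGroup.mk B⁻¹ • s)
      (by
        intro s hs
        obtain ⟨s, hs', rfl⟩ := Finset.mem_image.1 hs
        rw [← s.mk_rep, smul_mk_pline, eval_rep_mk_eq_zero hf'h, hf', eval_subst,
          mulVec_inv_mulVec]
        exact hfS s hs') hw
    rw [Finset.card_image_of_injective _ hinj, hcard] at this
    exact lt_irrefl _ this
  have hdvd := lin_sq_dvd_of_coefficients hc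
  have hc0 : c 0 = 0 := by
    have h0 : MvPolynomial.eval ![1, 0] f' = 0 := by
      rw [hf', eval_subst, hB]
      exact hfS p ((hS p).2 (MulAction.mem_orbit_self p))
    rw [hc, Finset.sum_range_succ', Finset.sum_eq_zero] at h0
    · simpa using h0
    · intro j _
      simp
  have hc1 : c 1 ≠ 0 := fun h => hlt _ (hdvd.1 hc0 h)
  obtain ⟨χ, hχ, hχf⟩ := hK A (hAg ▸ g.2)
  have hscale : ∀ j ≤ N, (ζ * e') ^ (N - j) * e' ^ j * c j = χ * c j := by
    intro j hj
    refine sum_pow_mul_injective (n := N) (α := fun j => (ζ * e') ^ (N - j) * e' ^ j * c j)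
      (β := fun j => χ * c j) (fun t _ => ?_) hj
    have h1 := hχf ((B : Matrix (Fin 2) (Fin 2) ℂ).mulVec ![t, 1])
    rw [hAB, ← eval_subst, ← eval_subst, ← hf', hc, hc, Finset.mul_sum] at h1
    simp only [Matrix.cons_val, mul_pow] at h1
    calc _ = _ := Finset.sum_congr rfl fun j _ => by ring
      _ = _ := h1
      _ = _ := Finset.sum_congr rfl fun j _ => by ring
  have hzero : ∀ j ≤ N, (¬ (n : ℤ) ∣ (j : ℤ) - 1) → c j = 0 := by
    intro j hj hnj
    by_contra hcj
    have h1 := mul_right_cancel₀ hcj (hscale j hj)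
    have h2 := mul_right_cancel₀ hc1 (hscale 1 (by omega))
    have e1 : ∀ j ≤ N, (ζ * e') ^ (N - j) * e' ^ j = e' ^ N * ζ ^ (N - j) := fun j hj => by
      rw [mul_pow, mul_assoc, ← pow_add, Nat.sub_add_cancel hj, mul_comm]
    rw [e1 j hj, ← h2, e1 1 (by omega)] at h1
    have h3 := mul_left_cancel₀ (pow_ne_zero N he') h1
    refine hnj ((hζ.zpow_eq_one_iff_dvd _).1 ?_)
    have h4 : ζ ^ ((j : ℤ) - 1) * ζ ^ (N - j) = ζ ^ (N - 1) := by
      rw [← zpow_natCast, ← zpow_natCast, ← zpow_add₀ hζ0]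
      congr 1
      push_cast [Nat.cast_sub hj, Nat.cast_sub (by omega : 1 ≤ N)]
      ring
    rw [h3] at h4
    exact (mul_eq_right₀ (pow_ne_zero _ hζ0)).1 h4
  -- `n` divides `N - 2`, so it cannot divide `N - 1`. Hence `[0 : 1]` is also a zero, and its
  -- simplicity gives `c (N - 1) ≠ 0`.
  have hcN : c N = 0 := by
    refine hzero N le_rfl fun h => ?_
    have h2 : (n : ℤ) ∣ (N : ℤ) - 2 := by
      have := Int.natCast_dvd_natCast.2 hnN
      rwa [Nat.cast_sub hN2] at this
    have h3 := dvd_sub h h2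
    rw [show (N : ℤ) - 1 - (N - 2) = 1 by ring] at h3
    have := Int.le_of_dvd one_pos h3
    omega
  refine ⟨B, c, fun x => by rw [← eval_subst, ← hf', hc], hc1, fun h => hlt _ (hdvd.2 hcN h), hzero⟩

/-! ### The fourth transvectant -/

/-- The fourth transvectant of a binary form with itself. -/
def transvectant (f : BinaryPoly) : BinaryPoly :=
  2 * (MvPolynomial.pderiv 0 (MvPolynomial.pderiv 0 (MvPolynomial.pderiv 0 (MvPolynomial.pderiv 0 f)))) *
      (MvPolynomial.pderiv 1 (MvPolynomial.pderiv 1 (MvPolynomial.pderiv 1 (MvPolynomial.pderiv 1 f)))) -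
    8 * (MvPolynomial.pderiv 1 (MvPolynomial.pderiv 0 (MvPolynomial.pderiv 0 (MvPolynomial.pderiv 0 f)))) *
      (MvPolynomial.pderiv 1 (MvPolynomial.pderiv 1 (MvPolynomial.pderiv 1 (MvPolynomial.pderiv 0 f)))) +
    6 * (MvPolynomial.pderiv 1 (MvPolynomial.pderiv 1 (MvPolynomial.pderiv 0 (MvPolynomial.pderiv 0 f)))) ^ 2

theorem pderiv_zero_one (f : BinaryPoly) :
    MvPolynomial.pderiv 0 (MvPolynomial.pderiv 1 f) =
      MvPolynomial.pderiv 1 (MvPolynomial.pderiv 0 f) := by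
  induction f using MvPolynomial.induction_on with
  | C a => simp
  | add p q hp hq => simp only [map_add, hp, hq]
  | mul_X p k hp =>
    have h0 : MvPolynomial.pderiv (0 : Fin 2) (MvPolynomial.X 1 : BinaryPoly) = 0 :=
      MvPolynomial.pderiv_X_of_ne (by decide)
    have h1 : MvPolynomial.pderiv (1 : Fin 2) (MvPolynomial.X 0 : BinaryPoly) = 0 :=
      MvPolynomial.pderiv_X_of_ne (by decide)
    fin_cases k <;> simp [hp, h0, h1] <;> ring

/-- The transvectant is the fourth power of Cayley's operator `∂x₁ ∂y₂ - ∂y₁ ∂x₂` applied to `f(x₁,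
y₁) f(x₂, y₂)` and restricted to the diagonal; each operator contributes a factor `det A`. -/
theorem transvectant_subst (A : Matrix (Fin 2) (Fin 2) ℂ) (f : BinaryPoly) :
    transvectant (subst A f) =
      MvPolynomial.C (A 0 0 * A 1 1 - A 0 1 * A 1 0) ^ 4 * subst A (transvectant f) := by
  simp only [transvectant, pderiv_subst, map_add, map_sub, map_mul, map_pow, map_ofNat,
    MvPolynomial.pderiv_C_mul, pderiv_zero_one]
  ring

theorem transvectant_C_mul (c : ℂ) (f : BinaryPoly) :
    transvectant (MvPolynomial.C c * f) = MvPolynomial.C (c ^ 2) * transvectant f := by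
  simp only [transvectant, MvPolynomial.pderiv_C_mul, map_pow]
  ring

theorem transvectant_homogeneous {f : BinaryPoly} {m : ℕ} (hf : f.IsHomogeneous m) :
    (transvectant f).IsHomogeneous (2 * (m - 4)) := by
  have h : ∀ i j k l, (MvPolynomial.pderiv i (MvPolynomial.pderiv j (MvPolynomial.pderiv k
      (MvPolynomial.pderiv l f)))).IsHomogeneous (m - 4) := fun i j k l => by
    have := hf.pderiv (i := l) |>.pderiv (i := k) |>.pderiv (i := j) |>.pderiv (i := i)
    rwa [show m - 1 - 1 - 1 - 1 = m - 4 by omega] at this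
  have h2 : ∀ (a : ℂ) {p q : BinaryPoly}, p.IsHomogeneous (m - 4) → q.IsHomogeneous (m - 4) →
      (MvPolynomial.C a * p * q).IsHomogeneous (2 * (m - 4)) := fun a p q hp hq => by
    have := (hp.C_mul a).mul hq
    rwa [← two_mul] at this
  have h3 := ((h2 2 (h 0 0 0 0) (h 1 1 1 1)).sub (h2 8 (h 1 0 0 0) (h 1 1 1 0))).add
    (h2 6 (h 1 1 0 0) (h 1 1 0 0))
  simp only [map_ofNat] at h3
  rw [transvectant, pow_two, ← mul_assoc 6]
  exact h3

theorem IsSemiInvariant.transvectant {K : Subgroup (Matrix.ProjGenLinGroup (Fin 2) ℂ)}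
    {f : BinaryPoly} (h : IsSemiInvariant K f) : IsSemiInvariant K (transvectant f) := by
  intro A hA
  obtain ⟨χ, hχ, h⟩ := h A hA
  have e : subst A f = MvPolynomial.C χ * f := MvPolynomial.funext fun x => by
    rw [eval_subst, h, map_mul, MvPolynomial.eval_C]
  have hdet := det_ne_zero_fin_two A
  refine ⟨χ ^ 2 / (A 0 0 * A 1 1 - A 0 1 * A 1 0) ^ 4,
    div_ne_zero (pow_ne_zero _ hχ) (pow_ne_zero _ hdet), fun x => ?_⟩
  have e1 := transvectant_subst A f
  rw [e, transvectant_C_mul] at e1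
  have e2 := congrArg (MvPolynomial.eval x) e1
  simp only [map_mul, map_pow, eval_subst, MvPolynomial.eval_C] at e2
  rw [div_mul_eq_mul_div, eq_div_iff (pow_ne_zero _ hdet), e2]
  ring

/-- A binary monomial. -/
def monomialForm (a : ℂ) (i j : ℕ) : BinaryPoly :=
  MvPolynomial.C a * (MvPolynomial.X 0 ^ i * MvPolynomial.X 1 ^ j)

theorem pderiv_zero_monomialForm (a : ℂ) (i j : ℕ) :
    MvPolynomial.pderiv 0 (monomialForm a i j) = monomialForm (a * i) (i - 1) j := by
  have h0 : MvPolynomial.pderiv (0 : Fin 2) (MvPolynomial.X 1 : BinaryPoly) = 0 :=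
    MvPolynomial.pderiv_X_of_ne (by decide)
  simp only [monomialForm, MvPolynomial.pderiv_C, MvPolynomial.pderiv_mul,
    MvPolynomial.pderiv_pow, h0, MvPolynomial.pderiv_X_self, map_mul, map_natCast]
  ring

theorem pderiv_one_monomialForm (a : ℂ) (i j : ℕ) :
    MvPolynomial.pderiv 1 (monomialForm a i j) = monomialForm (a * j) i (j - 1) := by
  have h1 : MvPolynomial.pderiv (1 : Fin 2) (MvPolynomial.X 0 : BinaryPoly) = 0 :=
    MvPolynomial.pderiv_X_of_ne (by decide)
  simp only [monomialForm, MvPolynomial.pderiv_C, MvPolynomial.pderiv_mul,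
    MvPolynomial.pderiv_pow, h1, MvPolynomial.pderiv_X_self, map_mul, map_natCast]
  ring

theorem eval_one_monomialForm (a : ℂ) (i j : ℕ) :
    MvPolynomial.eval ![1, 1] (monomialForm a i j) = a := by
  simp [monomialForm]

/-- One value suffices, being a nonzero multiple of the wanted relation between the coefficients. At
`(1, 1)` each monomial equals its coefficient, so the computation is numerical. -/
theorem eval_transvectant_dodecic (a b c : ℂ) :
    MvPolynomial.eval ![1, 1] (transvectant
      (monomialForm a 11 1 + monomialForm b 6 6 + monomialForm c 1 11)) =
    972000 * (b ^ 2 + 121 * (a * c)) := by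
  simp only [transvectant, map_add, map_sub, map_mul, map_pow, map_ofNat, pderiv_zero_monomialForm,
    pderiv_one_monomialForm, eval_one_monomialForm]
  norm_num
  ring

end PlaneFoliation

end

/-! ### From a large group to the Bernoulli foliations -/

noncomputable section

namespace PlaneFoliation

theorem Foliation.Equivalent.of_transport {d d' : ℕ} {F : Foliation d} {F' : Foliation d'}
    (T : GL (Fin 3) ℂ) (h : (F.transport T).Equivalent F') : F.Equivalent F' := by
  obtain ⟨S, hS⟩ := h
  refine ⟨S * T⁻¹, fun z hz => ?_⟩
  have h1 := hS (((T⁻¹ : GL (Fin 3) ℂ) : Matrix (Fin 3) (Fin 3) ℂ).mulVec z) (mulVec_ne_zero _ hz)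
  rw [← mul_mulVec] at h1
  rw [← h1]
  conv_lhs => rw [← mulVec_inv_mulVec T z, ← F.map_plane_transport, ← map_mulVecLin_mul]
  rw [inv_mul_cancel_right]

theorem wedge_bernoulliField {n : ℕ} {p : MvPolynomial (Fin 3) ℂ} {q : BinaryPoly}
    (hp : p = MvPolynomial.rename Fin.castSucc q) (hq : q.IsHomogeneous (n + 2))
    (x : Fin 2 → ℂ) (t : ℂ) :
    wedge ![x 0, x 1, t] (evalField (bernoulliField n p) ![x 0, x 1, t]) =
      ![-(t * (x 0 * t ^ n + MvPolynomial.eval x (MvPolynomial.pderiv 1 q))),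
        t * (MvPolynomial.eval x (MvPolynomial.pderiv 0 q) - x 1 * t ^ n),
        (n + 2) * MvPolynomial.eval x q] := by
  have hr : ∀ f : BinaryPoly, MvPolynomial.eval ![x 0, x 1, t] (MvPolynomial.rename Fin.castSucc f) =
      MvPolynomial.eval x f := by
    intro f
    rw [MvPolynomial.eval_rename]
    congr 2
    ext i
    fin_cases i <;> rfl
  have h0 : MvPolynomial.pderiv 0 p = MvPolynomial.rename Fin.castSucc (MvPolynomial.pderiv 0 q) := by
    rw [hp]
    exact MvPolynomial.pderiv_rename (Fin.castSucc_injective 2) 0 q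
  have h1 : MvPolynomial.pderiv 1 p = MvPolynomial.rename Fin.castSucc (MvPolynomial.pderiv 1 q) := by
    rw [hp]
    exact MvPolynomial.pderiv_rename (Fin.castSucc_injective 2) 1 q
  -- Euler's identity in degree `n + 2` yields the third coordinate.
  have he := congrArg (MvPolynomial.eval x) hq.sum_X_mul_pderiv
  rw [Fin.sum_univ_two] at he
  simp at he
  ext i
  fin_cases i
  · simp [wedge, evalField, bernoulliField, h1, hr]
    ring
  · simp [wedge, evalField, bernoulliField, h0, hr]
  · simp [wedge, evalField, bernoulliField, h0, h1, hr]
    linear_combination he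

/-- The linear changes of coordinates that carry a foliation in normal form to a Bernoulli
foliation. -/
theorem Parts.equivalent_bernoulli {n : ℕ} {F : Foliation (n + 1)} (P : Parts F) (hn : 1 ≤ n)
    {c : ℂ} (hc : c ≠ 0) (ha1 : P.a 1 = MvPolynomial.C c * MvPolynomial.X 0)
    (hb1 : P.b 1 = MvPolynomial.C c * MvPolynomial.X 1)
    (hj : ∀ j, j ≠ 1 → j ≠ n + 1 → P.a j = 0 ∧ P.b j = 0)
    (hdiv : divergence (P.a (n + 1)) (P.b (n + 1)) = 0) {q : BinaryPoly}
    (hq : q.IsHomogeneous (n + 2)) {E : Foliation (n + 1)}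
    (hE : E.v = bernoulliField n (MvPolynomial.rename Fin.castSucc q)) (B : GL (Fin 2) ℂ)
    (hB : ∀ x, MvPolynomial.eval ((B : Matrix (Fin 2) (Fin 2) ℂ).mulVec x)
      (radialDet (P.a (n + 1)) (P.b (n + 1))) =
        -c * (B 0 0 * B 1 1 - B 0 1 * B 1 0) * (n + 2) * MvPolynomial.eval x q) :
    F.Equivalent E := by
  -- `B` carries the Bernoulli foliation to `F`; its inverse is the required equivalence.
  suffices h : ∀ z : Fin 3 → ℂ, z ≠ 0 → (E.plane z).map
      (affineEmbedding B : Matrix (Fin 3) (Fin 3) ℂ).mulVecLin =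
      F.plane ((affineEmbedding B : Matrix (Fin 3) (Fin 3) ℂ).mulVec z) by
    refine ⟨(affineEmbedding B)⁻¹, fun z hz => ?_⟩
    have h1 := h (((affineEmbedding B)⁻¹ : GL (Fin 3) ℂ).1.mulVec z) (mulVec_ne_zero _ hz)
    rw [mulVec_inv_mulVec] at h1
    rw [← h1, ← map_mulVecLin_mul, inv_mul_cancel]
    simp
  intro z hz
  rw [map_plane, Foliation.plane, span_pair_eq_iff (mulVec_ne_zero _ hz)]
  -- The radial part has coefficient `-1` in the Bernoulli field and `c` in `F`, which dictates the
  -- factor.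
  refine ⟨-c⁻¹, neg_ne_zero.2 (inv_ne_zero hc), ?_⟩
  rw [wedge_affine]
  rw [eq_vec_three z]
  generalize (![z 0, z 1] : Fin 2 → ℂ) = x
  generalize z 2 = t
  rw [affineEmbedding_mulVec, P.wedge_eq, hE, wedge_bernoulliField rfl hq]
  set y := (B : Matrix (Fin 2) (Fin 2) ℂ).mulVec x with hy
  set Q := radialDet (P.a (n + 1)) (P.b (n + 1)) with hQ
  have hdet := det_ne_zero_fin_two B
  have hQB : subst B Q = MvPolynomial.C (-c * (B 0 0 * B 1 1 - B 0 1 * B 1 0) * (n + 2)) * q :=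
    MvPolynomial.funext fun x => by rw [eval_subst, hB, map_mul, MvPolynomial.eval_C]
  have hpd : ∀ j, B 0 j * MvPolynomial.eval y (MvPolynomial.pderiv 0 Q) +
      B 1 j * MvPolynomial.eval y (MvPolynomial.pderiv 1 Q) =
      -c * (B 0 0 * B 1 1 - B 0 1 * B 1 0) * (n + 2) * MvPolynomial.eval x (MvPolynomial.pderiv j q) := by
    intro j
    have := congrArg (MvPolynomial.eval x) (pderiv_subst B Q j)
    rw [hQB, MvPolynomial.pderiv_C_mul] at this
    simp only [map_add, map_mul, MvPolynomial.eval_C, eval_subst] at this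
    rw [← hy] at this
    linear_combination -this
  have hdec := field_decomposition (P.homogeneous_a (n + 1)) (P.homogeneous_b (n + 1))
  rw [hdiv, ← hQ] at hdec
  have hn2 : (n : ℂ) + 2 ≠ 0 := by exact_mod_cast (by omega : n + 2 ≠ 0)
  -- With zero divergence the part of degree `n + 1` is the Hamiltonian field of `Q`, up to the
  -- factor `n + 2`, so the chain rule for `Q ∘ B` determines it.
  have ha : MvPolynomial.eval y (P.a (n + 1)) = c * (B 0 0 * MvPolynomial.eval x (MvPolynomial.pderiv 1 q) -
      B 0 1 * MvPolynomial.eval x (MvPolynomial.pderiv 0 q)) := by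
    have h1 := congrArg (MvPolynomial.eval y) hdec.1
    simp at h1
    refine mul_left_cancel₀ hn2 (mul_left_cancel₀ hdet ?_)
    linear_combination (B 0 0 * B 1 1 - B 0 1 * B 1 0) * h1 - B 0 0 * hpd 1 + B 0 1 * hpd 0
  have hb : MvPolynomial.eval y (P.b (n + 1)) = c * (B 1 0 * MvPolynomial.eval x (MvPolynomial.pderiv 1 q) -
      B 1 1 * MvPolynomial.eval x (MvPolynomial.pderiv 0 q)) := by
    have h1 := congrArg (MvPolynomial.eval y) hdec.2
    simp at h1
    refine mul_left_cancel₀ hn2 (mul_left_cancel₀ hdet ?_)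
    linear_combination (B 0 0 * B 1 1 - B 0 1 * B 1 0) * h1 - B 1 0 * hpd 1 + B 1 1 * hpd 0
  have hsum : ∀ (m : ℕ) (g : ℕ → ℂ), n + 1 < m → (∀ j, j ≠ 1 → j ≠ n + 1 → g j = 0) →
      ∑ j ∈ Finset.range m, g j = g 1 + g (n + 1) := by
    intro m g hm hg
    exact Finset.sum_eq_add_of_mem 1 (n + 1) (by simp; omega) (by simp; omega) (by omega)
      fun j _ hj => hg j hj.1 hj.2
  have hQ1 : y 0 * MvPolynomial.eval y (P.b 1) - y 1 * MvPolynomial.eval y (P.a 1) = 0 := by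
    rw [ha1, hb1]
    simp
    ring
  have hQd : y 0 * MvPolynomial.eval y (P.b (n + 1)) - y 1 * MvPolynomial.eval y (P.a (n + 1)) =
      -c * (B 0 0 * B 1 1 - B 0 1 * B 1 0) * (n + 2) * MvPolynomial.eval x q := by
    rw [← hB x, ← hy, hQ]
    simp only [radialDet, map_sub, map_mul, MvPolynomial.eval_X]
  have hy0 : y 0 = B 0 0 * x 0 + B 0 1 * x 1 := by
    simp [hy]
  have hy1 : y 1 = B 1 0 * x 0 + B 1 1 * x 1 := by
    simp [hy]
  rw [hsum _ _ (by omega) (fun j h1 h2 => by simp [(hj j h1 h2).1]),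
    hsum _ _ (by omega) (fun j h1 h2 => by simp [(hj j h1 h2).2]),
    hsum _ _ (by omega) (fun j h1 h2 => by simp [(hj j h1 h2).1, (hj j h1 h2).2]), hQ1, hQd, ha, hb,
    ha1, hb1]
  ext i
  fin_cases i
  · simp [hy0]
    field_simp
    ring
  · simp [hy1]
    field_simp
    ring
  · simp
    field_simp

/-- `x⁵y - xy⁵` in two variables. -/
def sextic : BinaryPoly := monomialForm 1 5 1 + monomialForm (-1) 1 5

/-- `x¹¹y + 11x⁶y⁶ - xy¹¹` in two variables. -/
def dodecic : BinaryPoly := monomialForm 1 11 1 + monomialForm 11 6 6 + monomialForm (-1) 1 11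

theorem monomialForm_homogeneous (a : ℂ) (i j : ℕ) : (monomialForm a i j).IsHomogeneous (i + j) :=
  ((MvPolynomial.isHomogeneous_X_pow _ _).mul (MvPolynomial.isHomogeneous_X_pow _ _)).C_mul _

theorem sextic_homogeneous : sextic.IsHomogeneous (4 + 2) :=
  (monomialForm_homogeneous 1 5 1).add (monomialForm_homogeneous (-1) 1 5)

theorem dodecic_homogeneous : dodecic.IsHomogeneous (10 + 2) :=
  ((monomialForm_homogeneous 1 11 1).add (monomialForm_homogeneous 11 6 6)).add
    (monomialForm_homogeneous (-1) 1 11)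

theorem eval_monomialForm (a : ℂ) (i j : ℕ) (x : Fin 2 → ℂ) :
    MvPolynomial.eval x (monomialForm a i j) = a * (x 0 ^ i * x 1 ^ j) := by
  simp [monomialForm]

theorem rename_sextic : MvPolynomial.rename Fin.castSucc sextic = octahedralForm := by
  simp [sextic, monomialForm, octahedralForm, sub_eq_add_neg]

theorem rename_dodecic : MvPolynomial.rename Fin.castSucc dodecic = icosahedralForm := by
  simp [dodecic, monomialForm, icosahedralForm, sub_eq_add_neg]

theorem tetrahedral_semiInvariant {K : Subgroup (Matrix.ProjGenLinGroup (Fin 2) ℂ)}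
    (e : K ≃* alternatingGroup (Fin 4)) {m : ℕ} {f : BinaryPoly} (hm : m ≤ 3)
    (hf : f.IsHomogeneous m) (h : IsSemiInvariant K f) (hf0 : f ≠ 0) : m = 0 := by
  by_contra hm0
  have hN := (card_orbit_of_tetrahedral e).2
  obtain ⟨p, S, -, -, hp, -⟩ := h.eq_orbit hf hf0 (by omega) hN (by omega)
  have := hN p
  omega

/-- Degrees below `2 * 6` allow a single orbit, and an orbit of fewer than 8 points has 6. -/
theorem octahedral_semiInvariant {K : Subgroup (Matrix.ProjGenLinGroup (Fin 2) ℂ)}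
    (e : K ≃* Equiv.Perm (Fin 4)) {m : ℕ} {f : BinaryPoly} (hm : m ≤ 7)
    (hf : f.IsHomogeneous m) (h : IsSemiInvariant K f) (hf0 : f ≠ 0) : m = 0 ∨ m = 6 := by
  by_contra! hm0
  have hN := (card_orbit_of_octahedral e).2
  obtain ⟨p, S, -, -, hp, -⟩ := h.eq_orbit hf hf0 (by omega) (fun p => (hN p).1) (by omega)
  have := (hN p).2
  omega

theorem icosahedral_semiInvariant {K : Subgroup (Matrix.ProjGenLinGroup (Fin 2) ℂ)}
    (e : K ≃* alternatingGroup (Fin 5)) {m : ℕ} {f : BinaryPoly} (hm : m ≤ 19)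
    (hf : f.IsHomogeneous m) (h : IsSemiInvariant K f) (hf0 : f ≠ 0) : m = 0 ∨ m = 12 := by
  by_contra! hm0
  have hN := (card_orbit_of_icosahedral e).2
  obtain ⟨p, S, -, -, hp, -⟩ := h.eq_orbit hf hf0 (by omega) (fun p => (hN p).1) (by omega)
  have := (hN p).2
  omega

/-- `B * diag(α, β)` -/
def scaleColumns (B : GL (Fin 2) ℂ) {α β : ℂ} (hα : α ≠ 0) (hβ : β ≠ 0) : GL (Fin 2) ℂ :=
  Matrix.GeneralLinearGroup.mkOfDetNeZero
    !![B 0 0 * α, B 0 1 * β; B 1 0 * α, B 1 1 * β] (by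
      rw [Matrix.det_fin_two]
      have := mul_ne_zero (det_ne_zero_fin_two B) (mul_ne_zero hα hβ)
      intro h
      apply this
      simp at h
      linear_combination h)

theorem scaleColumns_apply (B : GL (Fin 2) ℂ) {α β : ℂ} (hα : α ≠ 0) (hβ : β ≠ 0) :
    (scaleColumns B hα hβ : Matrix (Fin 2) (Fin 2) ℂ) =
      !![B 0 0 * α, B 0 1 * β; B 1 0 * α, B 1 1 * β] := rfl

theorem scaleColumns_mulVec (B : GL (Fin 2) ℂ) {α β : ℂ} (hα : α ≠ 0) (hβ : β ≠ 0)
    (x : Fin 2 → ℂ) : (scaleColumns B hα hβ : Matrix (Fin 2) (Fin 2) ℂ).mulVec x =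
      (B : Matrix (Fin 2) (Fin 2) ℂ).mulVec ![α * x 0, β * x 1] := by
  rw [scaleColumns_apply]
  ext i
  fin_cases i <;> simp [Matrix.mulVec, dotProduct, Fin.sum_univ_two] <;> ring

/-- A semi-invariant sextic of the octahedral group is equivalent to `x⁵y - xy⁵`. -/
theorem exists_octahedral_coordinates {K : Subgroup (Matrix.ProjGenLinGroup (Fin 2) ℂ)}
    (e : K ≃* Equiv.Perm (Fin 4)) {f : BinaryPoly} (hf : f.IsHomogeneous 6)
    (h : IsSemiInvariant K f) (hf0 : f ≠ 0) {s : ℂ} (hs : s ≠ 0) :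
    ∃ B : GL (Fin 2) ℂ, ∀ x, MvPolynomial.eval ((B : Matrix (Fin 2) (Fin 2) ℂ).mulVec x) f =
      s * (B 0 0 * B 1 1 - B 0 1 * B 1 0) * MvPolynomial.eval x sextic := by
  have : Finite K := Finite.of_equiv _ e.symm.toEquiv
  obtain ⟨hK, hN⟩ := card_orbit_of_octahedral e
  obtain ⟨p, S, hS, hcard, hp, hfS⟩ := h.eq_orbit hf hf0 (by omega) (fun p => (hN p).1) (by omega)
  have hst := card_orbit_mul_card_stabilizer (K := K) p
  rw [hp, hK] at hst
  -- The stabilizer has order `24 / 6 = 4`, so the surviving exponents are `j = 1, 5`.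
  obtain ⟨B, c, hB, hc1, hc5, hc⟩ := exists_coefficients_of_stabilizer hf hf0 h p S hS hcard hfS
    (n := 4) (by omega) (by omega) (by omega) (by norm_num)
  simp only [Finset.sum_range_succ, Finset.sum_range_zero, hc 0 (by omega) (by omega),
    hc 2 (by omega) (by omega), hc 3 (by omega) (by omega), hc 4 (by omega) (by omega),
    hc 6 (by omega) (by omega)] at hB
  have hdet := det_ne_zero_fin_two B
  set δ := B 0 0 * B 1 1 - B 0 1 * B 1 0
  -- Scaling the columns by `α, β` multiplies the coefficients by `α⁵β` and `αβ⁵`, and the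
  -- determinant by `αβ`; fourth powers remain to be matched.
  obtain ⟨α, hα⟩ := IsAlgClosed.exists_pow_nat_eq (s * δ / c 1) (n := 4) (by norm_num)
  obtain ⟨β, hβ⟩ := IsAlgClosed.exists_pow_nat_eq (-(s * δ) / c 5) (n := 4) (by norm_num)
  have hα0 : α ≠ 0 := by
    rintro rfl
    exact div_ne_zero (mul_ne_zero hs hdet) hc1 (by rw [← hα]; norm_num)
  have hβ0 : β ≠ 0 := by
    rintro rfl
    exact div_ne_zero (neg_ne_zero.2 (mul_ne_zero hs hdet)) hc5 (by rw [← hβ]; norm_num)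
  rw [eq_div_iff hc1] at hα
  rw [eq_div_iff hc5] at hβ
  refine ⟨scaleColumns B hα0 hβ0, fun x => ?_⟩
  rw [scaleColumns_mulVec, hB, sextic, map_add, eval_monomialForm, eval_monomialForm,
    scaleColumns_apply]
  simp only [Matrix.cons_val, Matrix.of_apply, Matrix.cons_val']
  linear_combination α * β * x 0 ^ 5 * x 1 * hα + α * β * x 0 * x 1 ^ 5 * hβ

/-- A semi-invariant form of degree 12 of the icosahedral group is equivalent to
`x¹¹y + 11x⁶y⁶ - xy¹¹`. -/
theorem exists_icosahedral_coordinates {K : Subgroup (Matrix.ProjGenLinGroup (Fin 2) ℂ)}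
    (e : K ≃* alternatingGroup (Fin 5)) {f : BinaryPoly} (hf : f.IsHomogeneous 12)
    (h : IsSemiInvariant K f) (hf0 : f ≠ 0) {s : ℂ} (hs : s ≠ 0) :
    ∃ B : GL (Fin 2) ℂ, ∀ x, MvPolynomial.eval ((B : Matrix (Fin 2) (Fin 2) ℂ).mulVec x) f =
      s * (B 0 0 * B 1 1 - B 0 1 * B 1 0) * MvPolynomial.eval x dodecic := by
  have : Finite K := Finite.of_equiv _ e.symm.toEquiv
  obtain ⟨hK, hN⟩ := card_orbit_of_icosahedral e
  obtain ⟨p, S, hS, hcard, hp, hfS⟩ := h.eq_orbit hf hf0 (by omega) (fun p => (hN p).1) (by omega)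
  have hst := card_orbit_mul_card_stabilizer (K := K) p
  rw [hp, hK] at hst
  -- The stabilizer has order `60 / 12 = 5`, so the surviving exponents are `j = 1, 6, 11`.
  obtain ⟨B, c, hB, hc1, hc11, hc⟩ := exists_coefficients_of_stabilizer hf hf0 h p S hS hcard hfS
    (n := 5) (by omega) (by omega) (by omega) (by norm_num)
  simp only [Finset.sum_range_succ, Finset.sum_range_zero, hc 0 (by omega) (by omega),
    hc 2 (by omega) (by omega), hc 3 (by omega) (by omega), hc 4 (by omega) (by omega),
    hc 5 (by omega) (by omega), hc 7 (by omega) (by omega), hc 8 (by omega) (by omega),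
    hc 9 (by omega) (by omega), hc 10 (by omega) (by omega), hc 12 (by omega) (by omega)] at hB
  -- A semi-invariant of degree `2 * (12 - 4) = 16`, which is neither 0 nor 12.
  have hT : transvectant f = 0 := by
    by_contra hT
    have := icosahedral_semiInvariant e (by omega) (transvectant_homogeneous hf) h.transvectant hT
    omega
  have hsub : subst B f = monomialForm (c 1) 11 1 + monomialForm (c 6) 6 6 +
      monomialForm (c 11) 1 11 := MvPolynomial.funext fun x => by
    rw [eval_subst, hB]
    simp only [map_add, eval_monomialForm]
    ring
  have hc6 : c 6 ^ 2 + 121 * (c 1 * c 11) = 0 := by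
    have h1 := transvectant_subst B f
    rw [hT, map_zero, mul_zero, hsub] at h1
    have h2 := eval_transvectant_dodecic (c 1) (c 6) (c 11)
    rw [h1, map_zero] at h2
    linear_combination -h2 / 972000
  have hdet := det_ne_zero_fin_two B
  set δ := B 0 0 * B 1 1 - B 0 1 * B 1 0 with hδ
  obtain ⟨α, hα⟩ := IsAlgClosed.exists_pow_nat_eq (s * δ / c 1) (n := 10) (by norm_num)
  obtain ⟨β, hβ⟩ := IsAlgClosed.exists_pow_nat_eq (-(s * δ) / c 11) (n := 10) (by norm_num)
  have hα0 : α ≠ 0 := by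
    rintro rfl
    exact div_ne_zero (mul_ne_zero hs hdet) hc1 (by rw [← hα]; norm_num)
  have hβ0 : β ≠ 0 := by
    rintro rfl
    exact div_ne_zero (neg_ne_zero.2 (mul_ne_zero hs hdet)) hc11 (by rw [← hβ]; norm_num)
  rw [eq_div_iff hc1] at hα
  rw [eq_div_iff hc11] at hβ
  -- The transvectant relation fixes the square of the middle coefficient. Replacing `α` by `-α`
  -- changes the sign of `α⁵` and keeps `α¹⁰`, which settles the sign.
  obtain ⟨α', hα', hα'0, hmid⟩ : ∃ α' : ℂ, α' ^ 10 * c 1 = s * δ ∧ α' ≠ 0 ∧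
      c 6 * (α' ^ 5 * β ^ 5) = 11 * (s * δ) := by
    have hsq : (c 6 * (α ^ 5 * β ^ 5)) ^ 2 = (11 * (s * δ)) ^ 2 := by
      refine mul_left_cancel₀ (mul_ne_zero hc1 hc11) ?_
      linear_combination α ^ 10 * c 1 * (β ^ 10 * c 11) * hc6 -
        121 * c 1 * c 11 * β ^ 10 * c 11 * hα - 121 * c 1 * c 11 * (s * δ) * hβ
    rcases sq_eq_sq_iff_eq_or_eq_neg.1 hsq with h1 | h1
    · exact ⟨α, hα, hα0, h1⟩
    · refine ⟨-α, ?_, neg_ne_zero.2 hα0, ?_⟩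
      · linear_combination hα
      · linear_combination -h1
  refine ⟨scaleColumns B hα'0 hβ0, fun x => ?_⟩
  rw [scaleColumns_mulVec, hB, dodecic, map_add, map_add, eval_monomialForm, eval_monomialForm,
    eval_monomialForm, scaleColumns_apply]
  simp only [Matrix.cons_val, Matrix.of_apply, Matrix.cons_val']
  linear_combination α' * β * x 0 ^ 11 * x 1 * hα' + α' * β * x 0 * x 1 ^ 11 * hβ +
    α' * β * x 0 ^ 6 * x 1 ^ 6 * hmid

theorem equivalent_of_card_le {d : ℕ} {F : Foliation d} {G : Subgroup (GL (Fin 2) ℂ)}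
    (hinv : ∀ A ∈ G, F.Invariant (affineEmbedding A))
    (hscal : ∃ u : ℂˣ, ¬ F.Invariant (affineEmbedding (Matrix.GeneralLinearGroup.scalar (Fin 2) u)))
    (hpoly : IsPolyhedral (projectivization G)) (hcard : 3 * (d ^ 2 + d + 1) ≤ Nat.card G) :
    F.Equivalent bernoulliFive ∨ F.Equivalent bernoulliEleven := by
  obtain ⟨P⟩ := F.nonempty_parts
  rcases hpoly with ⟨⟨e⟩⟩ | ⟨⟨e⟩⟩ | ⟨⟨e⟩⟩
  · exfalso
    have hK := (card_orbit_of_tetrahedral e).1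
    have hd := P.card_le_mul_degree hinv hscal fun f hf h => by
      by_contra hf0
      exact one_ne_zero (tetrahedral_semiInvariant e (by omega) hf h hf0)
    rw [hK] at hd
    -- From `3(d² + d + 1) ≤ 12 d`. Forms of degree at most 3 are then constant if semi-invariant,
    -- so `N = 4` is admissible below, and its conclusion `d = 3` is absurd.
    have hd2 : d ≤ 2 := by nlinarith
    have := (P.normal_form hinv hscal (N := 4) (by omega) (fun m f hm hf h hf0 =>
      Or.inl (tetrahedral_semiInvariant e (by omega) hf h hf0)) (by omega)).1
    omega
  · left
    have hK := (card_orbit_of_octahedral e).1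
    have hd := P.card_le_mul_degree hinv hscal fun f hf h => by
      by_contra hf0
      have := octahedral_semiInvariant e (by omega) hf h hf0
      omega
    rw [hK] at hd
    -- From `3(d² + d + 1) ≤ 24 d`; the relevant forms have degree at most 7, below the orbit size
    -- 8.
    have hd2 : d ≤ 6 := by nlinarith
    obtain ⟨hd5, hQ, hdiv, hj, c, hc, ha1, hb1⟩ := P.normal_form hinv hscal (N := 6) (by omega)
      (fun m f hm hf h hf0 => octahedral_semiInvariant e (by omega) hf h hf0)
      -- For `d = 6` the group has at least 129 elements, more than `2 * 24`.
      (by rintro rfl; omega)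
    obtain rfl : d = 4 + 1 := by omega
    obtain ⟨B, hB⟩ := exists_octahedral_coordinates e
      (homogeneous_radialDet (P.homogeneous_a _) (P.homogeneous_b _))
      (P.isSemiInvariant_radialDet hinv (4 + 1)) hQ (s := -c * 6)
      (mul_ne_zero (neg_ne_zero.2 hc) (by norm_num))
    refine P.equivalent_bernoulli (by norm_num) hc ha1 hb1 hj hdiv sextic_homogeneous
      (E := bernoulliFive) (by rw [rename_sextic]; rfl) B fun x => ?_
    rw [hB]
    push_cast
    ring
  · right
    have hK := (card_orbit_of_icosahedral e).1
    have hd := P.card_le_mul_degree hinv hscal fun f hf h => by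
      by_contra hf0
      have := icosahedral_semiInvariant e (by omega) hf h hf0
      omega
    rw [hK] at hd
    -- From `3(d² + d + 1) ≤ 60 d`; the relevant forms have degree at most 19, below the orbit size
    -- 20.
    have hd2 : d ≤ 18 := by nlinarith
    obtain ⟨hd11, hQ, hdiv, hj, c, hc, ha1, hb1⟩ := P.normal_form hinv hscal (N := 12) (by omega)
      (fun m f hm hf h hf0 => icosahedral_semiInvariant e (by omega) hf h hf0)
      -- For `d = 12` the group has at least 471 elements, more than `2 * 60`.
      (by rintro rfl; omega)
    obtain rfl : d = 10 + 1 := by omega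
    obtain ⟨B, hB⟩ := exists_icosahedral_coordinates e
      (homogeneous_radialDet (P.homogeneous_a _) (P.homogeneous_b _))
      (P.isSemiInvariant_radialDet hinv (10 + 1)) hQ (s := -c * 12)
      (mul_ne_zero (neg_ne_zero.2 hc) (by norm_num))
    refine P.equivalent_bernoulli (by norm_num) hc ha1 hb1 hj hdiv dodecic_homogeneous
      (E := bernoulliEleven) (by rw [rename_dodecic]; rfl) B fun x => ?_
    rw [hB]
    push_cast
    ring

end PlaneFoliation

end

/-! ### Explicit automorphisms of the two Bernoulli foliations -/

noncomputable section

namespace PlaneFoliation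

/-- `A` multiplies `x dy - y dx` by its determinant, so it preserves the foliation as soon as `q`,
and hence `dq`, is multiplied by the same factor. -/
theorem Foliation.invariant_of_form {n : ℕ} {q : BinaryPoly} (hq : q.IsHomogeneous (n + 2))
    {E : Foliation (n + 1)}
    (hE : E.v = bernoulliField n (MvPolynomial.rename Fin.castSucc q)) (A : GL (Fin 2) ℂ)
    (hA : ∀ x, MvPolynomial.eval ((A : Matrix (Fin 2) (Fin 2) ℂ).mulVec x) q =
      (A 0 0 * A 1 1 - A 0 1 * A 1 0) * MvPolynomial.eval x q) :
    E.Invariant (affineEmbedding A) := by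
  rw [E.invariant_affine_iff]
  refine ⟨1, one_ne_zero, fun z => ?_⟩
  rw [eq_vec_three z]
  generalize (![z 0, z 1] : Fin 2 → ℂ) = x
  generalize z 2 = t
  rw [affineEmbedding_mulVec, hE, wedge_bernoulliField rfl hq, wedge_bernoulliField rfl hq]
  set y := (A : Matrix (Fin 2) (Fin 2) ℂ).mulVec x with hy
  have hdet := det_ne_zero_fin_two A
  have hsub : subst A q = MvPolynomial.C (A 0 0 * A 1 1 - A 0 1 * A 1 0) * q :=
    MvPolynomial.funext fun x => by rw [eval_subst, hA, map_mul, MvPolynomial.eval_C]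
  have hpd : ∀ j, A 0 j * MvPolynomial.eval y (MvPolynomial.pderiv 0 q) +
      A 1 j * MvPolynomial.eval y (MvPolynomial.pderiv 1 q) =
      (A 0 0 * A 1 1 - A 0 1 * A 1 0) * MvPolynomial.eval x (MvPolynomial.pderiv j q) := by
    intro j
    have := congrArg (MvPolynomial.eval x) (pderiv_subst A q j)
    rw [hsub, MvPolynomial.pderiv_C_mul] at this
    simp only [map_add, map_mul, MvPolynomial.eval_C, eval_subst] at this
    rw [← hy] at this
    linear_combination -this
  have h0 : MvPolynomial.eval y (MvPolynomial.pderiv 0 q) =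
      A 1 1 * MvPolynomial.eval x (MvPolynomial.pderiv 0 q) -
        A 1 0 * MvPolynomial.eval x (MvPolynomial.pderiv 1 q) := by
    refine mul_left_cancel₀ hdet ?_
    linear_combination A 1 1 * hpd 0 - A 1 0 * hpd 1
  have h1 : MvPolynomial.eval y (MvPolynomial.pderiv 1 q) =
      A 0 0 * MvPolynomial.eval x (MvPolynomial.pderiv 1 q) -
        A 0 1 * MvPolynomial.eval x (MvPolynomial.pderiv 0 q) := by
    refine mul_left_cancel₀ hdet ?_
    linear_combination A 0 0 * hpd 1 - A 0 1 * hpd 0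
  have hy0 : y 0 = A 0 0 * x 0 + A 0 1 * x 1 := by
    simp [hy]
  have hy1 : y 1 = A 1 0 * x 0 + A 1 1 * x 1 := by
    simp [hy]
  rw [hA, h0, h1, hy0, hy1]
  ext i
  fin_cases i <;> simp <;> ring

theorem Foliation.Equivalent.degree_eq {d d' : ℕ} {F : Foliation d} {E : Foliation d'}
    (h : F.Equivalent E) : d = d' := by
  obtain ⟨T, hT⟩ := h
  refine (F.wedge_eq_of_plane_eq (E.transport T) fun z hz => ?_).1
  apply map_mulVecLin_injective T
  rw [hT z hz, E.map_plane_transport]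

theorem Foliation.Equivalent.invariant {d d' : ℕ} {F : Foliation d} {E : Foliation d'}
    {T : GL (Fin 3) ℂ} (hT : ∀ z : Fin 3 → ℂ, z ≠ 0 →
      (F.plane z).map (T : Matrix (Fin 3) (Fin 3) ℂ).mulVecLin =
        E.plane ((T : Matrix (Fin 3) (Fin 3) ℂ).mulVec z)) {g : GL (Fin 3) ℂ}
    (hg : E.Invariant g) : F.Invariant (T⁻¹ * g * T) := by
  intro z hz
  apply map_mulVecLin_injective T
  rw [hT _ (mulVec_ne_zero _ hz), ← map_mulVecLin_mul, ← mul_mulVec, mul_assoc T⁻¹,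
    mul_inv_cancel_left, map_mulVecLin_mul, hT z hz, hg _ (mulVec_ne_zero _ hz), ← mul_mulVec]

theorem projective_conj_injective (T : GL (Fin 3) ℂ) :
    Function.Injective fun A : GL (Fin 2) ℂ => projective (T * affineEmbedding A * T⁻¹) := by
  intro A B h
  apply projective_affineEmbedding_injective
  simp only [map_mul, mul_left_inj, mul_right_inj] at h
  exact h

/-- Linear automorphisms of `E` are conjugated into automorphisms of `F`, injectively. Finiteness
matters because `Nat.card` of an infinite type is 0. -/
theorem Foliation.Equivalent.card_le {d d' : ℕ} {F : Foliation d} {E : Foliation d'}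
    (h : F.Equivalent E) [Finite F.aut] {ι : Type*} {m : ι → GL (Fin 2) ℂ}
    (hm : Function.Injective m) (hinv : ∀ i, E.Invariant (affineEmbedding (m i))) :
    Nat.card ι ≤ Nat.card F.aut := by
  obtain ⟨T, hT⟩ := h
  refine Nat.card_le_card_of_injective (fun i => (⟨projective (T⁻¹ * affineEmbedding (m i) * T),
    (F.projective_mem_aut_iff _).2 (Equivalent.invariant hT (hinv i))⟩ : F.aut)) fun i j hij => ?_
  refine hm (projective_conj_injective T⁻¹ ?_)
  simpa using congrArg Subtype.val hij

/-- The invertible matrix with the given entries. -/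
def matrixTwo (a b c e : ℂ) (h : a * e - b * c ≠ 0) : GL (Fin 2) ℂ :=
  Matrix.GeneralLinearGroup.mkOfDetNeZero !![a, b; c, e] (by rwa [Matrix.det_fin_two_of])

theorem entries_eq {A A' : GL (Fin 2) ℂ} {a b c e a' b' c' e' : ℂ}
    (hA : (A : Matrix (Fin 2) (Fin 2) ℂ) = !![a, b; c, e])
    (hA' : (A' : Matrix (Fin 2) (Fin 2) ℂ) = !![a', b'; c', e']) (h : A = A') :
    a = a' ∧ b = b' ∧ c = c' ∧ e = e' := by
  have H : !![a, b; c, e] = !![a', b'; c', e'] := by rw [← hA, ← hA', h]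
  exact ⟨congrFun (congrFun H 0) 0, congrFun (congrFun H 0) 1, congrFun (congrFun H 1) 0,
    congrFun (congrFun H 1) 1⟩

theorem bernoulliFive_invariant {A : GL (Fin 2) ℂ} {a b c e : ℂ}
    (hA : (A : Matrix (Fin 2) (Fin 2) ℂ) = !![a, b; c, e])
    (H : ∀ x y : ℂ, (a * x + b * y) ^ 5 * (c * x + e * y) - (a * x + b * y) * (c * x + e * y) ^ 5 =
      (a * e - b * c) * (x ^ 5 * y - x * y ^ 5)) :
    bernoulliFive.Invariant (affineEmbedding A) := by
  refine bernoulliFive.invariant_of_form sextic_homogeneous (by rw [rename_sextic]; rfl) _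
    fun x => ?_
  have := H (x 0) (x 1)
  simp only [sextic, map_add, eval_monomialForm, hA]
  simp [Matrix.mulVec, dotProduct, Fin.sum_univ_two]
  linear_combination this

theorem bernoulliEleven_invariant {A : GL (Fin 2) ℂ} {a b c e : ℂ}
    (hA : (A : Matrix (Fin 2) (Fin 2) ℂ) = !![a, b; c, e])
    (H : ∀ x y : ℂ, (a * x + b * y) ^ 11 * (c * x + e * y) +
        11 * ((a * x + b * y) ^ 6 * (c * x + e * y) ^ 6) - (a * x + b * y) * (c * x + e * y) ^ 11 =
      (a * e - b * c) * (x ^ 11 * y + 11 * (x ^ 6 * y ^ 6) - x * y ^ 11)) :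
    bernoulliEleven.Invariant (affineEmbedding A) := by
  refine bernoulliEleven.invariant_of_form dodecic_homogeneous (by rw [rename_dodecic]; rfl) _
    fun x => ?_
  have := H (x 0) (x 1)
  simp only [dodecic, map_add, eval_monomialForm, hA]
  simp [Matrix.mulVec, dotProduct, Fin.sum_univ_two]
  linear_combination this

theorem rootsOfUnity_pow {n : ℕ} (u : rootsOfUnity n ℂ) : (u : ℂˣ).val ^ n = 1 := by
  have := u.2
  rw [mem_rootsOfUnity] at this
  simpa using congrArg Units.val this

theorem rootsOfUnity_ne_zero {n : ℕ} (u : rootsOfUnity n ℂ) : (u : ℂˣ).val ≠ 0 := (u : ℂˣ).ne_zero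

theorem rootsOfUnity_ext {n : ℕ} {u v : rootsOfUnity n ℂ} (h : (u : ℂˣ).val = (v : ℂˣ).val) :
    u = v := Subtype.ext (Units.ext h)

/-- The octic is the dodecic divided by `xy(x² + xy - y²)`: it carries the eight vertices of the
icosahedron that the involution does not exchange with those of `xy`. The factor is `25 t⁴`, reduced
by `t² = 1 - t`. -/
theorem icosahedral_octic {t : ℂ} (ht : t ^ 2 + t = 1) (x y : ℂ) :
    let g : ℂ → ℂ → ℂ := fun x y => x ^ 8 - x ^ 7 * y + 2 * x ^ 6 * y ^ 2 - 3 * x ^ 5 * y ^ 3 +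
      5 * x ^ 4 * y ^ 4 + 3 * x ^ 3 * y ^ 5 + 2 * x ^ 2 * y ^ 6 + x * y ^ 7 + y ^ 8
    g (-x + t * y) (t * x + y) = (50 - 75 * t) * g x y := by
  intro g
  simp only [g]
  linear_combination ((49 - 27 * t + 20 * t ^ 2 - 10 * t ^ 3 + 5 * t ^ 4 - 2 * t ^ 5 + t ^ 6) * y ^ 8 +
    (51 - 28 * t + 25 * t ^ 2 + 5 * t ^ 3 - 3 * t ^ 5 - t ^ 6) * x * y ^ 7 +
    (98 - 54 * t + 10 * t ^ 2 + 10 * t ^ 3 + 40 * t ^ 4 - 4 * t ^ 5 + 2 * t ^ 6) * x ^ 2 * y ^ 6 +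
    (153 - 64 * t + 35 * t ^ 2 - 105 * t ^ 3 + 40 * t ^ 4 + 11 * t ^ 5 - 3 * t ^ 6) * x ^ 3 * y ^ 5 +
    (245 - 100 * t + 165 * t ^ 2 - 45 * t ^ 3 - 40 * t ^ 4 + 25 * t ^ 5 + 5 * t ^ 6) * x ^ 4 * y ^ 4 +
    (-153 + 64 * t - 35 * t ^ 2 + 105 * t ^ 3 - 40 * t ^ 4 - 11 * t ^ 5 + 3 * t ^ 6) * x ^ 5 * y ^ 3 +
    (98 - 54 * t + 10 * t ^ 2 + 10 * t ^ 3 + 40 * t ^ 4 - 4 * t ^ 5 + 2 * t ^ 6) * x ^ 6 * y ^ 2 +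
    (-51 + 28 * t - 25 * t ^ 2 - 5 * t ^ 3 + 3 * t ^ 5 + t ^ 6) * x ^ 7 * y +
    (49 - 27 * t + 20 * t ^ 2 - 10 * t ^ 3 + 5 * t ^ 4 - 2 * t ^ 5 + t ^ 6) * x ^ 8) * ht

/-- An involution of the projective line that permutes the vertices of the icosahedron: it exchanges
`xy` with `x² + xy - y²`, up to constants, and preserves the octic factor. -/
theorem icosahedral_reflection {t : ℂ} (ht : t ^ 2 + t = 1) (x y : ℂ) :
    (-x + t * y) ^ 11 * (t * x + y) + 11 * ((-x + t * y) ^ 6 * (t * x + y) ^ 6) -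
        (-x + t * y) * (t * x + y) ^ 11 =
      125 * t ^ 6 * (x ^ 11 * y + 11 * (x ^ 6 * y ^ 6) - x * y ^ 11) := by
  have hfac : ∀ x y : ℂ, x ^ 11 * y + 11 * (x ^ 6 * y ^ 6) - x * y ^ 11 =
      (x * y) * (x ^ 2 + x * y - y ^ 2) * (x ^ 8 - x ^ 7 * y + 2 * x ^ 6 * y ^ 2 -
        3 * x ^ 5 * y ^ 3 + 5 * x ^ 4 * y ^ 4 + 3 * x ^ 3 * y ^ 5 + 2 * x ^ 2 * y ^ 6 + x * y ^ 7 +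
        y ^ 8) := fun x y => by ring
  have h1 : (-x + t * y) * (t * x + y) = -t * (x ^ 2 + x * y - y ^ 2) := by
    linear_combination x * y * ht
  have h2 : (-x + t * y) ^ 2 + (-x + t * y) * (t * x + y) - (t * x + y) ^ 2 =
      -(5 * t) * (x * y) := by
    linear_combination (y ^ 2 - x ^ 2 + x * y) * ht
  have h4 : t ^ 4 = 2 - 3 * t := by linear_combination (t ^ 2 - t + 2) * ht
  have h8 := icosahedral_octic ht x y
  simp only at h8
  rw [hfac, hfac x y, h2, h8, h1]
  have h6 : 125 * t ^ 6 = 5 * t ^ 2 * (50 - 75 * t) := by linear_combination 125 * t ^ 2 * h4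
  rw [h6]
  ring

/-- 96 linear automorphisms of the foliation `P₅`. -/
theorem exists_octahedral_automorphisms : ∃ m : (rootsOfUnity 4 ℂ × rootsOfUnity 4 ℂ) ⊕
    (rootsOfUnity 4 ℂ × rootsOfUnity 4 ℂ) ⊕ (rootsOfUnity 4 ℂ × rootsOfUnity 4 ℂ × rootsOfUnity 4 ℂ)
      → GL (Fin 2) ℂ, Function.Injective m ∧
    ∀ i, bernoulliFive.Invariant (affineEmbedding (m i)) := by
  -- For the third family the form is multiplied by `8 η⁶ c a b` and the determinant is `-2 η² c a
  -- b`; they agree when `η⁴ = -1/4`.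
  obtain ⟨η, hη⟩ := IsAlgClosed.exists_pow_nat_eq (-1 / 4 : ℂ) (n := 4) (by norm_num)
  have hη0 : η ≠ 0 := by
    rintro rfl
    norm_num at hη
  refine ⟨Sum.elim
    (fun p => matrixTwo (p.1 : ℂˣ) 0 0 (p.2 : ℂˣ) (by simp))
    (Sum.elim (fun p => matrixTwo 0 (p.1 : ℂˣ) (p.2 : ℂˣ) 0 (by simp))
    (fun p => matrixTwo (η * (p.1 : ℂˣ) * (p.2.1 : ℂˣ)) (η * (p.1 : ℂˣ) * (p.2.2 : ℂˣ))
      (η * (p.2.1 : ℂˣ)) (-(η * (p.2.2 : ℂˣ))) (by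
        have h : -2 * η ^ 2 * (p.1 : ℂˣ).val * (p.2.1 : ℂˣ).val * (p.2.2 : ℂˣ).val ≠ 0 := by
          simp [hη0]
        intro h'
        apply h
        linear_combination h'))), ?_, ?_⟩
  -- The positions of the zero entries tell the three families apart.
  · rintro (⟨a, b⟩ | ⟨a, b⟩ | ⟨c, a, b⟩) (⟨a', b'⟩ | ⟨a', b'⟩ | ⟨c', a', b'⟩) h <;>
      obtain ⟨h1, h2, h3, h4⟩ := entries_eq rfl rfl h
    · obtain rfl := rootsOfUnity_ext h1
      obtain rfl := rootsOfUnity_ext h4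
      rfl
    · exact absurd h1 (rootsOfUnity_ne_zero a)
    · exact absurd h3.symm (mul_ne_zero hη0 (rootsOfUnity_ne_zero a'))
    · exact absurd h1.symm (rootsOfUnity_ne_zero a')
    · obtain rfl := rootsOfUnity_ext h2
      obtain rfl := rootsOfUnity_ext h3
      rfl
    · exact absurd h4.symm (neg_ne_zero.2 (mul_ne_zero hη0 (rootsOfUnity_ne_zero b')))
    · exact absurd h3 (mul_ne_zero hη0 (rootsOfUnity_ne_zero a))
    · exact absurd h4 (neg_ne_zero.2 (mul_ne_zero hη0 (rootsOfUnity_ne_zero b)))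
    · obtain rfl : a = a' := rootsOfUnity_ext (mul_left_cancel₀ hη0 h3)
      obtain rfl : b = b' := rootsOfUnity_ext (mul_left_cancel₀ hη0 (neg_injective h4))
      obtain rfl : c = c' := rootsOfUnity_ext
        (mul_left_cancel₀ hη0 (mul_right_cancel₀ (rootsOfUnity_ne_zero a) h1))
      rfl
  · rintro (⟨a, b⟩ | ⟨a, b⟩ | ⟨c, a, b⟩) <;> refine bernoulliFive_invariant rfl fun x y => ?_ <;>
      have ha := rootsOfUnity_pow a <;> have hb := rootsOfUnity_pow b <;>
      generalize (a : ℂˣ).val = a at * <;> generalize (b : ℂˣ).val = b at *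
    · linear_combination a * b * x ^ 5 * y * ha - a * b * x * y ^ 5 * hb
    · linear_combination a * b * x * y ^ 5 * ha - a * b * x ^ 5 * y * hb
    · have hc := rootsOfUnity_pow c
      generalize (c : ℂˣ).val = c at *
      linear_combination η ^ 6 * c * (a * x + b * y) ^ 5 * (a * x - b * y) * hc +
        8 * η ^ 6 * c * a * b * (x ^ 5 * y * ha - x * y ^ 5 * hb) +
        8 * η ^ 2 * c * a * b * (x ^ 5 * y - x * y ^ 5) * hη

/-- The involution is combined with the diagonal maps `(a, b)` and `(c, 1)`, each of which
multiplies the form by its determinant; `η` rescales the involution so that its own factor becomes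
its determinant. -/
theorem icosahedral_scaling {t η a b c : ℂ} (ht : t ^ 2 + t = 1)
    (hη : η ^ 10 * (125 * t ^ 6) = -(1 + t ^ 2)) (ha : a ^ 10 = 1) (hab : (a * b) ^ 5 = 1)
    (hc : c ^ 5 = 1) (x y : ℂ) :
    let u := η * (-(a * x) + t * (b * y))
    let v := η * (t * (a * x) + b * y)
    (c * u) ^ 11 * v + 11 * ((c * u) ^ 6 * v ^ 6) - c * u * v ^ 11 =
      -(c * (a * b) * η ^ 2 * (1 + t ^ 2)) * (x ^ 11 * y + 11 * (x ^ 6 * y ^ 6) - x * y ^ 11) := by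
  have hcol : ∀ u v : ℂ, (c * u) ^ 11 * v + 11 * ((c * u) ^ 6 * v ^ 6) - c * u * v ^ 11 =
      c * (u ^ 11 * v + 11 * (u ^ 6 * v ^ 6) - u * v ^ 11) := fun u v => by
    linear_combination (c * (c ^ 5 + 1) * u ^ 11 * v + 11 * c * u ^ 6 * v ^ 6) * hc
  have hη12 : ∀ u v : ℂ, (η * u) ^ 11 * (η * v) + 11 * ((η * u) ^ 6 * (η * v) ^ 6) -
      η * u * (η * v) ^ 11 = η ^ 12 * (u ^ 11 * v + 11 * (u ^ 6 * v ^ 6) - u * v ^ 11) :=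
    fun u v => by ring
  have hb : b ^ 10 = 1 := by
    linear_combination ((a * b) ^ 5 + 1) * hab - b ^ 10 * ha
  have hdiag : (a * x) ^ 11 * (b * y) + 11 * ((a * x) ^ 6 * (b * y) ^ 6) - a * x * (b * y) ^ 11 =
      a * b * (x ^ 11 * y + 11 * (x ^ 6 * y ^ 6) - x * y ^ 11) := by
    linear_combination a * b * x ^ 11 * y * ha + 11 * (a * b) * x ^ 6 * y ^ 6 * hab -
      a * b * x * y ^ 11 * hb
  intro u v
  rw [hcol, hη12, icosahedral_reflection ht, hdiag]
  linear_combination c * (a * b) * η ^ 2 * (x ^ 11 * y + 11 * (x ^ 6 * y ^ 6) - x * y ^ 11) * hη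

/-- 500 linear automorphisms of the foliation `P₁₁`. -/
theorem exists_icosahedral_automorphisms : ∃ m :
    (rootsOfUnity 5 ℂ × rootsOfUnity 10 ℂ × rootsOfUnity 5 ℂ) ⊕
      (rootsOfUnity 5 ℂ × rootsOfUnity 10 ℂ × rootsOfUnity 5 ℂ) → GL (Fin 2) ℂ,
    Function.Injective m ∧ ∀ i, bernoulliEleven.Invariant (affineEmbedding (m i)) := by
  obtain ⟨t, ht⟩ : ∃ t : ℂ, t ^ 2 + t = 1 := by
    obtain ⟨s, hs⟩ := IsAlgClosed.exists_pow_nat_eq (5 : ℂ) (n := 2) (by norm_num)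
    exact ⟨(s - 1) / 2, by linear_combination hs / 4⟩
  have ht0 : t ≠ 0 := by
    rintro rfl
    norm_num at ht
  -- Reduction by `t² = 1 - t` gives `t¹⁰ = 34 - 55 t`. The fact separates the two families below.
  have ht10 : t ^ 10 ≠ 1 := by
    intro h
    have h1 : 55 * t = 33 := by
      linear_combination (t ^ 8 - t ^ 7 + 2 * t ^ 6 - 3 * t ^ 5 + 5 * t ^ 4 - 8 * t ^ 3 +
        13 * t ^ 2 - 21 * t + 34) * ht - h
    have h2 : t = 3 / 5 := by linear_combination h1 / 55
    rw [h2] at ht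
    norm_num at ht
  have ht2 : 1 + t ^ 2 ≠ 0 := by
    intro h
    have h1 : t = 2 := by linear_combination ht - h
    rw [h1] at ht
    norm_num at ht
  obtain ⟨η, hη⟩ := IsAlgClosed.exists_pow_nat_eq (-(1 + t ^ 2) / (125 * t ^ 6)) (n := 10)
    (by norm_num)
  rw [eq_div_iff (by simp [ht0])] at hη
  have hη0 : η ≠ 0 := by
    rintro rfl
    exact neg_ne_zero.2 ht2 (by rw [← hη]; norm_num)
  have hdet : ∀ p : rootsOfUnity 5 ℂ × rootsOfUnity 10 ℂ × rootsOfUnity 5 ℂ,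
      η ^ 2 * (1 + t ^ 2) * (p.1 : ℂˣ).val * (p.2.1 : ℂˣ).val *
        ((p.2.1 : ℂˣ).val⁻¹ * (p.2.2 : ℂˣ).val) ≠ 0 := by
    simp [hη0, ht2]
  -- The diagonal entries are `a` and `b = a⁻¹ z`, so that `(a b) ^ 5 = 1`. The second family
  -- composes with `(X, Y) ↦ (Y, -X)`, which preserves the form and has determinant 1. No entry
  -- vanishes, so the monomial automorphisms are left out; the bound does without them.
  refine ⟨Sum.elim
    (fun p => matrixTwo (-(η * (p.1 : ℂˣ) * (p.2.1 : ℂˣ)))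
      (η * t * (p.1 : ℂˣ) * ((p.2.1 : ℂˣ).val⁻¹ * (p.2.2 : ℂˣ)))
      (η * t * (p.2.1 : ℂˣ)) (η * ((p.2.1 : ℂˣ).val⁻¹ * (p.2.2 : ℂˣ)))
      fun h => hdet p (by linear_combination -h))
    (fun p => matrixTwo (η * t * (p.1 : ℂˣ) * (p.2.1 : ℂˣ))
      (η * (p.1 : ℂˣ) * ((p.2.1 : ℂˣ).val⁻¹ * (p.2.2 : ℂˣ)))
      (η * (p.2.1 : ℂˣ)) (-(η * t * ((p.2.1 : ℂˣ).val⁻¹ * (p.2.2 : ℂˣ))))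
      fun h => hdet p (by linear_combination -h)), ?_, ?_⟩
  -- The lower left entries of the two families have different tenth powers, by `ht10`.
  · have hcross : ∀ a a' : rootsOfUnity 10 ℂ, η * t * (a : ℂˣ).val ≠ η * (a' : ℂˣ).val := by
      intro a a' h
      apply ht10
      have h1 : t * (a : ℂˣ).val = (a' : ℂˣ).val :=
        mul_left_cancel₀ hη0 (by linear_combination h)
      have h2 := congrArg (· ^ 10) h1
      simpa only [mul_pow, rootsOfUnity_pow, mul_one] using h2
    rintro (⟨c, a, z⟩ | ⟨c, a, z⟩) (⟨c', a', z'⟩ | ⟨c', a', z'⟩) h <;>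
      obtain ⟨h1, -, h3, h4⟩ := entries_eq rfl rfl h
    · obtain rfl : a = a' := rootsOfUnity_ext (mul_left_cancel₀ (mul_ne_zero hη0 ht0) h3)
      obtain rfl : z = z' := rootsOfUnity_ext
        (mul_left_cancel₀ (inv_ne_zero (rootsOfUnity_ne_zero a)) (mul_left_cancel₀ hη0 h4))
      obtain rfl : c = c' := rootsOfUnity_ext
        (mul_left_cancel₀ hη0 (mul_right_cancel₀ (rootsOfUnity_ne_zero a) (neg_injective h1)))
      rfl
    · exact absurd h3 (hcross a a')
    · exact absurd h3.symm (hcross a' a)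
    · obtain rfl : a = a' := rootsOfUnity_ext (mul_left_cancel₀ hη0 h3)
      obtain rfl : z = z' := rootsOfUnity_ext
        (mul_left_cancel₀ (inv_ne_zero (rootsOfUnity_ne_zero a))
          (mul_left_cancel₀ (mul_ne_zero hη0 ht0) (neg_injective h4)))
      obtain rfl : c = c' := rootsOfUnity_ext (mul_left_cancel₀ (mul_ne_zero hη0 ht0)
        (mul_right_cancel₀ (rootsOfUnity_ne_zero a) h1))
      rfl
  · have key : ∀ (c : rootsOfUnity 5 ℂ) (a : rootsOfUnity 10 ℂ) (z : rootsOfUnity 5 ℂ) (ε : ℂ),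
        ε ^ 5 = 1 → _ := fun c a z ε hε =>
      icosahedral_scaling (b := (a : ℂˣ).val⁻¹ * (z : ℂˣ).val) ht hη (rootsOfUnity_pow a) (by
        rw [mul_inv_cancel_left₀ (rootsOfUnity_ne_zero a), rootsOfUnity_pow]) hε
    rintro (⟨c, a, z⟩ | ⟨c, a, z⟩) <;> refine bernoulliEleven_invariant rfl fun x y => ?_
    · have := key c a z _ (rootsOfUnity_pow c) x y
      simp only at this ⊢
      generalize (a : ℂˣ).val⁻¹ * (z : ℂˣ).val = b at *
      convert this using 1 <;> ring
    -- The scaling by `c` now acts on the other row, so the identity is taken with `c = 1` and the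
    -- factor is restored at the end.
    · have := key c a z 1 (one_pow 5) x y
      have hc := rootsOfUnity_pow c
      simp only at this ⊢
      generalize (a : ℂˣ).val⁻¹ * (z : ℂˣ).val = b at *
      generalize (c : ℂˣ).val = c at *
      generalize (a : ℂˣ).val = a at *
      have e1 : η * t * c * a * x + η * c * b * y = c * (η * (t * (a * x) + b * y)) := by ring
      have e2 : η * a * x + -(η * t * b) * y = -(η * (-(a * x) + t * (b * y))) := by ring
      rw [e1, e2]
      generalize η * (t * (a * x) + b * y) = v at *
      generalize η * (-(a * x) + t * (b * y)) = u at *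
      linear_combination c * this - (c * (c ^ 5 + 1) * v ^ 11 * u - 11 * c * u ^ 6 * v ^ 6) * hc

end PlaneFoliation

end

/-! ### The theorem -/

open PlaneFoliation in
theorem mainTheorem6 (d : ℕ) (F : Foliation d) (hfin : Finite F.aut)
    (T : GL (Fin 3) ℂ) (G : Subgroup (GL (Fin 2) ℂ))
    (hG : F.aut = ((G.map affineEmbedding).map (MulAut.conj T).toMonoidHom).map projective)
    (hpoly : IsPolyhedral (projectivization G)) :
    3 * (d ^ 2 + d + 1) ≤ Nat.card F.aut ↔
      F.Equivalent bernoulliFive ∨ F.Equivalent bernoulliEleven := by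
  have hmem : ∀ A, F.Invariant (T * affineEmbedding A * T⁻¹) ↔
      (F.transport T).Invariant (affineEmbedding A) := fun A =>
    (F.invariant_transport_iff T _).symm
  constructor
  · intro hcard
    have hinv : ∀ A ∈ G, (F.transport T).Invariant (affineEmbedding A) := by
      intro A hA
      rw [← hmem, ← F.projective_mem_aut_iff, hG]
      exact ⟨_, ⟨_, ⟨A, hA, rfl⟩, rfl⟩, rfl⟩
    have hc : Nat.card F.aut = Nat.card G := by
      rw [hG, Subgroup.map_map, Subgroup.map_map]
      exact Nat.card_image_of_injective (projective_conj_injective T) G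
    -- If every homothety preserved the foliation, `ℂˣ` would embed in the finite group `F.aut`.
    have hscal : ∃ u : ℂˣ, ¬ (F.transport T).Invariant
        (affineEmbedding (Matrix.GeneralLinearGroup.scalar (Fin 2) u)) := by
      by_contra! hall
      have hinj : Function.Injective fun u : ℂˣ =>
          (⟨projective (T * affineEmbedding (Matrix.GeneralLinearGroup.scalar (Fin 2) u) * T⁻¹),
            (F.projective_mem_aut_iff _).2 ((hmem _).2 (hall u))⟩ : F.aut) := by
        intro u v huv
        have h1 := projective_conj_injective T (congrArg Subtype.val huv)
        have h2 := congrArg (fun A : GL (Fin 2) ℂ => A 0 0) h1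
        exact Units.ext (by simpa using h2)
      have := Finite.of_injective _ hinj
      have : Finite ℂ := Finite.of_finite_univ ((Set.finite_range (Units.val : ℂˣ → ℂ)).insert 0
        |>.subset fun z _ => by
          by_cases hz : z = 0
          · exact Or.inl hz
          · exact Or.inr ⟨Units.mk0 z hz, rfl⟩)
      exact not_finite ℂ
    rw [hc] at hcard
    exact (equivalent_of_card_le hinv hscal hpoly hcard).imp
      (Foliation.Equivalent.of_transport T) (Foliation.Equivalent.of_transport T)
  · rintro (h | h)
    · obtain rfl := h.degree_eq
      obtain ⟨m, hm, hm'⟩ := exists_octahedral_automorphisms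
      refine le_trans ?_ (h.card_le hm hm')
      -- The count is `16 + 16 + 64 = 96`, against `3 * 31 = 93`.
      simp only [Nat.card_sum, Nat.card_prod, Complex.card_rootsOfUnity]
      norm_num
    · obtain rfl := h.degree_eq
      obtain ⟨m, hm, hm'⟩ := exists_icosahedral_automorphisms
      refine le_trans ?_ (h.card_le hm hm')
      -- The count is `250 + 250 = 500`, against `3 * 133 = 399`.
      simp only [Nat.card_sum, Nat.card_prod, Complex.card_rootsOfUnity]
      norm_num
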